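/- **Setting.** Let $\mathbb T=\mathbb R/2\pi\mathbb Z$ and let $H^m$ denote the $L^2$-based Sobolev space of order $m$ on $\mathbb T$, with norm $\|f\|_{H^m}=\big(\sum_{n\in\mathbb Z}(1+n^2)^m|\hat f(n)|^2\big)^{1/2}$. For real constants $P,J_X,\Lambda,\ell,a$ and $U=(w_0,w_1,w_2,\psi,\eta,\xi)^{\rm tr}$ set $$\mathfrak b_P=P^2(1+\psi)\xi^2,\quad \mathfrak b_{J_X}=J_X^2t^{2(1-2\ell)}w_0^4(1+\psi)\xi^2,\quad \mathfrak b_\Lambda=2\Lambda t^{2(2-\ell)}w_0^2(1+\psi)\xi^2,\quad \mathfrak b=\mathfrak b_P+\mathfrak b_{J_X}+2\mathfrak b_\Lambda,$$ $\mathbb P=\mathrm{diag}(1,0,1,0,1,1)$, $\mathbb P^\perp=1-\mathbb P$, $B^0=\mathrm{diag}(1,1,1+\psi,1,1,4)$; let $B^1$ be the $6\times6$ matrix whose only non-zero entries are the $(2,3)$ and $(3,2)$ entries, both equal to $-(1+\psi)$; let $\mathcal B$ be the matrix with diagonal $\big(\ell-a-w_1,\,1,\,1+\psi,\,1,\,1-\mathfrak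 b,\,4((a+w_1)^2-1+w_2^2(1+\psi))+\mathfrak b\big)$ and with $(5,3)$ entry $4(1+\psi)(\mathfrak b_{J_X}+\mathfrak b_\Lambda-(a+w_1)\mathfrak b)$ as its only non-zero off-diagonal entry; and let $F=\big(0,\tfrac12(w_2\eta+\mathfrak b_{J_X}+\mathfrak b_\Lambda-(a+w_1)\mathfrak b),0,-(1+\psi)\mathfrak b,0,0\big)^{\rm tr}$. Consider the initial value problem, posed for $t\in(0,T_0]$, $$B^0\partial_tU+B^1\partial_\theta U=\tfrac1t\mathcal B\,\mathbb PU+\tfrac1tF,\qquad U(T_0)=\mathring U. \tag{E}$$ **Proposition.** Let $T_0>0$, let $k\ge 3$ be an integer, let $P\in\mathbb R$, and let $J_X,\Lambda,\ell,a\in\mathbb R$ satisfy one of 1. $J_X\neq0$, $a<\ell\le\frac12$ and $a<-1$; 2. $J_X=0$, $\Lambda\ne0$, $a<\ell\le2$ and $a\in(-\infty,-1)\cup(1,2)$; 3. $J_X=\Lambda=0$, $a<\ell$ and $a\in(-\infty,-1)\cup(1,\infty)$. Put $\kappa_0=\min\{1,a^2-1,\ell-a\}$ and let $\sigma\in(0,2\kappa_0/3)$.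 Then there are $R_0>0$ and $C$, depending only on $T_0,k,\sigma,P,J_X,\Lambda,\ell,a$, such that the following holds for every $\mathring U=(\mathring w_0,\mathring w_1,\mathring w_2,\mathring\psi,\mathring\eta,\mathring\xi)^{\rm tr}\in H^k(\mathbb T,\mathbb R^6)$ with $\mathring w_0>0$, $\mathring\xi>0$ and $\|\mathring U\|_{H^k}<R_0$, and every solution $$U=(w_0,w_1,w_2,\psi,\eta,\xi)^{\rm tr}\in C^0((0,T_0],H^k)\cap L^\infty((0,T_0],H^k)\cap C^1((0,T_0],H^{k-1})$$ of (E). One has $w_0,\xi>0$ on $(0,T_0]\times\mathbb T$. The limit $\lim_{t\searrow0}\mathbb P^\perp U(t)=(0,\tilde w_1,0,\tilde\psi,0,0)$ exists in $H^{k-1}$, and $1+\tilde\psi>0$. There are $\tilde w_2,\tilde\eta\in H^{k-2}$ and $\tilde u,\tilde\nu\in H^{k-1}$ such that for all $t\in(0,T_0]$ $$\|t^{-1}w_2(t)-\ln(t)\,\partial_\theta\tilde w_1-\tilde w_2\|_{H^{k-2}}\le C(t+t^{2\kappa_0-3\sigma}),\qquad \|t^{-1}\eta(t)-\tilde\eta\|_{H^{k-2}}\le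 C(t+t^{2\kappa_0-3\sigma}),$$ $$\|\ln w_0(t)+(a+\tilde w_1-\ell)\ln t-\tilde u\|_{H^{k-1}}\le C(t+t^{2\kappa_0-2\sigma}),\qquad \|\ln\xi(t)+(1-(a+\tilde w_1)^2)\ln t-\tilde\nu\|_{H^{k-1}}\le C(t+t^{2\kappa_0-2\sigma}).$$ Furthermore, if at $t=T_0$ the data satisfy the constraint $$t\,\partial_\theta\xi=2w_2(a+w_1)\xi-\frac{\eta\,\xi}{2(1+\psi)},$$ together with the constraints $\partial_\theta w_0=-\frac1t w_2w_0$ and $\partial_\theta\psi=\frac1t\eta$ (which say that $w_2$ and $\eta$ are $t$ times the $\theta$-derivatives of the metric functions $u=\ell\ln t-\ln w_0$ and $\alpha=1+\psi$), then $$\partial_\theta\tilde\nu-2(a+\tilde w_1)\tilde w_2+\tfrac12(1+\tilde\psi)^{-1}\tilde\eta=0 .$$ -/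

import Mathlib

open Real Set Filter Topology

namespace PolarisedT2

noncomputable section

/-- The circle `𝕋 = ℝ / 2πℤ`. -/
abbrev Circ : Type := AddCircle (2 * π)

instance factTwoPiPos : Fact (0 < 2 * π) := ⟨Real.two_pi_pos⟩

/-! ### Sobolev spaces on the circle -/

/-- The terms `(1 + n²)^m |f̂(n)|²`, `n ∈ ℤ`, whose sum is the squared `H^m` norm of `f`. -/
def sobTerm (m : ℕ) (f : Circ → ℝ) (n : ℤ) : ℝ :=
  (1 + (n : ℝ) ^ 2) ^ m * ‖fourierCoeff (fun x => (f x : ℂ)) n‖ ^ 2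

/-- `f ∈ H^m(𝕋)`, for `m ≥ 1`. Every class in `H^m(𝕋)` with `m ≥ 1` has exactly one continuous
representative, and elements of `H^m(𝕋)` are identified with that representative. -/
def MemH (m : ℕ) (f : Circ → ℝ) : Prop :=
  Continuous f ∧ Summable (sobTerm m f)

/-- The norm of `H^m(𝕋)` (meaningful when `MemH m f`). -/
def normH (m : ℕ) (f : Circ → ℝ) : ℝ :=
  √(∑' n : ℤ, sobTerm m f n)

/-- `V ∈ H^m(𝕋, ℝ⁶)`. -/
def MemHv (m : ℕ) (V : Fin 6 → Circ → ℝ) : Prop :=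
  ∀ i, MemH m (V i)

/-- The norm of `H^m(𝕋, ℝ⁶)`. -/
def normHv (m : ℕ) (V : Fin 6 → Circ → ℝ) : ℝ :=
  √(∑ i, normH m (V i) ^ 2)

/-- `‖f‖_{H^m} ≤ B`, including the assertion `f ∈ H^m(𝕋)`. -/
def BoundH (m : ℕ) (f : Circ → ℝ) (B : ℝ) : Prop :=
  MemH m f ∧ normH m f ≤ B

/-- The derivative `∂_θ f` on the circle. -/
def dθ (f : Circ → ℝ) (x : Circ) : ℝ :=
  deriv (fun s : ℝ => f (x + (s : Circ))) 0

/-- `V ∈ C⁰(I, H^m(𝕋, ℝ⁶))`. -/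
def ContH (m : ℕ) (I : Set ℝ) (V : ℝ → Fin 6 → Circ → ℝ) : Prop :=
  (∀ t ∈ I, MemHv m (V t)) ∧
    ∀ t ∈ I, Tendsto (fun s => normHv m (V s - V t)) (𝓝[I] t) (𝓝 0)

/-- `V ∈ C¹(I, H^m(𝕋, ℝ⁶))` with time derivative `V'` (one-sided at an endpoint of `I`). -/
def ContDerivH (m : ℕ) (I : Set ℝ) (V V' : ℝ → Fin 6 → Circ → ℝ) : Prop :=
  (∀ t ∈ I, MemHv m (V t)) ∧ ContH m I V' ∧
    ∀ t ∈ I, Tendsto (fun s => normHv m ((s - t)⁻¹ • (V s - V t) - V' t))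
      (𝓝[I \ {t}] t) (𝓝 0)

/-! ### The Fuchsian system

A state `v : Fin 6 → ℝ` lists the values of `(w₀, w₁, w₂, ψ, η, ξ)`, in this order. -/

/-- `𝔟_P = P² (1 + ψ) ξ²`. -/
def bP (P : ℝ) (v : Fin 6 → ℝ) : ℝ := P ^ 2 * (1 + v 3) * v 5 ^ 2

/-- `𝔟_{J_X} = J_X² t^{2(1 - 2ℓ)} w₀⁴ (1 + ψ) ξ²`. -/
def bJ (J ℓ t : ℝ) (v : Fin 6 → ℝ) : ℝ :=
  J ^ 2 * t ^ (2 * (1 - 2 * ℓ)) * v 0 ^ 4 * (1 + v 3) * v 5 ^ 2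

/-- `𝔟_Λ = 2 Λ t^{2(2 - ℓ)} w₀² (1 + ψ) ξ²`. -/
def bΛ (Λ ℓ t : ℝ) (v : Fin 6 → ℝ) : ℝ :=
  2 * Λ * t ^ (2 * (2 - ℓ)) * v 0 ^ 2 * (1 + v 3) * v 5 ^ 2

/-- `𝔟 = 𝔟_P + 𝔟_{J_X} + 2 𝔟_Λ`. -/
def bTot (P J Λ ℓ t : ℝ) (v : Fin 6 → ℝ) : ℝ :=
  bP P v + bJ J ℓ t v + 2 * bΛ Λ ℓ t v

/-- The projection `ℙ`. -/
def matP : Matrix (Fin 6) (Fin 6) ℝ :=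
  !![1, 0, 0, 0, 0, 0;
     0, 0, 0, 0, 0, 0;
     0, 0, 1, 0, 0, 0;
     0, 0, 0, 0, 0, 0;
     0, 0, 0, 0, 1, 0;
     0, 0, 0, 0, 0, 1]

/-- The matrix `B⁰`. -/
def matB0 (v : Fin 6 → ℝ) : Matrix (Fin 6) (Fin 6) ℝ :=
  !![1, 0, 0, 0, 0, 0;
     0, 1, 0, 0, 0, 0;
     0, 0, 1 + v 3, 0, 0, 0;
     0, 0, 0, 1, 0, 0;
     0, 0, 0, 0, 1, 0;
     0, 0, 0, 0, 0, 4]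

/-- The matrix `B¹`. -/
def matB1 (v : Fin 6 → ℝ) : Matrix (Fin 6) (Fin 6) ℝ :=
  !![0, 0, 0, 0, 0, 0;
     0, 0, -(1 + v 3), 0, 0, 0;
     0, -(1 + v 3), 0, 0, 0, 0;
     0, 0, 0, 0, 0, 0;
     0, 0, 0, 0, 0, 0;
     0, 0, 0, 0, 0, 0]

/-- The matrix `𝓑`. -/
def matB (P J Λ ℓ a t : ℝ) (v : Fin 6 → ℝ) : Matrix (Fin 6) (Fin 6) ℝ :=
  !![ℓ - a - v 1, 0, 0, 0, 0, 0;
     0, 1, 0, 0, 0, 0;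
     0, 0, 1 + v 3, 0, 0, 0;
     0, 0, 0, 1, 0, 0;
     0, 0, 4 * (1 + v 3) * (bJ J ℓ t v + bΛ Λ ℓ t v - (a + v 1) * bTot P J Λ ℓ t v), 0,
       1 - bTot P J Λ ℓ t v, 0;
     0, 0, 0, 0, 0, 4 * ((a + v 1) ^ 2 - 1 + v 2 ^ 2 * (1 + v 3)) + bTot P J Λ ℓ t v]

/-- The source term `F`. -/
def vecF (P J Λ ℓ a t : ℝ) (v : Fin 6 → ℝ) : Fin 6 → ℝ :=
  ![0,
    1 / 2 * (v 2 * v 4 + bJ J ℓ t v + bΛ Λ ℓ t v - (a + v 1) * bTot P J Λ ℓ t v),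
    0,
    -(1 + v 3) * bTot P J Λ ℓ t v,
    0,
    0]

/-- The values at `x` of the six component functions of `V`. -/
def stateAt (V : Fin 6 → Circ → ℝ) (x : Circ) : Fin 6 → ℝ := fun i => V i x

/-- The function `ℙ^⊥ V`, where `ℙ^⊥ = 1 - ℙ`. -/
def perpPart (V : Fin 6 → Circ → ℝ) : Fin 6 → Circ → ℝ :=
  fun i x => Matrix.mulVec (1 - matP) (stateAt V x) i

/-- The equation `B⁰ ∂_t U + B¹ ∂_θ U = (1/t) 𝓑 ℙ U + (1/t) F` at the time `t`, on all of `𝕋`, for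
`V = U(t)` and `V' = ∂_t U(t)`. -/
def EvolutionEq (P J Λ ℓ a t : ℝ) (V V' : Fin 6 → Circ → ℝ) : Prop :=
  ∀ x : Circ,
    Matrix.mulVec (matB0 (stateAt V x)) (stateAt V' x)
        + Matrix.mulVec (matB1 (stateAt V x)) (stateAt (fun i => dθ (V i)) x)
      = (1 / t) • Matrix.mulVec (matB P J Λ ℓ a t (stateAt V x))
            (Matrix.mulVec matP (stateAt V x))
        + (1 / t) • vecF P J Λ ℓ a t (stateAt V x)

/-- `U ∈ C⁰((0,T₀], H^k) ∩ L^∞((0,T₀], H^k) ∩ C¹((0,T₀], H^{k-1})` solves the evolution equation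
on `(0,T₀] × 𝕋` with `U(T₀) = U₀`. -/
def IsSolution (P J Λ ℓ a T₀ : ℝ) (k : ℕ) (U₀ : Fin 6 → Circ → ℝ)
    (U : ℝ → Fin 6 → Circ → ℝ) : Prop :=
  ContH k (Ioc 0 T₀) U ∧
  (∃ M : ℝ, ∀ t ∈ Ioc 0 T₀, normHv k (U t) ≤ M) ∧
  (∃ U' : ℝ → Fin 6 → Circ → ℝ, ContDerivH (k - 1) (Ioc 0 T₀) U U' ∧
    ∀ t ∈ Ioc 0 T₀, EvolutionEq P J Λ ℓ a t (U t) (U' t)) ∧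
  U T₀ = U₀

/-- The three admissible ranges of the constants `J_X, Λ, ℓ, a`. -/
def Admissible (J Λ ℓ a : ℝ) : Prop :=
  (J ≠ 0 ∧ a < ℓ ∧ ℓ ≤ 1 / 2 ∧ a < -1) ∨
  (J = 0 ∧ Λ ≠ 0 ∧ a < ℓ ∧ ℓ ≤ 2 ∧ (a < -1 ∨ (1 < a ∧ a < 2))) ∨
  (J = 0 ∧ Λ = 0 ∧ a < ℓ ∧ (a < -1 ∨ 1 < a))

/-- `κ₀ = min {1, a² - 1, ℓ - a}`. -/
def kappa0 (ℓ a : ℝ) : ℝ := min 1 (min (a ^ 2 - 1) (ℓ - a))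

/-! ### Constraints -/

/-- `t ∂_θ ξ = 2 w₂ (a + w₁) ξ - η ξ / (2 (1 + ψ))` on `𝕋`. -/
def ConstraintXi (a t : ℝ) (V : Fin 6 → Circ → ℝ) : Prop :=
  ∀ x, t * dθ (V 5) x
    = 2 * V 2 x * (a + V 1 x) * V 5 x - V 4 x * V 5 x / (2 * (1 + V 3 x))

/-- `∂_θ w₀ = -(1/t) w₂ w₀` on `𝕋`. -/
def ConstraintW (t : ℝ) (V : Fin 6 → Circ → ℝ) : Prop :=
  ∀ x, dθ (V 0) x = -(1 / t) * V 2 x * V 0 x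

/-- `∂_θ ψ = (1/t) η` on `𝕋`. -/
def ConstraintPsi (t : ℝ) (V : Fin 6 → Circ → ℝ) : Prop :=
  ∀ x, dθ (V 3) x = 1 / t * V 4 x

end

end PolarisedT2

open PolarisedT2

namespace PolarisedT2

noncomputable section

/-! ### Square-summable sequences -/

/-! Write `κ` for `κ₀` and solve (E) for `t ∂_t U`. The components `w₀`, `w₂`, `η`, `ξ` have linear
coefficients `ℓ - a`, `1`, `1`, `a² - 1`, all at least `κ > 0`, so they are damped as `t` decreases.
The components `w₁` and `ψ` have no linear term; their singular sources are quadratic in `w₂`, `η`,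
`ξ`. The only derivative terms, `(1 + ψ) ∂_θ w₂` and `∂_θ w₁`, carry no factor `1/t` and are
symmetric once `w₂` is weighted by `1 + ψ`.

Smallness in `H^k` comes from an energy estimate. The singular nonlinear terms contribute at most a
multiple of `d g² / t`, where `d` bounds `U` and `g` bounds the damped components. The damping
contributes `κ g² / t`, so for small `d` it wins, and what remains is a Gronwall inequality with a
bounded rate. Since `U` is `C¹` only into `H^{k-1}`, the energy is formed with regularised
derivatives of order `k`, whose commutators are controlled uniformly in the regularisation
(`nrm2_comm_le`, `energyDot_ge`, `energy_integral_le`). A continuity argument closes the estimate in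
`small_of_small_data`.

After that the problem is one of ordinary differential equations in `H^{k-1}`. A small perturbation
costs an arbitrarily small power, so `ξ = O(t^{κ - σ})` and `𝔟 = O(t^{2κ - 2σ})`. Dividing by `t`
removes the linear terms of `w₂` and `η`: `w₂ / t` grows more slowly than a small negative power,
and `η / t` stays bounded. Hence `∂_t w₁` and `∂_t ψ` are integrable at `0`, which yields `w̃₁` and
`ψ̃`. Subtracting the leading logarithms from `w₂ / t`, `ln w₀` and `ln ξ` leaves quantities with
integrable time derivatives, and integration from `0` gives both limits and rates (`exists_limit`,
`exists_limit_of_eval`).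

The defect of the constraint for `w₀` is conserved (`SmallSoln.constraintW`). Once it vanishes, the
other two defects solve a homogeneous linear system (`SmallSoln.hasDeriv_defects`) and so vanish as
well. The asymptotic constraint is the limit of the constraint for `∂_θ ln ξ`, in which the
logarithms cancel. -/

/-- The `ℓ²` norm of a sequence (meaningful when the squares are summable). -/
def l2n (a : ℤ → ℝ) : ℝ := √(∑' n, a n ^ 2)

lemma l2n_nonneg (a : ℤ → ℝ) : 0 ≤ l2n a := Real.sqrt_nonneg _

lemma exists_lp_of_summable_sq {E : Type*} [NormedAddCommGroup E] (a : ℤ → E)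
    (ha : Summable fun n => ‖a n‖ ^ 2) :
    ∃ y : lp (fun _ : ℤ => E) 2, (∀ n, y n = a n) ∧ ‖y‖ = √(∑' n, ‖a n‖ ^ 2) := by
  have h2 : (0 : ℝ) < (2 : ENNReal).toReal := by norm_num
  have hm : Memℓp a 2 := by
    apply memℓp_gen
    simpa using ha
  refine ⟨⟨a, hm⟩, fun n => rfl, ?_⟩
  rw [lp.norm_eq_tsum_rpow h2]
  simp [Real.sqrt_eq_rpow]

lemma lp_summable_sq {E : Type*} [NormedAddCommGroup E] (y : lp (fun _ : ℤ => E) 2) :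
    Summable (fun n => ‖y n‖ ^ 2) ∧ ‖y‖ = √(∑' n, ‖y n‖ ^ 2) := by
  have h2 : (0 : ℝ) < (2 : ENNReal).toReal := by norm_num
  have := (lp.memℓp y).summable h2
  refine ⟨by simpa using this, ?_⟩
  rw [lp.norm_eq_tsum_rpow h2]
  simp [Real.sqrt_eq_rpow]

/-- Domination in `ℓ²` by a sum of two `ℓ²` sequences. -/
lemma l2n_le_of_le {r : ℤ → ℝ} (y z : lp (fun _ : ℤ => ℝ) 2)
    (h : ∀ n, |r n| ≤ y n + z n) :
    Summable (fun n => r n ^ 2) ∧ l2n r ≤ ‖y‖ + ‖z‖ := by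
  obtain ⟨hs, hn⟩ := lp_summable_sq (y + z)
  have hle : ∀ n, r n ^ 2 ≤ ‖(y + z) n‖ ^ 2 := by
    intro n
    have h1 : (y + z) n = y n + z n := rfl
    rw [h1, Real.norm_eq_abs, sq_abs, ← sq_abs (r n)]
    exact pow_le_pow_left₀ (abs_nonneg _) (h n) 2
  have hr : Summable (fun n => r n ^ 2) :=
    Summable.of_nonneg_of_le (fun n => sq_nonneg _) hle hs
  refine ⟨hr, le_trans ?_ (norm_add_le y z)⟩
  rw [hn]
  exact Real.sqrt_le_sqrt (Summable.tsum_le_tsum hle hr hs)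

lemma l2n_mono {r s : ℤ → ℝ} (h : ∀ n, |r n| ≤ s n) (hs : Summable fun n => s n ^ 2) :
    Summable (fun n => r n ^ 2) ∧ l2n r ≤ l2n s := by
  have hle : ∀ n, r n ^ 2 ≤ s n ^ 2 := fun n => by
    rw [← sq_abs (r n)]
    exact pow_le_pow_left₀ (abs_nonneg _) (h n) 2
  have hr : Summable (fun n => r n ^ 2) :=
    Summable.of_nonneg_of_le (fun n => sq_nonneg _) hle hs
  exact ⟨hr, Real.sqrt_le_sqrt (Summable.tsum_le_tsum hle hr hs)⟩

/-- Cauchy–Schwarz for sequences. -/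
lemma abs_tsum_mul_le (a b : ℤ → ℝ) (ha : Summable fun n => a n ^ 2)
    (hb : Summable fun n => b n ^ 2) :
    Summable (fun n => a n * b n) ∧ |∑' n, a n * b n| ≤ l2n a * l2n b := by
  obtain ⟨y, hy, hyn⟩ := exists_lp_of_summable_sq a (by simpa using ha)
  obtain ⟨z, hz, hzn⟩ := exists_lp_of_summable_sq b (by simpa using hb)
  have h1 := lp.hasSum_inner (𝕜 := ℝ) y z
  have h2 := abs_real_inner_le_norm y z
  have h3 : (fun i => inner ℝ (y i) (z i)) = fun n => a n * b n := by
    funext n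
    rw [hy, hz]
    simp [mul_comm]
  rw [h3] at h1
  refine ⟨h1.summable, ?_⟩
  rw [h1.tsum_eq]
  simpa [hyn, hzn, l2n] using h2

/-- Young's inequality `ℓ¹ * ℓ² ⊆ ℓ²`. -/
lemma young (A B : ℤ → ℝ) (hA0 : ∀ n, 0 ≤ A n) (hA : Summable A)
    (hB : Summable fun n => B n ^ 2) :
    ∃ y : lp (fun _ : ℤ => ℝ) 2, (∀ n, HasSum (fun m => A m * B (n - m)) (y n)) ∧
      ‖y‖ ≤ (∑' n, A n) * l2n B := by
  -- The convolution is the sum over `m` of `A m` times the translate of `B` by `m`. Translations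
  -- are isometries of `ℓ²`, so this series converges absolutely there.
  have hsh : ∀ m : ℤ, ∃ z : lp (fun _ : ℤ => ℝ) 2, (∀ n, z n = B (n - m)) ∧ ‖z‖ = l2n B := by
    intro m
    have hs : Summable fun n => B (n - m) ^ 2 := (Equiv.subRight m).summable_iff.mpr hB
    obtain ⟨z, hz, hzn⟩ := exists_lp_of_summable_sq (fun n => B (n - m)) (by simpa using hs)
    refine ⟨z, hz, ?_⟩
    rw [hzn, l2n]
    congr 1
    simpa using (Equiv.subRight m).tsum_eq (fun n => B n ^ 2)
  choose z hz hzn using hsh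
  have hnorm : ∀ m, ‖A m • z m‖ = A m * l2n B := fun m => by
    rw [norm_smul, hzn, Real.norm_of_nonneg (hA0 m)]
  have hsum : Summable fun m => ‖A m • z m‖ := by
    simp_rw [hnorm]
    exact hA.mul_right _
  refine ⟨∑' m, A m • z m, fun n => ?_, ?_⟩
  · have h1 := hsum.of_norm.hasSum.mapL (lp.evalCLM ℝ (fun _ : ℤ => ℝ) 2 n)
    have h2 : ∀ m, lp.evalCLM ℝ (fun _ : ℤ => ℝ) 2 n (A m • z m) = A m * B (n - m) := fun m => by
      rw [← hz]; rfl
    simp only [h2] at h1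
    exact h1
  · refine (norm_tsum_le_tsum_norm hsum).trans ?_
    simp_rw [hnorm]
    rw [tsum_mul_right]

/-! ### Fourier coefficients -/

/-- The Fourier coefficients of a real function on the circle. -/
def fc (f : Circ → ℝ) (n : ℤ) : ℂ := fourierCoeff (fun x => (f x : ℂ)) n

lemma continuous_toComplex {f : Circ → ℝ} (hf : Continuous f) :
    Continuous fun x => (f x : ℂ) := Complex.continuous_ofReal.comp hf

lemma integrable_of_cont {f : Circ → ℂ} (hf : Continuous f) :
    MeasureTheory.Integrable f (AddCircle.haarAddCircle) :=
  hf.integrable_of_hasCompactSupport (HasCompactSupport.of_compactSpace f)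

lemma fc_add {f g : Circ → ℝ} (hf : Continuous f) (hg : Continuous g) (n : ℤ) :
    fc (f + g) n = fc f n + fc g n := by
  have h := fourierCoeff.add (integrable_of_cont (continuous_toComplex hf))
    (integrable_of_cont (continuous_toComplex hg))
  have h1 : (fun x => ((f + g) x : ℂ)) = (fun x => (f x : ℂ)) + fun x => (g x : ℂ) := by
    funext x; simp
  rw [fc, h1, h]; rfl

lemma fc_smul (c : ℝ) (f : Circ → ℝ) (n : ℤ) : fc (c • f) n = c * fc f n := by
  have h1 : (fun x => ((c • f) x : ℂ)) = fun x => (c : ℂ) * (f x : ℂ) := by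
    funext x; simp
  rw [fc, h1, fourierCoeff.const_mul]; rfl

lemma fc_neg_index (f : Circ → ℝ) (n : ℤ) : fc f (-n) = (starRingEnd ℂ) (fc f n) := by
  unfold fc fourierCoeff
  rw [← integral_conj]
  congr 1
  funext x
  simp

lemma fourier_norm_apply (n : ℤ) (x : Circ) : ‖(fourier n x : ℂ)‖ = 1 :=
  Circle.norm_coe _

lemma fourierCoeff_mul_fourier (h : Circ → ℂ) (m n : ℤ) :
    fourierCoeff (fun x => fourier m x * h x) n = fourierCoeff h (n - m) := by
  unfold fourierCoeff
  congr 1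
  funext x
  rw [smul_eq_mul, smul_eq_mul, ← mul_assoc, ← fourier_add]
  congr 3
  ring

/-- Expand `g` in its absolutely convergent series and integrate term by term; multiplication by the
`m`-th mode shifts the coefficients of `h` by `m`. -/
lemma hasSum_fourierCoeff_mul {b : ℤ → ℂ} (hb : Summable fun m => ‖b m‖) {h g : Circ → ℂ}
    (hh : Continuous h) (hg : ∀ x, HasSum (fun m => b m * fourier m x) (g x)) (n : ℤ) :
    HasSum (fun m => b m * fourierCoeff h (n - m)) (fourierCoeff (fun x => h x * g x) n) := by
  have hcont : ∀ m : ℤ, Continuous fun x : Circ =>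
      (fourier (-n) x : ℂ) * (b m * (fourier m x * h x)) := fun m => by fun_prop
  have key := MeasureTheory.hasSum_integral_of_summable_integral_norm
    (μ := (AddCircle.haarAddCircle : MeasureTheory.Measure Circ))
    (F := fun (m : ℤ) x => (fourier (-n) x : ℂ) * (b m * (fourier m x * h x)))
    (fun m => integrable_of_cont (hcont m)) (by
      have : ∀ m : ℤ, (∫ x : Circ, ‖(fourier (-n) x : ℂ) * (b m * (fourier m x * h x))‖
          ∂AddCircle.haarAddCircle) = ‖b m‖ * ∫ x : Circ, ‖h x‖ ∂AddCircle.haarAddCircle := by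
        intro m
        rw [← MeasureTheory.integral_const_mul]
        congr 1
        funext x
        simp only [norm_mul, fourier_norm_apply]
        ring
      simp_rw [this]
      exact hb.mul_right _)
  have e1 : ∀ m : ℤ, (∫ x : Circ, (fourier (-n) x : ℂ) * (b m * (fourier m x * h x))
      ∂AddCircle.haarAddCircle) = b m * fourierCoeff h (n - m) := fun m => by
    rw [← fourierCoeff_mul_fourier, ← fourierCoeff.const_mul]
    rfl
  have e2 : (∫ x : Circ, ∑' m : ℤ, (fourier (-n) x : ℂ) * (b m * (fourier m x * h x))
      ∂AddCircle.haarAddCircle) = fourierCoeff (fun x => h x * g x) n := by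
    unfold fourierCoeff
    congr 1
    funext x
    show _ = (fourier (-n) x : ℂ) * (h x * g x)
    rw [← (hg x).tsum_eq, ← tsum_mul_left, ← tsum_mul_left]
    congr 1
    funext m
    ring
  simp only [e1] at key
  rw [e2] at key
  exact key

/-- This is the product formula with `h = 1`, whose only nonzero coefficient is the one of index
`0`. -/
lemma hasSum_fourierCoeff {b : ℤ → ℂ} (hb : Summable fun m => ‖b m‖) {g : Circ → ℂ}
    (hg : ∀ x, HasSum (fun m => b m * fourier m x) (g x)) (n : ℤ) :
    fourierCoeff g n = b n := by
  have h := hasSum_fourierCoeff_mul hb (h := fun _ => 1) continuous_const hg n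
  have h1 : ∀ m : ℤ, fourierCoeff (fun _ : Circ => (1 : ℂ)) (n - m) = if m = n then 1 else 0 := by
    intro m
    have h2 := fourierCoeff_fourier (T := 2 * π) 0
    have h3 : (⇑(fourier 0) : Circ → ℂ) = fun _ => 1 := by funext x; simp
    rw [h3] at h2
    rw [h2]
    simp [Pi.single_apply, sub_eq_zero, eq_comm]
  simp_rw [h1] at h
  have h4 : HasSum (fun m => b m * if m = n then (1 : ℂ) else 0) (b n) := by
    convert hasSum_ite_eq n (b n) using 2 with m
    split_ifs with hm <;> simp [hm]
  simpa using h.unique h4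

/-- A real continuous function with prescribed summable Fourier coefficients. -/
lemma exists_of_fc {a : ℤ → ℂ} (ha : Summable fun m => ‖a m‖)
    (hsym : ∀ n, a (-n) = (starRingEnd ℂ) (a n)) :
    ∃ f : Circ → ℝ, Continuous f ∧ ∀ n, fc f n = a n := by
  have hs : ∀ x : Circ, Summable fun m => a m * (fourier m x : ℂ) := fun x => by
    refine Summable.of_norm ?_
    simpa only [norm_mul, fourier_norm_apply, mul_one] using ha
  set g : Circ → ℂ := fun x => ∑' m, a m * (fourier m x : ℂ) with hg
  have hgc : Continuous g := by
    refine continuous_tsum (u := fun m => ‖a m‖) (fun m => by fun_prop) ha fun m x => ?_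
    rw [norm_mul, fourier_norm_apply, mul_one]
  have hreal : ∀ x, (starRingEnd ℂ) (g x) = g x := by
    intro x
    rw [hg]
    simp only
    rw [Complex.conj_tsum, ← (Equiv.neg ℤ).tsum_eq]
    congr 1
    funext m
    simp [hsym]
  refine ⟨fun x => (g x).re, Complex.continuous_re.comp hgc, fun n => ?_⟩
  have : (fun x => (((g x).re : ℝ) : ℂ)) = g := by
    funext x
    exact Complex.conj_eq_iff_re.mp (hreal x)
  rw [fc, this]
  exact hasSum_fourierCoeff ha (fun x => (hs x).hasSum) n

lemma hasSum_fc {f : Circ → ℝ} (hf : Continuous f) (hs : Summable fun n => ‖fc f n‖) (x : Circ) :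
    HasSum (fun n => fc f n * (fourier n x : ℂ)) (f x : ℂ) := by
  have := has_pointwise_sum_fourier_series_of_summable
    (f := (⟨fun x => (f x : ℂ), continuous_toComplex hf⟩ : C(Circ, ℂ))) hs.of_norm x
  simpa [smul_eq_mul, fc] using this

lemma eq_of_fc_eq {f g : Circ → ℝ} (hf : Continuous f) (hg : Continuous g)
    (hs : Summable fun n => ‖fc f n‖) (h : ∀ n, fc f n = fc g n) : f = g := by
  funext x
  have h1 := hasSum_fc hf hs x
  simp_rw [h] at hs h1
  exact_mod_cast h1.unique (hasSum_fc hg hs x)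

/-- Fourier coefficients of a product. -/
lemma hasSum_fc_mul {f g : Circ → ℝ} (hf : Continuous f) (hg : Continuous g)
    (hs : Summable fun n => ‖fc g n‖) (n : ℤ) :
    HasSum (fun m => fc g m * fc f (n - m)) (fc (f * g) n) := by
  have := hasSum_fourierCoeff_mul hs (continuous_toComplex hf) (hasSum_fc hg hs) n
  simpa [fc] using this

lemma summable_sq_fc {f : Circ → ℝ} (hf : Continuous f) :
    HasSum (fun n => ‖fc f n‖ ^ 2) (∫ x : Circ, f x ^ 2 ∂AddCircle.haarAddCircle) := by
  have hc := continuous_toComplex hf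
  have hL : MeasureTheory.MemLp (fun x => (f x : ℂ)) 2
      (AddCircle.haarAddCircle : MeasureTheory.Measure Circ) :=
    hc.memLp_of_hasCompactSupport (HasCompactSupport.of_compactSpace _)
  have h := hasSum_sq_fourierCoeff (T := 2 * π) hL.toLp
  have h1 : fourierCoeff (hL.toLp : Circ → ℂ) = fc f := by
    rw [fourierCoeff_congr_ae hL.coeFn_toLp]; rfl
  rw [h1] at h
  convert h using 1
  refine MeasureTheory.integral_congr_ae ?_
  filter_upwards [hL.coeFn_toLp] with x hx
  rw [hx]
  simp

end

end PolarisedT2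

namespace PolarisedT2

noncomputable section

/-! ### The Japanese bracket -/

/-- `⟨n⟩ = (1 + n²)^{1/2}`. -/
def jb (n : ℤ) : ℝ := √(1 + (n : ℝ) ^ 2)

lemma jb_sq (n : ℤ) : jb n ^ 2 = 1 + (n : ℝ) ^ 2 := Real.sq_sqrt (by positivity)

lemma jb_nonneg (n : ℤ) : 0 ≤ jb n := Real.sqrt_nonneg _

lemma one_le_jb (n : ℤ) : 1 ≤ jb n := by
  rw [jb, Real.one_le_sqrt]; nlinarith [sq_nonneg (n : ℝ)]

lemma jb_pos (n : ℤ) : 0 < jb n := lt_of_lt_of_le one_pos (one_le_jb n)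

lemma jb_neg (n : ℤ) : jb (-n) = jb n := by simp [jb]

lemma abs_le_jb (n : ℤ) : |(n : ℝ)| ≤ jb n := by
  rw [jb]; exact Real.abs_le_sqrt (by linarith)

lemma jb_add_le (n m : ℤ) : jb (n + m) ≤ jb n + jb m := by
  refine Real.sqrt_le_iff.mpr ⟨add_nonneg (jb_nonneg _) (jb_nonneg _), ?_⟩
  have h1 := jb_sq n
  have h2 := jb_sq m
  have h3 : (n : ℝ) * m ≤ jb n * jb m :=
    (le_abs_self _).trans (by
      rw [abs_mul]; exact mul_le_mul (abs_le_jb n) (abs_le_jb m) (abs_nonneg _) (jb_nonneg _))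
  push_cast
  nlinarith

lemma abs_jb_sub_le (n m : ℤ) : |jb n - jb m| ≤ jb (n - m) := by
  rw [abs_le]
  constructor
  · have := jb_add_le (m - n) n
    rw [sub_add_cancel, ← neg_sub, jb_neg] at this
    linarith
  · have := jb_add_le (n - m) m
    rw [sub_add_cancel] at this
    linarith

lemma summable_inv_jb_sq : Summable fun n : ℤ => (jb n)⁻¹ ^ 2 := by
  have h := Real.summable_one_div_int_pow.mpr (one_lt_two)
  refine Summable.of_norm_bounded_eventually h ?_
  rw [Filter.eventually_cofinite]
  refine Set.Finite.subset (Set.finite_singleton (0 : ℤ)) fun n hn => ?_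
  by_contra h0
  apply hn
  have h0' : n ≠ 0 := h0
  have hp : 0 < (n : ℝ) ^ 2 := by positivity
  rw [inv_pow, jb_sq, Real.norm_of_nonneg (by positivity), one_div]
  exact inv_anti₀ hp (by linarith)

/-- The constant of the embedding `H¹ ⊆ A(𝕋)` into the Wiener algebra. -/
def wienerConst : ℝ := l2n fun n => (jb n)⁻¹

lemma wienerConst_nonneg : 0 ≤ wienerConst := l2n_nonneg _

/-! ### Sobolev norms -/

/-- The weighted Fourier coefficients `⟨n⟩^m |f̂(n)|`. -/
def wf (m : ℕ) (f : Circ → ℝ) (n : ℤ) : ℝ := jb n ^ m * ‖fc f n‖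

lemma wf_nonneg (m : ℕ) (f : Circ → ℝ) (n : ℤ) : 0 ≤ wf m f n :=
  mul_nonneg (pow_nonneg (jb_nonneg _) _) (norm_nonneg _)

lemma wf_zero (f : Circ → ℝ) (n : ℤ) : wf 0 f n = ‖fc f n‖ := by simp [wf]

lemma sobTerm_eq (m : ℕ) (f : Circ → ℝ) (n : ℤ) : sobTerm m f n = wf m f n ^ 2 := by
  rw [sobTerm, wf, mul_pow, ← jb_sq, fc]; ring

lemma normH_eq (m : ℕ) (f : Circ → ℝ) : normH m f = l2n (wf m f) := by
  unfold normH l2n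
  simp_rw [sobTerm_eq]

lemma MemH.summable {m : ℕ} {f : Circ → ℝ} (h : MemH m f) : Summable fun n => wf m f n ^ 2 := by
  simpa only [← sobTerm_eq] using h.2

lemma memH_of_summable {m : ℕ} {f : Circ → ℝ} (hf : Continuous f)
    (h : Summable fun n => wf m f n ^ 2) : MemH m f :=
  ⟨hf, by simpa only [← sobTerm_eq] using h⟩

lemma wf_mono {m m' : ℕ} (h : m' ≤ m) (f : Circ → ℝ) (n : ℤ) : wf m' f n ≤ wf m f n :=
  mul_le_mul_of_nonneg_right (pow_le_pow_right₀ (one_le_jb n) h) (norm_nonneg _)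

lemma MemH.mono {m m' : ℕ} (h : m' ≤ m) {f : Circ → ℝ} (hf : MemH m f) :
    MemH m' f ∧ normH m' f ≤ normH m f := by
  have := l2n_mono (r := wf m' f) (s := wf m f)
    (fun n => by rw [abs_of_nonneg (wf_nonneg _ _ _)]; exact wf_mono h f n) hf.summable
  exact ⟨memH_of_summable hf.1 this.1, by rw [normH_eq, normH_eq]; exact this.2⟩

/-- Cauchy–Schwarz against `⟨n⟩⁻¹`: giving up one derivative turns `ℓ²` into `ℓ¹`. The case `m = 0`
is the embedding into the Wiener algebra, and `m = 1` serves the commutator estimate. -/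
lemma MemH.summable_wf {m : ℕ} {f : Circ → ℝ} (h : MemH (m + 1) f) :
    Summable (wf m f) ∧ ∑' n, wf m f n ≤ wienerConst * normH (m + 1) f := by
  have := abs_tsum_mul_le (fun n => (jb n)⁻¹) (wf (m + 1) f) summable_inv_jb_sq h.summable
  have e : (fun n => (jb n)⁻¹ * wf (m + 1) f n) = wf m f := by
    funext n
    have := (jb_pos n).ne'
    rw [wf, wf, pow_succ]
    field_simp
  rw [e] at this
  refine ⟨this.1, ?_⟩
  rw [normH_eq]
  exact (le_abs_self _).trans this.2

lemma MemH.summable_fc {m : ℕ} {f : Circ → ℝ} (h : MemH (m + 1) f) :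
    Summable (fun n => ‖fc f n‖) ∧ ∑' n, ‖fc f n‖ ≤ wienerConst * normH (m + 1) f := by
  have h1 := (h.mono (m' := 1) (by omega))
  have h2 := h1.1.summable_wf
  have e : wf 0 f = fun n => ‖fc f n‖ := funext fun n => wf_zero f n
  rw [e] at h2
  exact ⟨h2.1, h2.2.trans (mul_le_mul_of_nonneg_left h1.2 wienerConst_nonneg)⟩

lemma MemH.abs_le {m : ℕ} {f : Circ → ℝ} (h : MemH (m + 1) f) (x : Circ) :
    |f x| ≤ wienerConst * normH (m + 1) f := by
  obtain ⟨h1, h2⟩ := h.summable_fc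
  have h3 := (hasSum_fc h.1 h1 x).tsum_eq
  have h4 : ‖(f x : ℂ)‖ ≤ ∑' n, ‖fc f n‖ := by
    rw [← h3]
    refine (norm_tsum_le_tsum_norm ?_).trans (le_of_eq ?_)
    · simpa only [norm_mul, fourier_norm_apply, mul_one] using h1
    · simp only [norm_mul, fourier_norm_apply, mul_one]
  rw [Complex.norm_real] at h4
  exact h4.trans h2

/-! ### Products of Sobolev functions. -/

/-- Convolution estimate in `ℓ²`. -/
lemma l2n_conv_le {A B A' B' : ℤ → ℝ} (hA0 : ∀ n, 0 ≤ A n) (hA0' : ∀ n, 0 ≤ A' n)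
    (hA : Summable A) (hA' : Summable A') (hB : Summable fun n => B n ^ 2)
    (hB' : Summable fun n => B' n ^ 2) {c : ℤ → ℂ} {s : ℤ → ℤ → ℂ}
    (hs : ∀ n, HasSum (s n) (c n))
    (hle : ∀ n m, ‖s n m‖ ≤ A m * B (n - m) + B' m * A' (n - m)) :
    Summable (fun n => ‖c n‖ ^ 2) ∧
      l2n (fun n => ‖c n‖) ≤ (∑' n, A n) * l2n B + (∑' n, A' n) * l2n B' := by
  obtain ⟨y, hy, hyn⟩ := young A B hA0 hA hB
  obtain ⟨z, hz, hzn⟩ := young A' B' hA0' hA' hB'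
  have hz' : ∀ n, HasSum (fun m => B' m * A' (n - m)) (z n) := fun n => by
    have := (Equiv.subLeft n).hasSum_iff.mpr (hz n)
    convert this using 2 with m
    simp [mul_comm]
  have := l2n_le_of_le (r := fun n => ‖c n‖) y z fun n => by
    have h1 := (hy n).add (hz' n)
    have h2 : Summable fun m => ‖s n m‖ :=
      Summable.of_nonneg_of_le (fun _ => norm_nonneg _) (hle n) h1.summable
    rw [abs_of_nonneg (norm_nonneg _), ← (hs n).tsum_eq, ← h1.tsum_eq]
    exact (norm_tsum_le_tsum_norm h2).trans (Summable.tsum_le_tsum (hle n) h2 h1.summable)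
  exact ⟨this.1, this.2.trans (add_le_add hyn hzn)⟩

/-- The Banach algebra constant of `H^{m+1}`. -/
def algConst (m : ℕ) : ℝ := 2 ^ (m + 1) * wienerConst + 1

lemma one_le_algConst (m : ℕ) : 1 ≤ algConst m := by
  have := wienerConst_nonneg
  unfold algConst
  linarith [mul_nonneg (pow_nonneg (zero_le_two (α := ℝ)) (m + 1)) this]

lemma wienerConst_le_algConst (m : ℕ) : wienerConst ≤ algConst m := by
  have := wienerConst_nonneg
  have h : (1 : ℝ) ≤ 2 ^ (m + 1) := one_le_pow₀ one_le_two
  unfold algConst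
  nlinarith

/-- `H^{m+1}` is an algebra. -/
lemma MemH.mul {m : ℕ} {f g : Circ → ℝ} (hf : MemH (m + 1) f) (hg : MemH (m + 1) g) :
    MemH (m + 1) (f * g) ∧
      normH (m + 1) (f * g) ≤ algConst m * (normH (m + 1) f * normH (m + 1) g) := by
  have hsf := hf.summable_fc
  have hsg := hg.summable_fc
  have key := l2n_conv_le (A := fun n => 2 ^ m * ‖fc g n‖) (B := wf (m + 1) f)
    (A' := fun n => 2 ^ m * ‖fc f n‖) (B' := wf (m + 1) g)
    (c := fun n => (jb n : ℂ) ^ (m + 1) * fc (f * g) n)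
    (s := fun n l => (jb n : ℂ) ^ (m + 1) * (fc g l * fc f (n - l)))
    (fun n => by positivity) (fun n => by positivity) (hsg.1.mul_left _) (hsf.1.mul_left _)
    hf.summable hg.summable (fun n => (hasSum_fc_mul hf.1 hg.1 hsg.1 n).mul_left _)
    (fun n l => by
      -- Since `⟨n⟩ ≤ ⟨n - l⟩ + ⟨l⟩`, the whole weight can be put on one factor at a time; the other
      -- factor is then measured in `ℓ¹`.
      have h1 : jb n ^ (m + 1) ≤ 2 ^ m * (jb (n - l) ^ (m + 1) + jb l ^ (m + 1)) := by
        have h2 := jb_add_le (n - l) l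
        rw [sub_add_cancel] at h2
        exact (pow_le_pow_left₀ (jb_nonneg n) h2 _).trans
          (add_pow_le (jb_nonneg _) (jb_nonneg _) (m + 1))
      rw [norm_mul, norm_mul, norm_pow, Complex.norm_real, Real.norm_of_nonneg (jb_nonneg n)]
      calc _ ≤ 2 ^ m * (jb (n - l) ^ (m + 1) + jb l ^ (m + 1)) * (‖fc g l‖ * ‖fc f (n - l)‖) :=
            mul_le_mul_of_nonneg_right h1 (by positivity)
        _ = _ := by simp only [wf]; ring)
  have e : (fun n => ‖(jb n : ℂ) ^ (m + 1) * fc (f * g) n‖) = wf (m + 1) (f * g) := by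
    funext n
    rw [norm_mul, norm_pow, Complex.norm_real, Real.norm_of_nonneg (jb_nonneg n), wf]
  refine ⟨memH_of_summable (hf.1.mul hg.1) (by simpa only [← e] using key.1), ?_⟩
  rw [normH_eq, ← e]
  refine key.2.trans ?_
  rw [tsum_mul_left, tsum_mul_left, ← normH_eq, ← normH_eq]
  have h1 := hsf.2
  have h2 := hsg.2
  have n1 : 0 ≤ normH (m + 1) f := Real.sqrt_nonneg _
  have n2 : 0 ≤ normH (m + 1) g := Real.sqrt_nonneg _
  have h2m : (0 : ℝ) ≤ 2 ^ m := by positivity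
  calc _ ≤ 2 ^ m * (wienerConst * normH (m + 1) g) * normH (m + 1) f
        + 2 ^ m * (wienerConst * normH (m + 1) f) * normH (m + 1) g := by gcongr
    _ = (algConst m - 1) * (normH (m + 1) f * normH (m + 1) g) := by
        simp only [algConst, pow_succ]; ring
    _ ≤ _ := by
        have := mul_nonneg n1 n2
        nlinarith

lemma fc_const (c : ℝ) (n : ℤ) : fc (fun _ => c) n = if n = 0 then (c : ℂ) else 0 := by
  have h2 := fourierCoeff_fourier (T := 2 * π) 0
  have h3 : (⇑(fourier 0) : Circ → ℂ) = fun _ => 1 := by funext x; simp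
  rw [h3] at h2
  have h4 : (fun _ : Circ => ((c : ℝ) : ℂ)) = fun x => (c : ℂ) * (fun _ : Circ => (1 : ℂ)) x := by
    simp
  rw [fc, h4, fourierCoeff.const_mul, h2]
  by_cases h : n = 0 <;> simp [h]

lemma memH_const (m : ℕ) (c : ℝ) : MemH m fun _ => c := by
  refine memH_of_summable continuous_const
    (summable_of_ne_finset_zero (s := {0}) fun n hn => ?_)
  have : n ≠ 0 := by simpa using hn
  simp [wf, fc_const, this]

lemma MemH.add {m : ℕ} {f g : Circ → ℝ} (hf : MemH m f) (hg : MemH m g) : MemH m (f + g) := by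
  obtain ⟨y, hy, -⟩ := exists_lp_of_summable_sq (wf m f) (by simpa using hf.summable)
  obtain ⟨z, hz, -⟩ := exists_lp_of_summable_sq (wf m g) (by simpa using hg.summable)
  refine memH_of_summable (hf.1.add hg.1) (l2n_le_of_le y z fun n => ?_).1
  rw [abs_of_nonneg (wf_nonneg _ _ _), hy, hz, wf, wf, wf, ← mul_add, fc_add hf.1 hg.1]
  exact mul_le_mul_of_nonneg_left (norm_add_le _ _) (pow_nonneg (jb_nonneg _) _)

/-! ### The Banach algebras `H^{m+1}` -/

/-- `H^{m+1}(𝕋)` as a subalgebra of the functions on the circle. -/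
def HsAlg (m : ℕ) : Subalgebra ℝ (Circ → ℝ) where
  carrier := {f | MemH (m + 1) f}
  mul_mem' hf hg := (MemH.mul hf hg).1
  add_mem' hf hg := MemH.add hf hg
  algebraMap_mem' c := memH_const _ c

/-- `H^{m+1}(𝕋)`, to be equipped with a Banach algebra norm. -/
def Hsp (m : ℕ) : Type := HsAlg m

namespace Hsp

variable {m m' : ℕ}

instance : CommRing (Hsp m) := inferInstanceAs (CommRing (HsAlg m))
instance : Algebra ℝ (Hsp m) := inferInstanceAs (Algebra ℝ (HsAlg m))
instance : CoeFun (Hsp m) fun _ => Circ → ℝ := ⟨fun f => f.1⟩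

lemma memH (f : Hsp m) : MemH (m + 1) f := f.2
lemma cont (f : Hsp m) : Continuous f := f.2.1

/-- The element of `H^{m+1}` given by a function. -/
def mk (f : Circ → ℝ) (hf : MemH (m + 1) f) : Hsp m := ⟨f, hf⟩

@[simp] lemma mk_apply (f : Circ → ℝ) (hf : MemH (m + 1) f) (x : Circ) : (mk f hf : Hsp m) x = f x :=
  rfl

lemma coe_mk (f : Circ → ℝ) (hf : MemH (m + 1) f) : ((mk f hf : Hsp m) : Circ → ℝ) = f := rfl

@[ext] lemma ext {f g : Hsp m} (h : ∀ x, f x = g x) : f = g := Subtype.ext (funext h)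

@[simp] lemma add_apply (f g : Hsp m) (x : Circ) : (f + g) x = f x + g x := rfl
@[simp] lemma sub_apply (f g : Hsp m) (x : Circ) : (f - g) x = f x - g x := rfl
@[simp] lemma neg_apply (f : Hsp m) (x : Circ) : (-f) x = -f x := rfl
@[simp] lemma mul_apply (f g : Hsp m) (x : Circ) : (f * g) x = f x * g x := rfl
@[simp] lemma pow_apply (f : Hsp m) (i : ℕ) (x : Circ) : (f ^ i) x = f x ^ i := rfl
@[simp] lemma smul_apply (c : ℝ) (f : Hsp m) (x : Circ) : (c • f) x = c * f x := rfl
@[simp] lemma zero_apply (x : Circ) : (0 : Hsp m) x = 0 := rfl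
@[simp] lemma one_apply (x : Circ) : (1 : Hsp m) x = 1 := rfl
@[simp] lemma algebraMap_apply (c : ℝ) (x : Circ) : (algebraMap ℝ (Hsp m) c) x = c := rfl

lemma fc_add (f g : Hsp m) (n : ℤ) : fc (f + g : Hsp m) n = fc f n + fc g n :=
  PolarisedT2.fc_add f.cont g.cont n

lemma fc_smul (c : ℝ) (f : Hsp m) (n : ℤ) : fc (c • f : Hsp m) n = c * fc f n :=
  PolarisedT2.fc_smul c f n

lemma fc_sub (f g : Hsp m) (n : ℤ) : fc (f - g : Hsp m) n = fc f n - fc g n := by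
  have : f - g = f + (-1 : ℝ) • g := by ext x; simp; ring
  rw [this, fc_add, fc_smul]; push_cast; ring

lemma hasSum_fc_mul (f g : Hsp m) (n : ℤ) :
    HasSum (fun l => fc g l * fc f (n - l)) (fc (f * g : Hsp m) n) :=
  PolarisedT2.hasSum_fc_mul f.cont g.cont g.memH.summable_fc.1 n

lemma ext_fc {f g : Hsp m} (h : ∀ n, fc f n = fc g n) : f = g :=
  Subtype.ext (eq_of_fc_eq f.cont g.cont f.memH.summable_fc.1 h)

/-- Weighted square summability and Hermitian symmetry characterise the Fourier coefficients of real
Sobolev functions. This direction supplies the Fourier multipliers and the completeness of the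
space. -/
lemma exists_fc {a : ℤ → ℂ} (hsym : ∀ n, a (-n) = (starRingEnd ℂ) (a n))
    (ha : Summable fun n => (jb n ^ (m + 1) * ‖a n‖) ^ 2) : ∃ f : Hsp m, ∀ n, fc f n = a n := by
  have h1 := (abs_tsum_mul_le (fun n => (jb n)⁻¹) _ summable_inv_jb_sq ha).1
  have h2 : Summable fun n => ‖a n‖ := by
    refine Summable.of_nonneg_of_le (fun _ => norm_nonneg _) (fun n => ?_) h1
    have h3 := jb_pos n
    have h4 : 1 ≤ jb n ^ m := one_le_pow₀ (one_le_jb n)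
    have e : (jb n)⁻¹ * (jb n ^ (m + 1) * ‖a n‖) = jb n ^ m * ‖a n‖ := by
      rw [pow_succ]; field_simp
    rw [e]
    exact le_mul_of_one_le_left (norm_nonneg _) h4
  obtain ⟨f, hf, hfa⟩ := exists_of_fc h2 hsym
  exact ⟨⟨f, memH_of_summable hf (by simpa only [wf, hfa] using ha)⟩, hfa⟩

/-- The weighted Fourier coefficients as an element of `ℓ²(ℤ, ℂ)`. -/
def emb (m : ℕ) : Hsp m →ₗ[ℝ] lp (fun _ : ℤ => ℂ) 2 where
  toFun f := ⟨fun n => ((algConst m * jb n ^ (m + 1) : ℝ) : ℂ) * fc f n, by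
    apply memℓp_gen
    have := f.memH.summable.mul_left (algConst m ^ 2)
    refine this.congr fun n => ?_
    have h1 := one_le_algConst m
    rw [norm_mul, Complex.norm_real, Real.norm_of_nonneg
      (mul_nonneg (by linarith) (pow_nonneg (jb_nonneg n) _)), wf]
    norm_num
    ring⟩
  map_add' f g := by
    ext n
    change _ * fc (f + g : Hsp m) n = _ * fc f n + _ * fc g n
    rw [fc_add]; ring
  map_smul' c f := by
    ext n
    change _ * fc (c • f : Hsp m) n = (c : ℝ) • (_ * fc f n)
    rw [fc_smul, Complex.real_smul]; ring

lemma emb_apply (f : Hsp m) (n : ℤ) :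
    emb m f n = ((algConst m * jb n ^ (m + 1) : ℝ) : ℂ) * fc f n := rfl

lemma algConst_mul_jb_ne (n : ℤ) : ((algConst m * jb n ^ (m + 1) : ℝ) : ℂ) ≠ 0 := by
  have h1 := one_le_algConst m
  have h2 := jb_pos n
  have : 0 < algConst m * jb n ^ (m + 1) := by positivity
  exact_mod_cast this.ne'

lemma emb_injective : Function.Injective (emb m) := fun f g h => by
  refine ext_fc fun n => ?_
  have h1 : emb m f n = emb m g n := by rw [h]
  exact mul_left_cancel₀ (algConst_mul_jb_ne n) h1

instance : NormedAddCommGroup (Hsp m) := NormedAddCommGroup.induced _ _ (emb m) emb_injective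

lemma norm_eq_emb (f : Hsp m) : ‖f‖ = ‖emb m f‖ := rfl

lemma norm_eq (f : Hsp m) : ‖f‖ = algConst m * normH (m + 1) f := by
  rw [norm_eq_emb, (lp_summable_sq (emb m f)).2, normH_eq, l2n]
  have h1 : 0 ≤ algConst m := zero_le_one.trans (one_le_algConst m)
  have : ∀ n, ‖emb m f n‖ ^ 2 = algConst m ^ 2 * wf (m + 1) f n ^ 2 := fun n => by
    rw [emb_apply, norm_mul, Complex.norm_real, Real.norm_of_nonneg
      (mul_nonneg h1 (pow_nonneg (jb_nonneg n) _)), wf]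
    ring
  simp_rw [this]
  rw [tsum_mul_left, Real.sqrt_mul (sq_nonneg _), Real.sqrt_sq h1]

lemma normH_le_norm (f : Hsp m) : normH (m + 1) f ≤ ‖f‖ := by
  rw [norm_eq]
  exact le_mul_of_one_le_left (Real.sqrt_nonneg _) (one_le_algConst m)

instance : NormedCommRing (Hsp m) where
  __ := (inferInstance : NormedAddCommGroup (Hsp m))
  __ := (inferInstance : CommRing (Hsp m))
  norm_mul_le f g := by
    have h := (f.memH.mul g.memH).2
    have h1 := one_le_algConst m
    rw [norm_eq, norm_eq, norm_eq]
    calc _ ≤ algConst m * (algConst m * (normH (m + 1) f * normH (m + 1) g)) :=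
          mul_le_mul_of_nonneg_left h (by linarith)
      _ = _ := by ring

instance : NormedAlgebra ℝ (Hsp m) where
  __ := (inferInstance : Algebra ℝ (Hsp m))
  norm_smul_le c f := by
    rw [norm_eq_emb, map_smul, norm_smul, norm_eq_emb]

/-- The range is cut out by the reality condition `y (-n) = conj (y n)`, an intersection of closed
conditions because evaluations are continuous on `ℓ²`. Completeness of the Sobolev algebra follows.
-/
lemma isClosed_range_emb : IsClosed (Set.range (emb m)) := by
  have : Set.range (emb m) = ⋂ n : ℤ, {y : lp (fun _ : ℤ => ℂ) 2 |
      lp.evalCLM ℝ (fun _ : ℤ => ℂ) 2 (-n) y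
        = (starRingEnd ℂ) (lp.evalCLM ℝ (fun _ : ℤ => ℂ) 2 n y)} := by
    ext y
    simp only [Set.mem_range, Set.mem_iInter, Set.mem_ofPred_eq]
    constructor
    · rintro ⟨f, rfl⟩ n
      change emb m f (-n) = (starRingEnd ℂ) (emb m f n)
      rw [emb_apply, emb_apply, fc_neg_index, jb_neg, map_mul, Complex.conj_ofReal]
    · intro hy
      have hy' : ∀ n, y (-n) = (starRingEnd ℂ) (y n) := hy
      have h0 := one_le_algConst m
      obtain ⟨f, hf⟩ := exists_fc (m := m)
        (a := fun n => ((algConst m * jb n ^ (m + 1) : ℝ) : ℂ)⁻¹ * y n)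
        (fun n => by rw [hy', jb_neg, map_mul, map_inv₀, Complex.conj_ofReal]) (by
          refine ((lp_summable_sq y).1.mul_left ((algConst m)⁻¹ ^ 2)).congr fun n => ?_
          have h1 := jb_pos n
          rw [norm_mul, norm_inv, Complex.norm_real, Real.norm_of_nonneg (by positivity)]
          field_simp)
      refine ⟨f, ?_⟩
      ext n
      rw [emb_apply, hf, mul_inv_cancel_left₀ (algConst_mul_jb_ne n)]
  rw [this]
  refine isClosed_iInter fun n => isClosed_eq (ContinuousLinearMap.continuous _)
    (Complex.continuous_conj.comp (ContinuousLinearMap.continuous _))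

instance : CompleteSpace (Hsp m) := by
  have hi : Isometry (emb m) := AddMonoidHomClass.isometry_of_norm _ fun f => rfl
  rw [completeSpace_iff_isComplete_range hi.isUniformInducing]
  exact isClosed_range_emb.isComplete

lemma abs_apply_le (f : Hsp m) (x : Circ) : |f x| ≤ ‖f‖ := by
  refine (f.memH.abs_le x).trans ?_
  rw [norm_eq]
  exact mul_le_mul_of_nonneg_right (wienerConst_le_algConst m) (Real.sqrt_nonneg _)

/-- Evaluation at a point. -/
def evalL (x : Circ) : Hsp m →L[ℝ] ℝ :=
  LinearMap.mkContinuous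
    { toFun := fun f => f x
      map_add' := fun _ _ => rfl
      map_smul' := fun _ _ => rfl } 1 fun f => by
    rw [one_mul]; exact abs_apply_le f x

@[simp] lemma evalL_apply (x : Circ) (f : Hsp m) : evalL x f = f x := rfl

/-! ### Fourier multipliers, inclusions and the derivative. -/

lemma exists_mult (μ : ℤ → ℂ) (hsym : ∀ n, μ (-n) = (starRingEnd ℂ) (μ n)) (C : ℝ)
    (hC : ∀ n, ‖μ n‖ * jb n ^ (m' + 1) ≤ C * jb n ^ (m + 1)) (f : Hsp m) :
    ∃ g : Hsp m', ∀ n, fc g n = μ n * fc f n := by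
  refine exists_fc (fun n => by rw [hsym, fc_neg_index, map_mul]) ?_
  refine (l2n_mono (s := fun n => C * wf (m + 1) f n) (fun n => ?_) ?_).1
  · rw [abs_of_nonneg (mul_nonneg (pow_nonneg (jb_nonneg _) _) (norm_nonneg _)), norm_mul, wf]
    calc _ = ‖μ n‖ * jb n ^ (m' + 1) * ‖fc f n‖ := by ring
      _ ≤ C * jb n ^ (m + 1) * ‖fc f n‖ := mul_le_mul_of_nonneg_right (hC n) (norm_nonneg _)
      _ = _ := by ring
  · simpa only [mul_pow] using f.memH.summable.mul_left (C ^ 2)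

/-- The Fourier multiplier with symbol `μ`. -/
def mult (μ : ℤ → ℂ) (hsym : ∀ n, μ (-n) = (starRingEnd ℂ) (μ n)) (C : ℝ)
    (hC : ∀ n, ‖μ n‖ * jb n ^ (m' + 1) ≤ C * jb n ^ (m + 1)) : Hsp m →L[ℝ] Hsp m' :=
  LinearMap.mkContinuous
    { toFun := fun f => (exists_mult μ hsym C hC f).choose
      map_add' := fun f g => ext_fc fun n => by
        rw [fc_add, (exists_mult μ hsym C hC _).choose_spec,
          (exists_mult μ hsym C hC _).choose_spec, (exists_mult μ hsym C hC _).choose_spec,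
          fc_add, mul_add]
      map_smul' := fun c f => ext_fc fun n => by
        rw [RingHom.id_apply, fc_smul, (exists_mult μ hsym C hC _).choose_spec,
          (exists_mult μ hsym C hC _).choose_spec, fc_smul]
        ring } (algConst m' * C) fun f => by
    have hC0 : 0 ≤ C := by
      have h1 := hC 0
      have h2 : 0 < jb 0 ^ (m + 1) := pow_pos (jb_pos 0) _
      have h3 : 0 ≤ ‖μ 0‖ * jb 0 ^ (m' + 1) :=
        mul_nonneg (norm_nonneg _) (pow_nonneg (jb_nonneg 0) _)
      exact nonneg_of_mul_nonneg_left (h3.trans h1) h2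
    have h0 := one_le_algConst m'
    have hspec := (exists_mult μ hsym C hC f).choose_spec
    have h1 := (l2n_mono (r := wf (m' + 1) (exists_mult μ hsym C hC f).choose)
      (s := fun n => C * wf (m + 1) f n) (fun n => by
        rw [abs_of_nonneg (wf_nonneg _ _ _), wf, wf, hspec, norm_mul]
        calc _ = ‖μ n‖ * jb n ^ (m' + 1) * ‖fc f n‖ := by ring
          _ ≤ C * jb n ^ (m + 1) * ‖fc f n‖ := mul_le_mul_of_nonneg_right (hC n) (norm_nonneg _)
          _ = _ := by ring)
      (by simpa only [mul_pow] using f.memH.summable.mul_left (C ^ 2))).2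
    have h2 : l2n (fun n => C * wf (m + 1) f n) = C * normH (m + 1) f := by
      rw [normH_eq, l2n, l2n]
      simp_rw [mul_pow]
      rw [tsum_mul_left, Real.sqrt_mul (sq_nonneg _), Real.sqrt_sq hC0]
    change ‖(exists_mult μ hsym C hC f).choose‖ ≤ _
    rw [norm_eq, normH_eq, mul_assoc]
    refine mul_le_mul_of_nonneg_left (h1.trans ?_) (by linarith)
    rw [h2]
    exact mul_le_mul_of_nonneg_left (normH_le_norm f) hC0

lemma fc_mult (μ : ℤ → ℂ) (hsym : ∀ n, μ (-n) = (starRingEnd ℂ) (μ n)) (C : ℝ)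
    (hC : ∀ n, ‖μ n‖ * jb n ^ (m' + 1) ≤ C * jb n ^ (m + 1)) (f : Hsp m) (n : ℤ) :
    fc (mult μ hsym C hC f) n = μ n * fc f n :=
  (exists_mult μ hsym C hC f).choose_spec n

/-- The inclusion `H^{m+1} ⊆ H^{m'+1}`. -/
def incl (h : m' ≤ m) : Hsp m →L[ℝ] Hsp m' :=
  LinearMap.mkContinuous
    { toFun := fun f => mk f (f.memH.mono (by omega)).1
      map_add' := fun _ _ => rfl
      map_smul' := fun _ _ => rfl } (algConst m') fun f => by
    have h0 := one_le_algConst m'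
    change ‖mk f _‖ ≤ _
    rw [norm_eq]
    exact mul_le_mul_of_nonneg_left
      ((f.memH.mono (by omega)).2.trans (normH_le_norm f)) (by linarith)

@[simp] lemma incl_apply (h : m' ≤ m) (f : Hsp m) (x : Circ) : incl h f x = f x := rfl

lemma coe_incl (h : m' ≤ m) (f : Hsp m) : (incl h f : Circ → ℝ) = f :=
  funext fun x => incl_apply h f x

lemma incl_mul (h : m' ≤ m) (f g : Hsp m) : incl h (f * g) = incl h f * incl h g := rfl

lemma incl_incl {l : ℕ} (h : m' ≤ m) (h' : l ≤ m') (f : Hsp m) :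
    incl h' (incl h f) = incl (h'.trans h) f := by
  ext x
  rw [incl_apply, incl_apply, incl_apply]

/-- The derivative `∂_θ : H^{m+2} → H^{m+1}`. -/
def D : Hsp (m + 1) →L[ℝ] Hsp m :=
  mult (fun n => Complex.I * n) (fun n => by simp) 1 fun n => by
    rw [norm_mul, Complex.norm_I, one_mul, one_mul, pow_succ, mul_comm]
    have h : ‖(n : ℂ)‖ = |(n : ℝ)| := by
      rw [← Complex.ofReal_intCast, Complex.norm_real, Real.norm_eq_abs]
    rw [h, pow_succ (jb n) (m + 1)]
    exact mul_le_mul_of_nonneg_left (abs_le_jb n)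
      (mul_nonneg (pow_nonneg (jb_nonneg n) _) (jb_nonneg n))

lemma fc_D (f : Hsp (m + 1)) (n : ℤ) : fc (D f) n = Complex.I * n * fc f n := fc_mult _ _ _ _ _ _

/-- `D` is defined by its symbol; this identifies it with the classical derivative. The series may
be differentiated term by term because the coefficients of `D f` are absolutely summable. -/
lemma hasDerivAt_comp_add (f : Hsp (m + 1)) (x : Circ) (s : ℝ) :
    HasDerivAt (fun s : ℝ => f (x + (s : Circ))) (D f (x + (s : Circ))) s := by
  have hf := f.memH.summable_fc.1
  have hD := (D f).memH.summable_fc.1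
  have hfs : ∀ s : ℝ, HasSum (fun n => fc f n * (fourier n (x + (s : Circ)) : ℂ))
      (f (x + (s : Circ)) : ℂ) := fun s => hasSum_fc f.cont hf _
  have hDs := hasSum_fc (D f).cont hD (x + (s : Circ))
  have hderiv : ∀ (n : ℤ) (s : ℝ), HasDerivAt (fun s : ℝ => fc f n * (fourier n (x + (s : Circ)) : ℂ))
      (fc (D f) n * (fourier n (x + (s : Circ)) : ℂ)) s := fun n s => by
    have h1 := (hasDerivAt_fourier (2 * π) n s).const_mul (fc f n * (fourier n x : ℂ))
    have e : (fun s : ℝ => fc f n * (fourier n (x + (s : Circ)) : ℂ))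
        = fun s : ℝ => fc f n * (fourier n x : ℂ) * (fourier n (s : Circ) : ℂ) := by
      funext s
      have h5 : (fourier n (x + (s : Circ)) : ℂ) = fourier n x * fourier n (s : Circ) := by
        simp only [fourier_apply, smul_add, AddCircle.toCircle_add, Circle.coe_mul]
      rw [h5]; ring
    rw [e]
    refine h1.congr_deriv ?_
    have h5 : (fourier n (x + (s : Circ)) : ℂ) = fourier n x * fourier n (s : Circ) := by
      simp only [fourier_apply, smul_add, AddCircle.toCircle_add, Circle.coe_mul]
    rw [fc_D, h5]
    have hpi : (π : ℂ) ≠ 0 := by exact_mod_cast Real.pi_ne_zero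
    push_cast
    field_simp
  have key := hasDerivAt_tsum (𝕜 := ℝ) hD hderiv (fun n s => by
    rw [norm_mul, fourier_norm_apply, mul_one]) (hfs s).summable s
  have e1 : (fun s : ℝ => ∑' n, fc f n * (fourier n (x + (s : Circ)) : ℂ))
      = fun s : ℝ => ((f (x + (s : Circ)) : ℝ) : ℂ) := funext fun s => (hfs s).tsum_eq
  rw [e1, hDs.tsum_eq] at key
  exact Complex.reCLM.hasFDerivAt.comp_hasDerivAt s key

lemma dθ_eq (f : Hsp (m + 1)) (x : Circ) : dθ f x = D f x := by
  have := (hasDerivAt_comp_add f x 0).deriv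
  simpa [dθ] using this

lemma D_mul (f g : Hsp (m + 1)) :
    D (f * g) = D f * incl (Nat.le_succ m) g + incl (Nat.le_succ m) f * D g := by
  ext x
  rw [← dθ_eq]
  have h := ((hasDerivAt_comp_add f x 0).mul (hasDerivAt_comp_add g x 0)).deriv
  have e : dθ (f * g : Hsp (m + 1)) x
      = deriv ((fun s : ℝ => f (x + (s : Circ))) * fun s : ℝ => g (x + (s : Circ))) 0 := rfl
  rw [e, h]
  simp

lemma D_incl (h : m' ≤ m) (f : Hsp (m + 1)) :
    D (incl (Nat.succ_le_succ h) f) = incl h (D f) :=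
  ext_fc fun n => by rw [fc_D, coe_incl, coe_incl, fc_D]

end Hsp

end

end PolarisedT2

namespace PolarisedT2

noncomputable section

namespace Hsp

variable {m : ℕ}

/-! ### Means over the circle -/

/-- The mean value of a function over the circle. -/
def avg : Hsp m →L[ℝ] ℝ :=
  LinearMap.mkContinuous
    { toFun := fun f => (fc f 0).re
      map_add' := fun f g => by rw [fc_add, Complex.add_re]
      map_smul' := fun c f => by rw [fc_smul]; simp } 1 fun f => by
    have h := f.memH.summable_fc
    have h1 : ‖fc f 0‖ ≤ ∑' n, ‖fc f n‖ := h.1.le_tsum 0 fun _ _ => norm_nonneg _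
    rw [one_mul, norm_eq]
    exact (Complex.abs_re_le_norm _).trans (h1.trans (h.2.trans
      (mul_le_mul_of_nonneg_right (wienerConst_le_algConst m) (Real.sqrt_nonneg _))))

lemma avg_def (f : Hsp m) : avg f = (fc f 0).re := rfl

lemma avg_eq_integral (f : Hsp m) : avg f = ∫ x : Circ, f x ∂AddCircle.haarAddCircle := by
  rw [avg_def, fc, fourierCoeff]
  simp only [neg_zero, fourier_zero, one_smul]
  have h := integral_ofReal (𝕜 := ℂ) (f := (f : Circ → ℝ))
    (μ := (AddCircle.haarAddCircle : MeasureTheory.Measure Circ))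
  have h' : (∫ x : Circ, ((f x : ℝ) : ℂ) ∂AddCircle.haarAddCircle)
      = ((∫ x : Circ, f x ∂AddCircle.haarAddCircle : ℝ) : ℂ) := h
  rw [h', Complex.ofReal_re]

lemma avg_mono {f g : Hsp m} (h : ∀ x, f x ≤ g x) : avg f ≤ avg g := by
  rw [avg_eq_integral, avg_eq_integral]
  refine MeasureTheory.integral_mono ?_ ?_ h
  · exact f.cont.integrable_of_hasCompactSupport (HasCompactSupport.of_compactSpace _)
  · exact g.cont.integrable_of_hasCompactSupport (HasCompactSupport.of_compactSpace _)

/-- The `L²` norm. -/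
def nrm2 (f : Hsp m) : ℝ := normH 0 f

lemma nrm2_nonneg (f : Hsp m) : 0 ≤ nrm2 f := Real.sqrt_nonneg _

lemma nrm2_eq (f : Hsp m) : nrm2 f = l2n fun n => ‖fc f n‖ := by
  rw [nrm2, normH_eq]
  congr 1
  funext n
  exact wf_zero _ _

lemma avg_sq (f : Hsp m) : avg (f ^ 2) = nrm2 f ^ 2 := by
  rw [avg_eq_integral, nrm2_eq, l2n, Real.sq_sqrt (tsum_nonneg fun _ => sq_nonneg _),
    (summable_sq_fc f.cont).tsum_eq]
  rfl

lemma summable_norm_fc_sq (f : Hsp m) : Summable fun n => ‖fc f n‖ ^ 2 :=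
  (summable_sq_fc f.cont).summable

lemma abs_avg_mul_le (f g : Hsp m) : |avg (f * g)| ≤ nrm2 f * nrm2 g := by
  have h := hasSum_fc_mul f g 0
  have h1 := abs_tsum_mul_le _ _ f.summable_norm_fc_sq g.summable_norm_fc_sq
  have h2 : ∀ n, ‖fc g n * fc f (0 - n)‖ = ‖fc f n‖ * ‖fc g n‖ := fun n => by
    rw [zero_sub, fc_neg_index, norm_mul, Complex.norm_conj, mul_comm]
  rw [avg_def, nrm2_eq, nrm2_eq]
  refine (Complex.abs_re_le_norm _).trans (le_trans ?_ ((le_abs_self _).trans h1.2))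
  rw [← h.tsum_eq]
  refine (norm_tsum_le_tsum_norm ?_).trans (le_of_eq ?_)
  · simpa only [h2] using h1.1
  · simp only [h2]

/-- One factor is measured in the supremum norm, so that the two top-order factors are needed only
in `L²`. -/
lemma abs_avg_mul_mul_le (h f g : Hsp m) {M : ℝ} (hM : ∀ x, |h x| ≤ M) :
    |avg (h * f * g)| ≤ M * (nrm2 f * nrm2 g) := by
  have hM0 : 0 ≤ M := (abs_nonneg _).trans (hM 0)
  have h1 : nrm2 (h * f) ≤ M * nrm2 f := by
    refine abs_le_of_sq_le_sq' ?_ (mul_nonneg hM0 (nrm2_nonneg f)) |>.2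
    rw [← avg_sq, mul_pow, mul_pow, ← avg_sq]
    have h2 : M ^ 2 * avg (f ^ 2) = avg (M ^ 2 • f ^ 2) := by rw [map_smul, smul_eq_mul]
    rw [h2]
    refine avg_mono fun x => ?_
    simp only [pow_apply, mul_apply, smul_apply]
    refine mul_le_mul_of_nonneg_right ?_ (sq_nonneg _)
    rw [← sq_abs (h x)]
    exact pow_le_pow_left₀ (abs_nonneg _) (hM x) 2
  calc _ ≤ nrm2 (h * f) * nrm2 g := abs_avg_mul_le _ _
    _ ≤ M * nrm2 f * nrm2 g := mul_le_mul_of_nonneg_right h1 (nrm2_nonneg g)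
    _ = _ := by ring

lemma avg_D (f : Hsp (m + 1)) : avg (D f) = 0 := by
  rw [avg_def, fc_D]; simp

/-! ### Regularised derivatives -/

/-- The symbol `⟨n⟩^k (1 + ε ⟨n⟩)^{-2}` with `ε = 1 / (N + 1)`. -/
def regSym (k N : ℕ) (n : ℤ) : ℝ := jb n ^ k / (1 + jb n / (N + 1)) ^ 2

lemma regSym_nonneg (k N : ℕ) (n : ℤ) : 0 ≤ regSym k N n := by
  have := jb_nonneg n
  unfold regSym; positivity

lemma regSym_le (k N : ℕ) (n : ℤ) : regSym k N n ≤ jb n ^ k := by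
  have := jb_nonneg n
  refine div_le_self (by positivity) (one_le_pow₀ ?_)
  have : 0 ≤ jb n / (N + 1) := by positivity
  linarith

/-- For fixed `N` the regularisation gains two orders. Thus the operator can be applied to `∂_t U`,
which lies only in `H^{k-1}`, with values in `H¹`, where products make sense. -/
lemma regSym_mul_le (k N : ℕ) (n : ℤ) :
    regSym k N n * jb n ^ 2 ≤ (N + 1) ^ 2 * jb n ^ k := by
  have h := jb_pos n
  have hN : (0 : ℝ) < N + 1 := by positivity
  rw [regSym, div_mul_eq_mul_div, div_le_iff₀ (by positivity)]
  have e : ((N : ℝ) + 1) ^ 2 * jb n ^ k * (1 + jb n / (N + 1)) ^ 2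
      = jb n ^ k * (N + 1 + jb n) ^ 2 := by
    field_simp
  rw [e]
  refine mul_le_mul_of_nonneg_left (pow_le_pow_left₀ h.le ?_ 2) (by positivity)
  linarith

/-- A mean value estimate for the symbol, with a constant that does not depend on `N`. It trades one
order of the symbol for one weight `⟨n - l⟩` on the other factor of the product. -/
lemma abs_regSym_sub_le (q N : ℕ) (n l : ℤ) :
    |regSym (q + 1) N n - regSym (q + 1) N l| ≤
      ((q + 1) * 2 ^ q + 2) * (jb (n - l) * (jb (n - l) ^ q + jb l ^ q)) := by
  set x := jb n with hx
  set y := jb l with hy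
  set z := jb (n - l) with hz
  have hx1 : 1 ≤ x := one_le_jb n
  have hy1 : 1 ≤ y := one_le_jb l
  have hz1 : 1 ≤ z := one_le_jb _
  have hxy : |x - y| ≤ z := abs_jb_sub_le n l
  set e : ℝ := ((N : ℝ) + 1)⁻¹ with he
  have he0 : 0 < e := by positivity
  have hrx : regSym (q + 1) N n = x ^ (q + 1) * (1 / (1 + e * x)) ^ 2 := by
    rw [regSym, one_div_pow, mul_one_div, he, inv_mul_eq_div]
  have hry : regSym (q + 1) N l = y ^ (q + 1) * (1 / (1 + e * y)) ^ 2 := by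
    rw [regSym, one_div_pow, mul_one_div, he, inv_mul_eq_div]
  set r := 1 / (1 + e * x) with hr
  set s := 1 / (1 + e * y) with hs
  have hex : 0 < 1 + e * x := by positivity
  have hey : 0 < 1 + e * y := by positivity
  have hr0 : 0 ≤ r := by positivity
  have hs0 : 0 ≤ s := by positivity
  have hr1 : r ≤ 1 := by
    rw [hr, div_le_one hex]; nlinarith
  have hs1 : s ≤ 1 := by
    rw [hs, div_le_one hey]; nlinarith
  -- The difference of the cut-offs is `e (y - x) r s`. The factor `y e s` is at most `1`, so the
  -- small parameter `e` disappears from the bound.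
  have hyrs : y * |r - s| ≤ z := by
    have e1 : r - s = e * (y - x) * r * s := by
      rw [hr, hs]; field_simp; ring
    have e2 : y * e * s ≤ 1 := by
      rw [hs, mul_one_div, div_le_one hey]; linarith
    have e3 : 0 ≤ y * e * s := by positivity
    rw [e1, abs_mul, abs_mul, abs_mul, abs_of_pos he0, abs_of_nonneg hr0, abs_of_nonneg hs0,
      abs_sub_comm]
    calc _ = (y * e * s) * (r * |x - y|) := by ring
      _ ≤ 1 * (1 * z) := by gcongr
      _ = z := by ring
  have hpow : |x ^ (q + 1) - y ^ (q + 1)| ≤ (q + 1) * 2 ^ q * (z * (z ^ q + y ^ q)) := by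
    have h1 := abs_pow_sub_pow_le x y (q + 1)
    have h2 : max |x| |y| ≤ z + y := by
      rw [abs_of_pos (by linarith), abs_of_pos (by linarith)]
      refine max_le ?_ (by linarith)
      have := (abs_le.mp hxy).2
      linarith
    have h3 : max |x| |y| ^ q ≤ 2 ^ q * (z ^ q + y ^ q) := by
      refine (pow_le_pow_left₀ (le_max_of_le_left (abs_nonneg x)) h2 q).trans
        ((add_pow_le (by linarith) (by linarith) q).trans ?_)
      refine mul_le_mul_of_nonneg_right (pow_le_pow_right₀ one_le_two (Nat.sub_le _ _))
        (by positivity)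
    rw [Nat.add_sub_cancel] at h1
    refine h1.trans ?_
    push_cast
    calc |x - y| * (q + 1) * max |x| |y| ^ q ≤ z * (q + 1) * (2 ^ q * (z ^ q + y ^ q)) := by
          gcongr
      _ = _ := by ring
  have hdiff : y ^ (q + 1) * |r ^ 2 - s ^ 2| ≤ 2 * (z * y ^ q) := by
    have e1 : |r ^ 2 - s ^ 2| = |r - s| * (r + s) := by
      rw [sq_sub_sq, abs_mul, abs_of_nonneg (by positivity : 0 ≤ r + s)]; ring
    rw [e1]
    calc _ = y ^ q * (y * |r - s|) * (r + s) := by ring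
      _ ≤ y ^ q * z * (1 + 1) := by gcongr
      _ = _ := by ring
  rw [hrx, hry]
  have e1 : x ^ (q + 1) * r ^ 2 - y ^ (q + 1) * s ^ 2
      = (x ^ (q + 1) - y ^ (q + 1)) * r ^ 2 + y ^ (q + 1) * (r ^ 2 - s ^ 2) := by ring
  rw [e1]
  refine (abs_add_le _ _).trans ?_
  rw [abs_mul, abs_mul, abs_of_nonneg (by positivity : 0 ≤ r ^ 2),
    abs_of_nonneg (by positivity : 0 ≤ y ^ (q + 1))]
  have hr2 : r ^ 2 ≤ 1 := pow_le_one₀ hr0 hr1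
  have hzq : 0 ≤ z * z ^ q := by positivity
  calc _ ≤ (q + 1) * 2 ^ q * (z * (z ^ q + y ^ q)) * 1 + 2 * (z * y ^ q) := by gcongr
    _ ≤ _ := by nlinarith

/-- The regularised derivative of order `j + 3`, with symbol `⟨n⟩^{j+3} (1 + ⟨n⟩ / (N + 1))^{-2}`. -/
def regGen (j N : ℕ) {m m' : ℕ} (h : m = j + 1 + m') : Hsp m →L[ℝ] Hsp m' :=
  mult (fun n => (regSym (j + 3) N n : ℂ)) (fun n => by
    rw [Complex.conj_ofReal, regSym, regSym, jb_neg]) ((N + 1) ^ 2) fun n => by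
    have h' := regSym_mul_le (j + 3) N n
    have h1 := jb_pos n
    rw [Complex.norm_real, Real.norm_of_nonneg (regSym_nonneg _ _ _)]
    refine le_of_mul_le_mul_right ?_ h1
    subst h
    calc _ = regSym (j + 3) N n * jb n ^ 2 * jb n ^ m' := by ring
      _ ≤ (N + 1) ^ 2 * jb n ^ (j + 3) * jb n ^ m' := by gcongr
      _ = _ := by ring

lemma fc_regGen (j N : ℕ) {m m' : ℕ} (h : m = j + 1 + m') (f : Hsp m) (n : ℤ) :
    fc (regGen j N h f) n = regSym (j + 3) N n * fc f n := fc_mult _ _ _ _ _ _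

/-- The regularised derivative `H^{j+2} → H^1`. -/
def reg (j N : ℕ) : Hsp (j + 1) →L[ℝ] Hsp 0 := regGen j N rfl

/-- The regularised derivative `H^{j+3} → H^2`. -/
def reg' (j N : ℕ) : Hsp (j + 2) →L[ℝ] Hsp 1 := regGen j N rfl

lemma fc_reg (j N : ℕ) (f : Hsp (j + 1)) (n : ℤ) :
    fc (reg j N f) n = regSym (j + 3) N n * fc f n := fc_regGen _ _ _ _ _

lemma fc_reg' (j N : ℕ) (f : Hsp (j + 2)) (n : ℤ) :
    fc (reg' j N f) n = regSym (j + 3) N n * fc f n := fc_regGen _ _ _ _ _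

lemma norm_fc_reg (j N : ℕ) (f : Hsp (j + 1)) (n : ℤ) :
    ‖fc (reg j N f) n‖ = regSym (j + 3) N n * ‖fc f n‖ := by
  rw [fc_reg, norm_mul, Complex.norm_real, Real.norm_of_nonneg (regSym_nonneg _ _ _)]

lemma incl_reg' (j N : ℕ) (f : Hsp (j + 2)) :
    incl (Nat.zero_le 1) (reg' j N f) = reg j N (incl (Nat.le_succ (j + 1)) f) :=
  ext_fc fun n => by
    rw [coe_incl, fc_reg', fc_reg, coe_incl]

/-- Integration by parts needs regularised functions that can themselves be differentiated, hence
the variant with values in `H²`. -/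
lemma D_reg' (j N : ℕ) (f : Hsp (j + 2)) : D (reg' j N f) = reg j N (D f) :=
  ext_fc fun n => by
    rw [fc_D, fc_reg', fc_reg, fc_D]; ring

lemma nrm2_reg_le (j N : ℕ) (f : Hsp (j + 2)) :
    nrm2 (reg j N (incl (Nat.le_succ (j + 1)) f)) ≤ normH (j + 3) f := by
  rw [nrm2_eq, normH_eq]
  refine (l2n_mono (fun n => ?_) f.memH.summable).2
  rw [abs_of_nonneg (norm_nonneg _), norm_fc_reg, coe_incl, wf]
  exact mul_le_mul_of_nonneg_right (regSym_le _ _ _) (norm_nonneg _)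

/-- Dominated convergence: the regularising factor is at most `1` and tends to `1` at each
frequency. -/
lemma tendsto_nrm2_reg (j : ℕ) (f : Hsp (j + 2)) :
    Tendsto (fun N => nrm2 (reg j N (incl (Nat.le_succ (j + 1)) f)) ^ 2) atTop
      (𝓝 (normH (j + 3) f ^ 2)) := by
  have e1 : ∀ N, nrm2 (reg j N (incl (Nat.le_succ (j + 1)) f)) ^ 2
      = ∑' n, (regSym (j + 3) N n * ‖fc f n‖) ^ 2 := fun N => by
    rw [nrm2_eq, l2n, Real.sq_sqrt (tsum_nonneg fun _ => sq_nonneg _)]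
    simp_rw [norm_fc_reg, coe_incl]
  have e2 : normH (j + 3) f ^ 2 = ∑' n, wf (j + 3) f n ^ 2 := by
    rw [normH_eq, l2n, Real.sq_sqrt (tsum_nonneg fun _ => sq_nonneg _)]
  simp_rw [e1]
  rw [e2]
  refine tendsto_tsum_of_dominated_convergence (bound := fun n => wf (j + 3) f n ^ 2)
    f.memH.summable (fun n => ?_) (Eventually.of_forall fun N n => ?_)
  · have h1 : Tendsto (fun N : ℕ => jb n / ((N : ℝ) + 1)) atTop (𝓝 0) := by
      have := tendsto_one_div_add_atTop_nhds_zero_nat (𝕜 := ℝ)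
      simpa [div_eq_mul_inv] using this.const_mul (jb n)
    have h2 : Tendsto (fun N : ℕ => regSym (j + 3) N n) atTop (𝓝 (jb n ^ (j + 3))) := by
      have h3 : Tendsto (fun N : ℕ => (1 + jb n / ((N : ℝ) + 1)) ^ 2) atTop (𝓝 1) := by
        simpa using (h1.const_add 1).pow 2
      have h4 := (tendsto_const_nhds (x := jb n ^ (j + 3))).div h3 one_ne_zero
      rw [div_one] at h4
      exact h4
    exact (h2.mul_const _).pow 2
  · rw [Real.norm_of_nonneg (sq_nonneg _), wf]
    have := regSym_nonneg (j + 3) N n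
    exact pow_le_pow_left₀ (by positivity)
      (mul_le_mul_of_nonneg_right (regSym_le _ _ _) (norm_nonneg _)) 2

/-! ### The commutator estimate. -/

/-- The constant in the commutator estimate. -/
def commConst (j : ℕ) : ℝ := 2 * (((j + 2 : ℕ) + 1) * 2 ^ (j + 2) + 2) * wienerConst

lemma commConst_nonneg (j : ℕ) : 0 ≤ commConst j := by
  have := wienerConst_nonneg
  unfold commConst; positivity

/-- Commutator estimate for the regularised derivatives, uniform in the regularisation. -/
lemma nrm2_comm_le (j N : ℕ) (ψ : Hsp (j + 2)) (h : Hsp (j + 1)) :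
    nrm2 (reg j N (incl (Nat.le_succ (j + 1)) ψ * h)
        - incl (Nat.zero_le (j + 2)) ψ * reg j N h) ≤ commConst j * (‖ψ‖ * ‖h‖) := by
  set C : ℝ := ((j + 2 : ℕ) + 1) * 2 ^ (j + 2) + 2 with hC
  have hC0 : 0 ≤ C := by positivity
  have hsh := h.memH.summable_fc
  have hψ2 := ψ.memH.mono (m' := 2) (by omega)
  have hsψ := hψ2.1.summable_wf
  -- The commutator has coefficients `∑ (s(n) - s(l)) ĥ(l) ψ̂(n - l)`, with `s` the regularised
  -- symbol. The bound on the symbol difference puts either `j + 3` weights on `ψ̂`, or one on `ψ̂`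
  -- and `j + 2` on `ĥ`. In each case the other sequence lies in `ℓ¹`, and `h` is needed only in
  -- `H^{j+2}`.
  have hconv := l2n_conv_le (A := fun n => C * ‖fc h n‖) (B := wf (j + 3) ψ)
    (A' := fun n => C * wf 1 ψ n) (B' := wf (j + 2) h)
    (c := fun n => fc (reg j N (incl (Nat.le_succ (j + 1)) ψ * h)
        - incl (Nat.zero_le (j + 2)) ψ * reg j N h : Hsp 0) n)
    (s := fun n l => ((regSym (j + 3) N n - regSym (j + 3) N l : ℝ) : ℂ)
      * (fc h l * fc ψ (n - l)))
    (fun n => by positivity) (fun n => mul_nonneg hC0 (wf_nonneg _ _ _))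
    (hsh.1.mul_left _) (hsψ.1.mul_left _) ψ.memH.summable h.memH.summable
    (fun n => by
      have h1 := (hasSum_fc_mul (incl (Nat.le_succ (j + 1)) ψ) h n).mul_left
        (regSym (j + 3) N n : ℂ)
      have h2 := hasSum_fc_mul (incl (Nat.zero_le (j + 2)) ψ) (reg j N h) n
      have h3 := h1.sub h2
      rw [fc_sub, fc_reg]
      refine h3.congr_fun fun l => ?_
      rw [fc_reg, coe_incl, coe_incl]
      push_cast
      ring)
    (fun n l => by
      have h1 := abs_regSym_sub_le (j + 2) N n l
      rw [norm_mul, norm_mul, Complex.norm_real, Real.norm_eq_abs]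
      refine (mul_le_mul_of_nonneg_right h1 (by positivity)).trans (le_of_eq ?_)
      rw [← hC]
      simp only [wf]
      ring)
  rw [nrm2_eq]
  refine hconv.2.trans ?_
  rw [tsum_mul_left, tsum_mul_left, ← normH_eq, ← normH_eq]
  have hw := wienerConst_nonneg
  have n1 := normH_le_norm ψ
  have n2 := normH_le_norm h
  have n3 := hψ2.2
  have p1 : 0 ≤ normH (j + 3) ψ := Real.sqrt_nonneg _
  have p2 : 0 ≤ normH (j + 2) h := Real.sqrt_nonneg _
  have b1 : ∑' n, ‖fc h n‖ ≤ wienerConst * ‖h‖ :=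
    hsh.2.trans (mul_le_mul_of_nonneg_left n2 hw)
  have b2 : ∑' n, wf 1 ψ n ≤ wienerConst * ‖ψ‖ :=
    hsψ.2.trans (mul_le_mul_of_nonneg_left (n3.trans n1) hw)
  calc _ ≤ C * (wienerConst * ‖h‖) * ‖ψ‖ + C * (wienerConst * ‖ψ‖) * ‖h‖ := by
        gcongr
    _ = _ := by rw [commConst, ← hC]; ring

end Hsp

end

end PolarisedT2

namespace PolarisedT2

noncomputable section

/-! ### The nonlinear terms in a commutative Banach algebra -/

section Nonlinear

variable {A : Type*} [NormedCommRing A]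

lemma norm_mul_le_mul' {x y : A} {X Y : ℝ} (hx : ‖x‖ ≤ X) (hy : ‖y‖ ≤ Y) : ‖x * y‖ ≤ X * Y :=
  (norm_mul_le x y).trans (mul_le_mul hx hy (norm_nonneg _) ((norm_nonneg _).trans hx))

lemma norm_pow_le_one' {x : A} (hx : ‖x‖ ≤ 1) {i : ℕ} (hi : 0 < i) : ‖x ^ i‖ ≤ 1 :=
  (norm_pow_le' x hi).trans (pow_le_one₀ (norm_nonneg _) hx)

/-- A bound for `‖𝔟‖ / ‖ξ‖²`. -/
def cB (A : Type*) [NormedCommRing A] (B : ℝ) : ℝ := 4 * B * (‖(1 : A)‖ + 1)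

/-- A bound for `‖𝔟_{J_X} + 𝔟_Λ - (a + w₁) 𝔟‖ / ‖ξ‖²`. -/
def cS (A : Type*) [NormedCommRing A] (a B : ℝ) : ℝ :=
  2 * B * (‖(1 : A)‖ + 1) + (|a| + 1) * cB A B

/-- The rescaled Sobolev norm need not give the unit norm one, which is why `‖1‖` appears in all the
constants. -/
lemma norm_one_add_le {x : A} (hx : ‖x‖ ≤ 1) : ‖1 + x‖ ≤ ‖(1 : A)‖ + 1 :=
  (norm_add_le _ _).trans (by linarith)

lemma norm_base_le {u : Fin 6 → A} (hu : ∀ i, ‖u i‖ ≤ 1) :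
    ‖(1 + u 3) * u 5 ^ 2‖ ≤ (‖(1 : A)‖ + 1) * ‖u 5‖ ^ 2 :=
  norm_mul_le_mul' (norm_one_add_le (hu 3)) (norm_pow_le' _ two_pos)

lemma cB_nonneg {B : ℝ} (hB : 0 ≤ B) : 0 ≤ cB A B := by
  have := norm_nonneg (1 : A)
  unfold cB; positivity

lemma cS_nonneg {a B : ℝ} (hB : 0 ≤ B) : 0 ≤ cS A a B := by
  have := norm_nonneg (1 : A)
  have := cB_nonneg (A := A) hB
  unfold cS; positivity

/-- The constant in the estimates of the nonlinear terms. -/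
def cF (A : Type*) [NormedCommRing A] (a B : ℝ) : ℝ :=
  1 + cS A a B + (‖(1 : A)‖ + 1) * cB A B + 4 * ((‖(1 : A)‖ + 1) * cS A a B) + cB A B
    + (2 * |a| + 1 + (‖(1 : A)‖ + 1))

lemma cF_pos {a B : ℝ} (hB : 0 ≤ B) : 0 < cF A a B := by
  have := norm_nonneg (1 : A)
  have := cB_nonneg (A := A) hB
  have := cS_nonneg (A := A) (a := a) hB
  have := abs_nonneg a
  unfold cF; positivity

variable [NormedAlgebra ℝ A]

/-- The function `𝔟`, with the time-dependent coefficients `P²`, `J_X² t^{2(1-2ℓ)}` and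
`2Λ t^{2(2-ℓ)}` replaced by the numbers `p`, `q`, `r`. -/
def nlB (p q r : ℝ) (u : Fin 6 → A) : A :=
  p • ((1 + u 3) * u 5 ^ 2) + q • (u 0 ^ 4 * ((1 + u 3) * u 5 ^ 2))
    + (2 * r) • (u 0 ^ 2 * ((1 + u 3) * u 5 ^ 2))

/-- The function `𝔟_{J_X} + 𝔟_Λ - (a + w₁) 𝔟`. -/
def nlS (a p q r : ℝ) (u : Fin 6 → A) : A :=
  q • (u 0 ^ 4 * ((1 + u 3) * u 5 ^ 2)) + r • (u 0 ^ 2 * ((1 + u 3) * u 5 ^ 2))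
    - (a • nlB p q r u + u 1 * nlB p q r u)

/-- The nonlinear part of `t ∂_t U`, apart from the derivative terms. -/
def nlF (a p q r : ℝ) (u : Fin 6 → A) : Fin 6 → A :=
  ![-(u 1 * u 0),
    (1 / 2 : ℝ) • (u 2 * u 4 + nlS a p q r u),
    0,
    -((1 + u 3) * nlB p q r u),
    (4 : ℝ) • ((1 + u 3) * nlS a p q r u * u 2) - nlB p q r u * u 4,
    ((2 * a) • u 1 + u 1 ^ 2 + u 2 ^ 2 * (1 + u 3) + (1 / 4 : ℝ) • nlB p q r u) * u 5]

lemma norm_smul_le_mul' {c : ℝ} {x : A} {B X : ℝ} (hc : |c| ≤ B) (hx : ‖x‖ ≤ X) :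
    ‖c • x‖ ≤ B * X := by
  rw [norm_smul, Real.norm_eq_abs]
  exact mul_le_mul hc hx (norm_nonneg _) ((abs_nonneg _).trans hc)

lemma norm_nlB_le {p q r B : ℝ} (hp : |p| ≤ B) (hq : |q| ≤ B) (hr : |r| ≤ B) {u : Fin 6 → A}
    (hu : ∀ i, ‖u i‖ ≤ 1) : ‖nlB p q r u‖ ≤ cB A B * ‖u 5‖ ^ 2 := by
  have h := norm_base_le hu
  have h4 := norm_mul_le_mul' (norm_pow_le_one' (hu 0) (i := 4) (by norm_num)) h
  have h2 := norm_mul_le_mul' (norm_pow_le_one' (hu 0) (i := 2) (by norm_num)) h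
  have hr2 : |2 * r| ≤ 2 * B := by
    rw [abs_mul, abs_two]; linarith
  refine (norm_add₃_le.trans (add_le_add (add_le_add (norm_smul_le_mul' hp h)
    (norm_smul_le_mul' hq h4)) (norm_smul_le_mul' hr2 h2))).trans (le_of_eq ?_)
  rw [cB]; ring

lemma norm_nlS_le {a p q r B : ℝ} (hp : |p| ≤ B) (hq : |q| ≤ B) (hr : |r| ≤ B) {u : Fin 6 → A}
    (hu : ∀ i, ‖u i‖ ≤ 1) : ‖nlS a p q r u‖ ≤ cS A a B * ‖u 5‖ ^ 2 := by
  have h := norm_base_le hu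
  have h4 := norm_mul_le_mul' (norm_pow_le_one' (hu 0) (i := 4) (by norm_num)) h
  have h2 := norm_mul_le_mul' (norm_pow_le_one' (hu 0) (i := 2) (by norm_num)) h
  have hb := norm_nlB_le hp hq hr hu
  refine ((norm_sub_le _ _).trans (add_le_add ((norm_add_le _ _).trans (add_le_add
    (norm_smul_le_mul' hq h4) (norm_smul_le_mul' hr h2))) ((norm_add_le _ _).trans
    (add_le_add (norm_smul_le_mul' le_rfl hb) (norm_mul_le_mul' (hu 1) hb))))).trans (le_of_eq ?_)
  rw [cS]; ring

variable {a p q r B : ℝ}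

/-- The nonlinear term in the equation for `w₀`. -/
lemma norm_nlF_zero_le (hB : 0 ≤ B) {u : Fin 6 → A} {d : ℝ} (hu : ∀ i, ‖u i‖ ≤ d) :
    ‖nlF a p q r u 0‖ ≤ cF A a B * (d * ‖u 0‖) := by
  have nb := cB_nonneg (A := A) hB
  have ns := cS_nonneg (A := A) (a := a) hB
  have n1 := norm_nonneg (1 : A)
  have na := abs_nonneg a
  have m1 : 0 ≤ (‖(1 : A)‖ + 1) * cB A B := by positivity
  have m2 : 0 ≤ (‖(1 : A)‖ + 1) * cS A a B := by positivity
  have hd0 : 0 ≤ d := (norm_nonneg _).trans (hu 0)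
  have e : ‖nlF a p q r u 0‖ ≤ d * ‖u 0‖ := by
    change ‖-(u 1 * u 0)‖ ≤ _
    rw [norm_neg]
    exact norm_mul_le_mul' (hu 1) le_rfl
  refine e.trans (le_mul_of_one_le_left (mul_nonneg hd0 (norm_nonneg _)) ?_)
  unfold cF; nlinarith

/-- The nonlinear term in the equation for `η`. -/
lemma norm_nlF_four_le (hp : |p| ≤ B) (hq : |q| ≤ B) (hr : |r| ≤ B) {u : Fin 6 → A}
    {d g : ℝ} (hd1 : d ≤ 1) (hu : ∀ i, ‖u i‖ ≤ d) (h4 : ‖u 4‖ ≤ g) (h5 : ‖u 5‖ ≤ g) :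
    ‖nlF a p q r u 4‖ ≤ cF A a B * (d * g) := by
  have hu1 : ∀ i, ‖u i‖ ≤ 1 := fun i => (hu i).trans hd1
  have hB : 0 ≤ B := (abs_nonneg _).trans hp
  have hd0 : 0 ≤ d := (norm_nonneg _).trans (hu 0)
  have hg0 : 0 ≤ g := (norm_nonneg _).trans h4
  have hdg : 0 ≤ d * g := mul_nonneg hd0 hg0
  have hb := norm_nlB_le hp hq hr hu1
  have hs := norm_nlS_le (a := a) hp hq hr hu1
  have nb := cB_nonneg (A := A) hB
  have ns := cS_nonneg (A := A) (a := a) hB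
  have n1 := norm_nonneg (1 : A)
  have na := abs_nonneg a
  have h55 : ‖u 5‖ ^ 2 ≤ d * g := by
    rw [sq]; exact mul_le_mul (hu 5) h5 (norm_nonneg _) hd0
  have h55d : ‖u 5‖ ^ 2 ≤ d := by
    rw [sq]
    calc _ ≤ d * 1 := mul_le_mul (hu 5) (hu1 5) (norm_nonneg _) hd0
      _ = d := mul_one d
  have m1 : 0 ≤ (‖(1 : A)‖ + 1) * cB A B := by positivity
  have m2 : 0 ≤ (‖(1 : A)‖ + 1) * cS A a B := by positivity
  have e : ‖nlF a p q r u 4‖ ≤ 4 * ((‖(1 : A)‖ + 1) * (cS A a B * (d * g)) * 1)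
      + cB A B * d * g := by
    change ‖(4 : ℝ) • ((1 + u 3) * nlS a p q r u * u 2) - nlB p q r u * u 4‖ ≤ _
    refine (norm_sub_le _ _).trans (add_le_add ?_ ?_)
    · refine norm_smul_le_mul' (by norm_num) ?_
      refine norm_mul_le_mul' (norm_mul_le_mul' (norm_one_add_le (hu1 3)) ?_) (hu1 2)
      exact hs.trans (mul_le_mul_of_nonneg_left h55 ns)
    · exact norm_mul_le_mul' (hb.trans (mul_le_mul_of_nonneg_left h55d nb)) h4
  refine e.trans ?_
  have : 4 * ((‖(1 : A)‖ + 1) * (cS A a B * (d * g)) * 1) + cB A B * d * g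
      = (4 * ((‖(1 : A)‖ + 1) * cS A a B) + cB A B) * (d * g) := by ring
  rw [this]
  refine mul_le_mul_of_nonneg_right ?_ hdg
  unfold cF; nlinarith

/-- The nonlinear term in the equation for `ξ`. -/
lemma norm_nlF_five_le (hp : |p| ≤ B) (hq : |q| ≤ B) (hr : |r| ≤ B) {u : Fin 6 → A}
    {d : ℝ} (hd1 : d ≤ 1) (hu : ∀ i, ‖u i‖ ≤ d) :
    ‖nlF a p q r u 5‖ ≤ cF A a B * (d * ‖u 5‖) := by
  set g := ‖u 5‖ with hg
  have h5 : ‖u 5‖ ≤ g := le_rfl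
  have hu1 : ∀ i, ‖u i‖ ≤ 1 := fun i => (hu i).trans hd1
  have hB : 0 ≤ B := (abs_nonneg _).trans hp
  have hd0 : 0 ≤ d := (norm_nonneg _).trans (hu 0)
  have hg0 : 0 ≤ g := (norm_nonneg _).trans h5
  have hdg : 0 ≤ d * g := mul_nonneg hd0 hg0
  have hb := norm_nlB_le hp hq hr hu1
  have hs := norm_nlS_le (a := a) hp hq hr hu1
  have nb := cB_nonneg (A := A) hB
  have ns := cS_nonneg (A := A) (a := a) hB
  have n1 := norm_nonneg (1 : A)
  have na := abs_nonneg a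
  have h55 : ‖u 5‖ ^ 2 ≤ d * g := by
    rw [sq]; exact mul_le_mul (hu 5) h5 (norm_nonneg _) hd0
  have h55d : ‖u 5‖ ^ 2 ≤ d := by
    rw [sq]
    calc _ ≤ d * 1 := mul_le_mul (hu 5) (hu1 5) (norm_nonneg _) hd0
      _ = d := mul_one d
  have m1 : 0 ≤ (‖(1 : A)‖ + 1) * cB A B := by positivity
  have m2 : 0 ≤ (‖(1 : A)‖ + 1) * cS A a B := by positivity
  have e : ‖nlF a p q r u 5‖ ≤ (2 * |a| * d + 1 * d + d * (‖(1 : A)‖ + 1)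
      + 1 / 4 * (cB A B * d)) * g := by
    change ‖((2 * a) • u 1 + u 1 ^ 2 + u 2 ^ 2 * (1 + u 3) + (1 / 4 : ℝ) • nlB p q r u) * u 5‖ ≤ _
    have hsq : ∀ i, ‖u i ^ 2‖ ≤ d := fun i => by
      rw [sq]
      exact (norm_mul_le_mul' (hu1 i) (hu i)).trans (by rw [one_mul])
    refine norm_mul_le_mul' ?_ h5
    refine (norm_add_le _ _).trans (add_le_add (norm_add₃_le.trans
      (add_le_add (add_le_add ?_ ?_) ?_)) ?_)
    · exact norm_smul_le_mul' (by rw [abs_mul, abs_two]) (hu 1)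
    · rw [one_mul]; exact hsq 1
    · exact norm_mul_le_mul' (hsq 2) (norm_one_add_le (hu1 3))
    · exact norm_smul_le_mul' (by norm_num [abs_of_pos])
        (hb.trans (mul_le_mul_of_nonneg_left h55d nb))
  refine e.trans ?_
  have : (2 * |a| * d + 1 * d + d * (‖(1 : A)‖ + 1) + 1 / 4 * (cB A B * d)) * g
      = (2 * |a| + 1 + (‖(1 : A)‖ + 1) + 1 / 4 * cB A B) * (d * g) := by ring
  rw [this]
  refine mul_le_mul_of_nonneg_right ?_ hdg
  unfold cF; nlinarith

/-- The nonlinear terms in the equations for the converging components. -/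
lemma norm_nlF_converging_le (hp : |p| ≤ B) (hq : |q| ≤ B) (hr : |r| ≤ B) {u : Fin 6 → A}
    {g : ℝ} (hu : ∀ i, ‖u i‖ ≤ 1) (h2 : ‖u 2‖ ≤ g) (h4 : ‖u 4‖ ≤ g) (h5 : ‖u 5‖ ≤ g) :
    ‖nlF a p q r u 1‖ ≤ cF A a B * g ^ 2 ∧ ‖nlF a p q r u 3‖ ≤ cF A a B * g ^ 2 := by
  have hB : 0 ≤ B := (abs_nonneg _).trans hp
  have hg0 : 0 ≤ g := (norm_nonneg _).trans h2
  have hb := norm_nlB_le hp hq hr hu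
  have hs := norm_nlS_le (a := a) hp hq hr hu
  have nb := cB_nonneg (A := A) hB
  have ns := cS_nonneg (A := A) (a := a) hB
  have n1 := norm_nonneg (1 : A)
  have na := abs_nonneg a
  have h55 : ‖u 5‖ ^ 2 ≤ g ^ 2 := pow_le_pow_left₀ (norm_nonneg _) h5 2
  have m1 : 0 ≤ (‖(1 : A)‖ + 1) * cB A B := by positivity
  have m2 : 0 ≤ (‖(1 : A)‖ + 1) * cS A a B := by positivity
  constructor
  · have e : ‖nlF a p q r u 1‖ ≤ 1 / 2 * (g * g + cS A a B * g ^ 2) := by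
      change ‖(1 / 2 : ℝ) • (u 2 * u 4 + nlS a p q r u)‖ ≤ _
      exact norm_smul_le_mul' (by norm_num [abs_of_pos]) ((norm_add_le _ _).trans
        (add_le_add (norm_mul_le_mul' h2 h4) (hs.trans (mul_le_mul_of_nonneg_left h55 ns))))
    refine e.trans ?_
    have : 1 / 2 * (g * g + cS A a B * g ^ 2) = (1 / 2 + 1 / 2 * cS A a B) * g ^ 2 := by ring
    rw [this]
    refine mul_le_mul_of_nonneg_right ?_ (sq_nonneg g)
    unfold cF; nlinarith
  · have e : ‖nlF a p q r u 3‖ ≤ (‖(1 : A)‖ + 1) * (cB A B * g ^ 2) := by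
      change ‖-((1 + u 3) * nlB p q r u)‖ ≤ _
      rw [norm_neg]
      exact norm_mul_le_mul' (norm_one_add_le (hu 3)) (hb.trans (mul_le_mul_of_nonneg_left h55 nb))
    refine e.trans ?_
    rw [← mul_assoc]
    refine mul_le_mul_of_nonneg_right ?_ (sq_nonneg g)
    unfold cF; nlinarith

end Nonlinear

/-! ### The evolution equation in Sobolev algebras. -/

open Hsp

variable {j : ℕ}

lemma incl_nlF {m m' : ℕ} (h : m' ≤ m) (a p q r : ℝ) (u : Fin 6 → Hsp m) (i : Fin 6) :
    nlF a p q r (fun i => incl h (u i)) i = incl h (nlF a p q r u i) := by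
  ext x
  fin_cases i <;> simp [nlF, nlS, nlB]

/-- The coefficients of the linear part of `t ∂_t U`. -/
def linF (ℓ a : ℝ) : Fin 6 → ℝ := ![ℓ - a, 0, 1, 0, 1, a ^ 2 - 1]

/-- The derivative terms of the evolution equation. -/
def derF (u : Fin 6 → Hsp (j + 2)) : Fin 6 → Hsp (j + 1) :=
  ![0, (1 + incl (Nat.le_succ (j + 1)) (u 3)) * D (u 2), D (u 1), 0, 0, 0]

/-- The evolution equation solved for the time derivative. -/
def SysEq (ℓ a p q r t : ℝ) (u : Fin 6 → Hsp (j + 2)) (du : Fin 6 → Hsp (j + 1)) : Prop :=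
  ∀ i, du i = t⁻¹ • (linF ℓ a i • incl (Nat.le_succ (j + 1)) (u i)
    + incl (Nat.le_succ (j + 1)) (nlF a p q r u i)) + derF u i

end

end PolarisedT2

namespace PolarisedT2

noncomputable section

open Hsp

variable {j : ℕ}

/-! ### The energy inequality -/

/-- The mean of `∂_θ ((1 + ψ) f g)` is zero; expand by the product rule. -/
lemma avg_parts (ψ f g : Hsp 1) :
    avg ((1 + incl (Nat.zero_le 1) ψ) * (incl (Nat.zero_le 1) f * D g))
      + avg ((1 + incl (Nat.zero_le 1) ψ) * (incl (Nat.zero_le 1) g * D f))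
      = -avg (D ψ * incl (Nat.zero_le 1) f * incl (Nat.zero_le 1) g) := by
  have h := avg_D ((f * g) + ψ * (f * g))
  rw [map_add, D_mul, D_mul, D_mul, incl_mul] at h
  have e : D f * incl (Nat.le_succ 0) g + incl (Nat.le_succ 0) f * D g
      + (D ψ * (incl (Nat.le_succ 0) f * incl (Nat.le_succ 0) g)
        + incl (Nat.le_succ 0) ψ * (D f * incl (Nat.le_succ 0) g + incl (Nat.le_succ 0) f * D g))
      = (1 + incl (Nat.zero_le 1) ψ) * (incl (Nat.zero_le 1) f * D g)
        + (1 + incl (Nat.zero_le 1) ψ) * (incl (Nat.zero_le 1) g * D f)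
        + D ψ * incl (Nat.zero_le 1) f * incl (Nat.zero_le 1) g := by ring
  rw [e, map_add, map_add] at h
  linarith

/-- The regularised top-order derivative of an element of `H^{j+3}`. -/
def top (N : ℕ) (f : Hsp (j + 2)) : Hsp 0 := reg j N (incl (Nat.le_succ (j + 1)) f)

lemma nrm2_top_le (N : ℕ) (f : Hsp (j + 2)) : nrm2 (top N f) ≤ ‖f‖ :=
  (nrm2_reg_le j N f).trans (normH_le_norm f)

lemma abs_avg_top_le (N : ℕ) (f g : Hsp (j + 2)) {X Y : ℝ} (hf : ‖f‖ ≤ X) (hg : ‖g‖ ≤ Y) :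
    |avg (top N f * top N g)| ≤ X * Y :=
  (abs_avg_mul_le _ _).trans (mul_le_mul ((nrm2_top_le N f).trans hf) ((nrm2_top_le N g).trans hg)
    (nrm2_nonneg _) ((norm_nonneg _).trans hf))

/-- The regularised energy. -/
def energy (N : ℕ) (u : Fin 6 → Hsp (j + 2)) : ℝ :=
  avg (top N (u 0) * top N (u 0)) + avg (top N (u 1) * top N (u 1))
    + avg ((1 + incl (Nat.zero_le (j + 2)) (u 3)) * (top N (u 2) * top N (u 2)))
    + avg (top N (u 3) * top N (u 3)) + avg (top N (u 4) * top N (u 4))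
    + avg (top N (u 5) * top N (u 5))

/-- The time derivative of the regularised energy. -/
def energyDot (N : ℕ) (u : Fin 6 → Hsp (j + 2)) (du : Fin 6 → Hsp (j + 1)) : ℝ :=
  2 * avg (top N (u 0) * reg j N (du 0)) + 2 * avg (top N (u 1) * reg j N (du 1))
    + (2 * avg ((1 + incl (Nat.zero_le (j + 2)) (u 3)) * (top N (u 2) * reg j N (du 2)))
      + avg (incl (Nat.zero_le (j + 1)) (du 3) * top N (u 2) * top N (u 2)))
    + 2 * avg (top N (u 3) * reg j N (du 3)) + 2 * avg (top N (u 4) * reg j N (du 4))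
    + 2 * avg (top N (u 5) * reg j N (du 5))

/-- The trailing `+ 0` stands for an absent derivative term, so that the equations for `w₀`, `ψ`,
`η` and `ξ` fit this form as they are. -/
lemma avg_top_mul_reg (N : ℕ) (c s : ℝ) (f g : Hsp (j + 2)) :
    avg (top N f * reg j N (s • (c • incl (Nat.le_succ (j + 1)) f
      + incl (Nat.le_succ (j + 1)) g) + 0)) = s * (c * nrm2 (top N f) ^ 2 + avg (top N f * top N g)) := by
  have e : top N f * reg j N (s • (c • incl (Nat.le_succ (j + 1)) f
      + incl (Nat.le_succ (j + 1)) g) + 0) = s • (c • top N f ^ 2 + top N f * top N g) := by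
    rw [add_zero, map_smul, map_add, map_smul, mul_smul_comm, mul_add, mul_smul_comm]
    rw [sq]; rfl
  rw [e, map_smul, map_add, map_smul, avg_sq, smul_eq_mul, smul_eq_mul]

/-- The coefficient of the lower-order error terms in the energy inequality. -/
def cD (j : ℕ) : ℝ := 2 * (commConst j + 1) * ‖(D : Hsp (j + 1 + 1) →L[ℝ] Hsp (j + 1))‖

lemma cD_nonneg (j : ℕ) : 0 ≤ cD j := by
  have := commConst_nonneg j
  unfold cD; positivity

/-- The contribution of the derivative terms to the energy inequality. -/
lemma abs_avg_derivative_terms_le (N : ℕ) (u : Fin 6 → Hsp (j + 2)) {n : ℝ}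
    (hu1 : ∀ i, ‖u i‖ ≤ 1) (hn : ∀ i, ‖u i‖ ≤ n) :
    |2 * avg (top N (u 1) * reg j N ((1 + incl (Nat.le_succ (j + 1)) (u 3)) * D (u 2)))
      + 2 * avg ((1 + incl (Nat.zero_le (j + 2)) (u 3)) * (top N (u 2) * reg j N (D (u 1))))|
      ≤ cD j * n ^ 2 := by
  set nD := ‖(D : Hsp (j + 1 + 1) →L[ℝ] Hsp (j + 1))‖ with hnD
  have hD : ∀ i, ‖(D (u i) : Hsp (j + 1))‖ ≤ nD * ‖u i‖ := fun i => ContinuousLinearMap.le_opNorm _ _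
  have hn0 : 0 ≤ n := (norm_nonneg _).trans (hn 0)
  have hC := commConst_nonneg j
  have hnD0 : 0 ≤ nD := norm_nonneg _
  -- `R` is what remains when the regularised derivative is moved past the coefficient `1 + ψ`. The
  -- commutator estimate bounds it without losing a derivative.
  set R : Hsp 0 := reg j N (incl (Nat.le_succ (j + 1)) (u 3) * D (u 2))
    - incl (Nat.zero_le (j + 2)) (u 3) * reg j N (D (u 2)) with hR
  have hRn : nrm2 R ≤ commConst j * (1 * (nD * n)) := by
    refine (nrm2_comm_le j N (u 3) (D (u 2))).trans (mul_le_mul_of_nonneg_left ?_ hC)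
    exact mul_le_mul (hu1 3) ((hD 2).trans (mul_le_mul_of_nonneg_left (hn 2) hnD0))
      (norm_nonneg _) zero_le_one
  have e1 : reg j N ((1 + incl (Nat.le_succ (j + 1)) (u 3)) * D (u 2))
      = (1 + incl (Nat.zero_le (j + 2)) (u 3)) * reg j N (D (u 2)) + R := by
    rw [hR, add_mul, one_mul, map_add]; ring
  -- The two top-order terms cancel up to `∂_θ ψ`, thanks to the weight `1 + ψ` on `w₂` in the
  -- energy. The remaining term contains no derivative of the regularised functions.
  have e2 := avg_parts (incl (by omega : 1 ≤ j + 2) (u 3)) (reg' j N (u 1)) (reg' j N (u 2))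
  rw [incl_reg', incl_reg', D_reg', D_reg'] at e2
  have e3 : (incl (Nat.zero_le 1) (incl (by omega : 1 ≤ j + 2) (u 3)) : Hsp 0)
      = incl (Nat.zero_le (j + 2)) (u 3) := incl_incl _ _ _
  rw [e3] at e2
  have e4 : |avg (D (incl (by omega : 1 ≤ j + 2) (u 3)) * top N (u 1) * top N (u 2))|
      ≤ nD * (n * n) := by
    refine (abs_avg_mul_mul_le _ _ _ (M := nD) fun x => ?_).trans ?_
    · have h1 : (D (incl (by omega : 1 ≤ j + 2) (u 3)) : Hsp 0)
          = incl (Nat.zero_le (j + 1)) (D (u 3)) := D_incl (Nat.zero_le (j + 1)) (u 3)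
      rw [h1, incl_apply]
      refine (abs_apply_le _ x).trans ((hD 3).trans ?_)
      calc nD * ‖u 3‖ ≤ nD * 1 := mul_le_mul_of_nonneg_left (hu1 3) hnD0
        _ = nD := mul_one _
    · exact mul_le_mul_of_nonneg_left (mul_le_mul ((nrm2_top_le N _).trans (hn 1))
        ((nrm2_top_le N _).trans (hn 2)) (nrm2_nonneg _) hn0) hnD0
  have e5 : |avg (top N (u 1) * R)| ≤ n * (commConst j * (1 * (nD * n))) :=
    (abs_avg_mul_le _ _).trans (mul_le_mul ((nrm2_top_le N _).trans (hn 1)) hRn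
      (nrm2_nonneg _) hn0)
  have e6 : avg (top N (u 1) * reg j N ((1 + incl (Nat.le_succ (j + 1)) (u 3)) * D (u 2)))
      = avg ((1 + incl (Nat.zero_le (j + 2)) (u 3)) * (top N (u 1) * reg j N (D (u 2))))
        + avg (top N (u 1) * R) := by
    rw [e1, ← map_add]
    congr 1
    ring
  rw [e6]
  have e2' : avg ((1 + incl (Nat.zero_le (j + 2)) (u 3)) * (top N (u 1) * reg j N (D (u 2))))
      + avg ((1 + incl (Nat.zero_le (j + 2)) (u 3)) * (top N (u 2) * reg j N (D (u 1))))
      = -avg (D (incl (by omega : 1 ≤ j + 2) (u 3)) * top N (u 1) * top N (u 2)) := e2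
  have e7 : ∀ x y z : ℝ, 2 * (x + y) + 2 * z = 2 * (x + z) + 2 * y := fun x y z => by ring
  rw [e7, e2']
  rw [abs_le] at e4 e5 ⊢
  have e8 : cD j * n ^ 2 = 2 * (nD * (n * n)) + 2 * (n * (commConst j * (1 * (nD * n)))) := by
    rw [cD, ← hnD]; ring
  rw [e8]
  constructor <;> linarith [e4.1, e4.2, e5.1, e5.2]

/-- The damping acts on the four decaying components. Every singular error contains one factor
bounded by `d` and two bounded by `g`: for `w₁` and `ψ` the source is already quadratic in the
decaying components, and otherwise one decaying factor comes from the test function. The derivative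
terms carry no `1/t` and give only `cD j * n ^ 2`. -/
lemma energyDot_ge (N : ℕ) {ℓ a p q r t B κ d g n : ℝ} (hp : |p| ≤ B) (hq : |q| ≤ B)
    (hr : |r| ≤ B) (ht : 0 < t) (hκ0 : 0 ≤ κ) (hκ1 : κ ≤ 1) (hκ2 : κ ≤ ℓ - a) (hκ3 : κ ≤ a ^ 2 - 1)
    {u : Fin 6 → Hsp (j + 2)} {du : Fin 6 → Hsp (j + 1)} (hd : d ≤ 1 / 2)
    (hu : ∀ i, ‖u i‖ ≤ d) (hn : ∀ i, ‖u i‖ ≤ n) (h0 : ‖u 0‖ ≤ g) (h2 : ‖u 2‖ ≤ g)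
    (h4 : ‖u 4‖ ≤ g) (h5 : ‖u 5‖ ≤ g) (hsys : SysEq ℓ a p q r t u du) :
    t⁻¹ * (κ * (nrm2 (top N (u 0)) ^ 2 + nrm2 (top N (u 2)) ^ 2 + nrm2 (top N (u 4)) ^ 2
        + nrm2 (top N (u 5)) ^ 2) - 11 * cF (Hsp (j + 2)) a B * d * g ^ 2) - cD j * n ^ 2
      ≤ energyDot N u du := by
  have hd1 : d ≤ 1 := by linarith
  have hu1 : ∀ i, ‖u i‖ ≤ 1 := fun i => (hu i).trans hd1
  have hd0 : 0 ≤ d := (norm_nonneg _).trans (hu 0)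
  have hg0 : 0 ≤ g := (norm_nonneg _).trans h0
  have hB : 0 ≤ B := (abs_nonneg _).trans hp
  set c := cF (Hsp (j + 2)) a B with hc
  have hc0 : 0 < c := cF_pos hB
  have hti : 0 < t⁻¹ := inv_pos.mpr ht
  have f0 := (norm_nlF_zero_le (a := a) (p := p) (q := q) (r := r) hB hu).trans
    (mul_le_mul_of_nonneg_left (mul_le_mul_of_nonneg_left h0 hd0) hc0.le)
  have f4 := norm_nlF_four_le (a := a) hp hq hr hd1 hu h4 h5
  have f5 := (norm_nlF_five_le (a := a) hp hq hr hd1 hu).trans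
    (mul_le_mul_of_nonneg_left (mul_le_mul_of_nonneg_left h5 hd0) hc0.le)
  obtain ⟨f1, f3⟩ := norm_nlF_converging_le (a := a) hp hq hr hu1 h2 h4 h5
  rw [← hc] at f0 f1 f3 f4 f5
  have s0 : du 0 = t⁻¹ • ((ℓ - a) • incl (Nat.le_succ (j + 1)) (u 0)
    + incl (Nat.le_succ (j + 1)) (nlF a p q r u 0)) + 0 := hsys 0
  have s1 : du 1 = t⁻¹ • ((0 : ℝ) • incl (Nat.le_succ (j + 1)) (u 1)
    + incl (Nat.le_succ (j + 1)) (nlF a p q r u 1))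
      + (1 + incl (Nat.le_succ (j + 1)) (u 3)) * D (u 2) := hsys 1
  have s2 : du 2 = t⁻¹ • ((1 : ℝ) • incl (Nat.le_succ (j + 1)) (u 2)
    + incl (Nat.le_succ (j + 1)) (nlF a p q r u 2)) + D (u 1) := hsys 2
  have s3 : du 3 = t⁻¹ • ((0 : ℝ) • incl (Nat.le_succ (j + 1)) (u 3)
    + incl (Nat.le_succ (j + 1)) (nlF a p q r u 3)) + 0 := hsys 3
  have s4 : du 4 = t⁻¹ • ((1 : ℝ) • incl (Nat.le_succ (j + 1)) (u 4)
    + incl (Nat.le_succ (j + 1)) (nlF a p q r u 4)) + 0 := hsys 4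
  have s5 : du 5 = t⁻¹ • ((a ^ 2 - 1) • incl (Nat.le_succ (j + 1)) (u 5)
    + incl (Nat.le_succ (j + 1)) (nlF a p q r u 5)) + 0 := hsys 5
  have a0 := abs_avg_top_le N (u 0) _ h0 f0
  have a1 := abs_avg_top_le N (u 1) _ (hu 1) f1
  have a3 := abs_avg_top_le N (u 3) _ (hu 3) f3
  have a4 := abs_avg_top_le N (u 4) _ h4 f4
  have a5 := abs_avg_top_le N (u 5) _ h5 f5
  have hder := abs_avg_derivative_terms_le N u hu1 hn
  have b0 : avg (top N (u 0) * reg j N (du 0)) = t⁻¹ * ((ℓ - a) * nrm2 (top N (u 0)) ^ 2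
      + avg (top N (u 0) * top N (nlF a p q r u 0))) := by rw [s0, avg_top_mul_reg]
  have b3 : avg (top N (u 3) * reg j N (du 3)) = t⁻¹ * (0 * nrm2 (top N (u 3)) ^ 2
      + avg (top N (u 3) * top N (nlF a p q r u 3))) := by rw [s3, avg_top_mul_reg]
  have b4 : avg (top N (u 4) * reg j N (du 4)) = t⁻¹ * (1 * nrm2 (top N (u 4)) ^ 2
      + avg (top N (u 4) * top N (nlF a p q r u 4))) := by rw [s4, avg_top_mul_reg]
  have b5 : avg (top N (u 5) * reg j N (du 5)) = t⁻¹ * ((a ^ 2 - 1) * nrm2 (top N (u 5)) ^ 2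
      + avg (top N (u 5) * top N (nlF a p q r u 5))) := by rw [s5, avg_top_mul_reg]
  have b1 : avg (top N (u 1) * reg j N (du 1))
      = t⁻¹ * avg (top N (u 1) * top N (nlF a p q r u 1))
        + avg (top N (u 1) * reg j N ((1 + incl (Nat.le_succ (j + 1)) (u 3)) * D (u 2))) := by
    rw [s1, zero_smul, zero_add, map_add, mul_add, map_add, map_smul, mul_smul_comm, map_smul,
      smul_eq_mul]
    rfl
  have b2 : avg ((1 + incl (Nat.zero_le (j + 2)) (u 3)) * (top N (u 2) * reg j N (du 2)))
      = t⁻¹ * avg ((1 + incl (Nat.zero_le (j + 2)) (u 3)) * (top N (u 2) ^ 2))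
        + avg ((1 + incl (Nat.zero_le (j + 2)) (u 3)) * (top N (u 2) * reg j N (D (u 1)))) := by
    have z : incl (Nat.le_succ (j + 1)) (nlF a p q r u 2) = 0 := by
      change incl (Nat.le_succ (j + 1)) (0 : Hsp (j + 2)) = 0
      rw [map_zero]
    rw [s2, one_smul, z, add_zero, map_add, mul_add, mul_add, map_add, map_smul, mul_smul_comm,
      mul_smul_comm, map_smul, smul_eq_mul, sq]
    rfl
  -- As `1 + ψ ≥ 1/2`, the factor `2` from differentiating a square leaves at least the unweighted
  -- norm of `w₂`, and `κ ≤ 1` then suffices.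
  have b2' : 1 / 2 * nrm2 (top N (u 2)) ^ 2
      ≤ avg ((1 + incl (Nat.zero_le (j + 2)) (u 3)) * (top N (u 2) ^ 2)) := by
    rw [← avg_sq, ← smul_eq_mul, ← map_smul]
    refine avg_mono fun x => ?_
    have h3 := (abs_le.mp ((abs_apply_le (u 3) x).trans (hu 3))).1
    simp only [Hsp.smul_apply, Hsp.pow_apply, Hsp.mul_apply, Hsp.add_apply, Hsp.one_apply, incl_apply]
    exact mul_le_mul_of_nonneg_right (by linarith) (sq_nonneg _)
  -- The time derivative of the weight `1 + ψ` is `O(g² / t)`, so this term is of the same cubic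
  -- type as the other errors.
  have b6 : |avg (incl (Nat.zero_le (j + 1)) (du 3) * top N (u 2) * top N (u 2))|
      ≤ t⁻¹ * (c * g ^ 2) * (d * 1) := by
    refine (abs_avg_mul_mul_le _ _ _ (M := t⁻¹ * (c * g ^ 2)) fun x => ?_).trans ?_
    · rw [s3, zero_smul, zero_add, add_zero, incl_apply, Hsp.smul_apply, incl_apply, abs_mul,
        abs_of_pos hti]
      exact mul_le_mul_of_nonneg_left ((abs_apply_le _ x).trans f3) hti.le
    · exact mul_le_mul_of_nonneg_left (mul_le_mul ((nrm2_top_le N _).trans (hu 2))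
        ((nrm2_top_le N _).trans (hu1 2)) (nrm2_nonneg _) hd0) (by positivity)
  have n0 := sq_nonneg (nrm2 (top N (u 0)))
  have n2 := sq_nonneg (nrm2 (top N (u 2)))
  have n4 := sq_nonneg (nrm2 (top N (u 4)))
  have n5 := sq_nonneg (nrm2 (top N (u 5)))
  set y0 := nrm2 (top N (u 0)) ^ 2
  set y2 := nrm2 (top N (u 2)) ^ 2
  set y4 := nrm2 (top N (u 4)) ^ 2
  set y5 := nrm2 (top N (u 5)) ^ 2
  -- The count `11` is two for each of the five nonlinear sources (the one for `w₂` vanishes) and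
  -- one for the derivative of the weight.
  have hcollect : κ * (y0 + y2 + y4 + y5) - 11 * c * d * g ^ 2
      ≤ 2 * ((ℓ - a) * y0 + avg (top N (u 0) * top N (nlF a p q r u 0)))
        + 2 * avg (top N (u 1) * top N (nlF a p q r u 1))
        + 2 * avg ((1 + incl (Nat.zero_le (j + 2)) (u 3)) * (top N (u 2) ^ 2))
        - c * g ^ 2 * (d * 1)
        + 2 * avg (top N (u 3) * top N (nlF a p q r u 3))
        + 2 * (1 * y4 + avg (top N (u 4) * top N (nlF a p q r u 4)))
        + 2 * ((a ^ 2 - 1) * y5 + avg (top N (u 5) * top N (nlF a p q r u 5))) := by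
    have z0 := mul_nonneg hκ0 n0
    have z4 := mul_nonneg hκ0 n4
    have z5 := mul_nonneg hκ0 n5
    have k0 : κ * y0 ≤ (ℓ - a) * y0 := mul_le_mul_of_nonneg_right hκ2 n0
    have k2 : κ * y2 ≤ 1 * y2 := mul_le_mul_of_nonneg_right hκ1 n2
    have k4 : κ * y4 ≤ 1 * y4 := mul_le_mul_of_nonneg_right hκ1 n4
    have k5 : κ * y5 ≤ (a ^ 2 - 1) * y5 := mul_le_mul_of_nonneg_right hκ3 n5
    have x0 := (abs_le.mp a0).1
    have x1 := (abs_le.mp a1).1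
    have x3 := (abs_le.mp a3).1
    have x4 := (abs_le.mp a4).1
    have x5 := (abs_le.mp a5).1
    linarith
  have := mul_le_mul_of_nonneg_left hcollect hti.le
  rw [energyDot, b0, b1, b2, b3, b4, b5]
  have x1 := (abs_le.mp hder).1
  have x2 := (abs_le.mp b6).1
  linarith

end

end PolarisedT2

namespace PolarisedT2

noncomputable section

open Hsp

variable {j : ℕ}

/-! ### Solutions and the a priori estimate -/

/-- A solution of the evolution equation, as a curve in `H^{j+3}` that is differentiable in
`H^{j+2}`. -/
structure Soln (ℓ a T₀ p : ℝ) (q r : ℝ → ℝ) (u : ℝ → Fin 6 → Hsp (j + 2))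
    (du : ℝ → Fin 6 → Hsp (j + 1)) : Prop where
  cont : ∀ i, ContinuousOn (fun t => u t i) (Ioc 0 T₀)
  deriv : ∀ i, ∀ t ∈ Ioc 0 T₀,
    HasDerivWithinAt (fun s => incl (Nat.le_succ (j + 1)) (u s i)) (du t i) (Ioc 0 T₀) t
  contDeriv : ∀ i, ContinuousOn (fun t => du t i) (Ioc 0 T₀)
  sys : ∀ t ∈ Ioc 0 T₀, (∀ x, 0 < 1 + u t 3 x) → SysEq ℓ a p (q t) (r t) t (u t) (du t)

lemma hasDerivWithinAt_energy (N : ℕ) {u : ℝ → Fin 6 → Hsp (j + 2)} {du : Fin 6 → Hsp (j + 1)}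
    {I : Set ℝ} {t : ℝ} (h : ∀ i, HasDerivWithinAt
      (fun s => incl (Nat.le_succ (j + 1)) (u s i)) (du i) I t) :
    HasDerivWithinAt (fun s => energy N (u s)) (energyDot N (u t) du) I t := by
  have h1 : ∀ i, HasDerivWithinAt (fun s => top N (u s i)) (reg j N (du i)) I t := fun i =>
    (reg j N).hasFDerivAt.comp_hasDerivWithinAt t (h i)
  have hψ : HasDerivWithinAt (fun s => incl (Nat.zero_le (j + 2)) (u s 3))
      (incl (Nat.zero_le (j + 1)) (du 3)) I t := by
    have := (incl (Nat.zero_le (j + 1))).hasFDerivAt.comp_hasDerivWithinAt t (h 3)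
    refine this.congr_of_eventuallyEq (Eventually.of_forall fun s => ?_) ?_ <;>
      exact (incl_incl _ _ _).symm
  have h2 : ∀ i, HasDerivWithinAt (fun s => avg (top N (u s i) * top N (u s i)))
      (2 * avg (top N (u t i) * reg j N (du i))) I t := fun i => by
    have := avg.hasFDerivAt.comp_hasDerivWithinAt t ((h1 i).mul (h1 i))
    refine this.congr_deriv ?_
    rw [map_add, mul_comm, two_mul]
  have h3 : HasDerivWithinAt
      (fun s => avg ((1 + incl (Nat.zero_le (j + 2)) (u s 3)) * (top N (u s 2) * top N (u s 2))))
      (2 * avg ((1 + incl (Nat.zero_le (j + 2)) (u t 3)) * (top N (u t 2) * reg j N (du 2)))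
        + avg (incl (Nat.zero_le (j + 1)) (du 3) * top N (u t 2) * top N (u t 2))) I t := by
    have := avg.hasFDerivAt.comp_hasDerivWithinAt t
      ((hψ.const_add 1).mul ((h1 2).mul (h1 2)))
    refine this.congr_deriv ?_
    rw [two_mul, ← map_add, ← map_add]
    congr 1
    change _ * (top N (u t 2) * top N (u t 2)) + _ = _
    ring
  exact (((((h2 0).add (h2 1)).add h3).add (h2 3)).add (h2 4)).add (h2 5)

/-- The sum of the squares of the regularised top-order norms. -/
def regNormSq (N : ℕ) (u : Fin 6 → Hsp (j + 2)) : ℝ := ∑ i, nrm2 (top N (u i)) ^ 2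

/-- The square of the `H^{j+3}` norm. -/
def sobNormSq (u : Fin 6 → Hsp (j + 2)) : ℝ := ∑ i, normH (j + 3) (u i) ^ 2

lemma avg_top_self (N : ℕ) (f : Hsp (j + 2)) : avg (top N f * top N f) = nrm2 (top N f) ^ 2 := by
  rw [← avg_sq, sq]

lemma energy_bounds (N : ℕ) {u : Fin 6 → Hsp (j + 2)} (h : ‖u 3‖ ≤ 1 / 2) :
    1 / 2 * regNormSq N u ≤ energy N u ∧ energy N u ≤ 2 * regNormSq N u := by
  have hψ : ∀ x, |u 3 x| ≤ 1 / 2 := fun x => (abs_apply_le _ x).trans h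
  have h1 : 1 / 2 * nrm2 (top N (u 2)) ^ 2
      ≤ avg ((1 + incl (Nat.zero_le (j + 2)) (u 3)) * (top N (u 2) * top N (u 2))) := by
    rw [← avg_sq, ← smul_eq_mul, ← map_smul]
    refine avg_mono fun x => ?_
    simp only [Hsp.smul_apply, Hsp.pow_apply, Hsp.mul_apply, Hsp.add_apply, Hsp.one_apply,
      incl_apply]
    rw [← sq]
    exact mul_le_mul_of_nonneg_right (by linarith [(abs_le.mp (hψ x)).1]) (sq_nonneg _)
  have h2 : avg ((1 + incl (Nat.zero_le (j + 2)) (u 3)) * (top N (u 2) * top N (u 2)))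
      ≤ 2 * nrm2 (top N (u 2)) ^ 2 := by
    rw [← avg_sq, ← smul_eq_mul (2 : ℝ), ← map_smul]
    refine avg_mono fun x => ?_
    simp only [Hsp.smul_apply, Hsp.pow_apply, Hsp.mul_apply, Hsp.add_apply, Hsp.one_apply,
      incl_apply]
    rw [← sq]
    exact mul_le_mul_of_nonneg_right (by linarith [(abs_le.mp (hψ x)).2]) (sq_nonneg _)
  have n := fun i => sq_nonneg (nrm2 (top N (u i)))
  simp only [energy, regNormSq, Fin.sum_univ_six, avg_top_self]
  constructor <;> linarith [n 0, n 1, n 3, n 4, n 5]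

lemma regNormSq_le (N : ℕ) (u : Fin 6 → Hsp (j + 2)) : regNormSq N u ≤ sobNormSq u :=
  Finset.sum_le_sum fun i _ => pow_le_pow_left₀ (nrm2_nonneg _) (nrm2_reg_le j N (u i)) 2

lemma tendsto_regNormSq (u : Fin 6 → Hsp (j + 2)) :
    Tendsto (fun N => regNormSq N u) atTop (𝓝 (sobNormSq u)) :=
  tendsto_finsetSum _ fun i _ => tendsto_nrm2_reg j (u i)

/-- The square of the `H^{j+3}` norm of the decaying components. -/
def decNormSq (u : Fin 6 → Hsp (j + 2)) : ℝ :=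
  normH (j + 3) (u 0) ^ 2 + normH (j + 3) (u 2) ^ 2 + normH (j + 3) (u 4) ^ 2
    + normH (j + 3) (u 5) ^ 2

/-- The regularised version of `decNormSq`. -/
def regDecNormSq (N : ℕ) (u : Fin 6 → Hsp (j + 2)) : ℝ :=
  nrm2 (top N (u 0)) ^ 2 + nrm2 (top N (u 2)) ^ 2 + nrm2 (top N (u 4)) ^ 2
    + nrm2 (top N (u 5)) ^ 2

lemma regDecNormSq_nonneg (N : ℕ) (u : Fin 6 → Hsp (j + 2)) : 0 ≤ regDecNormSq N u := by
  unfold regDecNormSq; positivity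

lemma decNormSq_nonneg (u : Fin 6 → Hsp (j + 2)) : 0 ≤ decNormSq u := by
  unfold decNormSq; positivity

lemma sobNormSq_nonneg (u : Fin 6 → Hsp (j + 2)) : 0 ≤ sobNormSq u :=
  Finset.sum_nonneg fun _ _ => sq_nonneg _

lemma regDecNormSq_le (N : ℕ) (u : Fin 6 → Hsp (j + 2)) : regDecNormSq N u ≤ decNormSq u := by
  have h := fun i => pow_le_pow_left₀ (nrm2_nonneg _) (nrm2_reg_le j N (u i)) 2
  exact add_le_add (add_le_add (add_le_add (h 0) (h 2)) (h 4)) (h 5)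

lemma tendsto_regDecNormSq (u : Fin 6 → Hsp (j + 2)) :
    Tendsto (fun N => regDecNormSq N u) atTop (𝓝 (decNormSq u)) :=
  (((tendsto_nrm2_reg j (u 0)).add (tendsto_nrm2_reg j (u 2))).add
    (tendsto_nrm2_reg j (u 4))).add (tendsto_nrm2_reg j (u 5))

lemma normH_eq_norm {m : ℕ} (f : Hsp m) : normH (m + 1) f = (algConst m)⁻¹ * ‖f‖ := by
  rw [norm_eq, inv_mul_cancel_left₀]
  exact (lt_of_lt_of_le one_pos (one_le_algConst m)).ne'

lemma norm_le_of_sobNormSq (u : Fin 6 → Hsp (j + 2)) (i : Fin 6) :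
    ‖u i‖ ≤ √(algConst (j + 2) ^ 2 * sobNormSq u) := by
  refine Real.le_sqrt_of_sq_le ?_
  rw [norm_eq, mul_pow]
  exact mul_le_mul_of_nonneg_left
    (Finset.single_le_sum (f := fun i => normH (j + 3) (u i) ^ 2) (fun _ _ => sq_nonneg _)
      (Finset.mem_univ i)) (sq_nonneg _)

/-- Gronwall's inequality in integral form, backwards in time. -/
lemma gronwall_integral {y : ℝ → ℝ} {s T A C : ℝ} (hsT : s ≤ T) (hC : 0 ≤ C)
    (hy : ContinuousOn y (Icc s T)) (h : ∀ r ∈ Icc s T, y r ≤ A + C * ∫ x in r..T, y x) :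
    y s ≤ A * exp (C * (T - s)) := by
  set F : ℝ → ℝ := fun r => A + C * ∫ x in r..T, y x with hF
  have hint : ∀ r ∈ Icc s T, IntervalIntegrable y MeasureTheory.volume r T := fun r hr =>
    (hy.mono (Icc_subset_Icc_left hr.1)).intervalIntegrable_of_Icc hr.2
  have hcont : ContinuousOn (fun r => F r * exp (C * r)) (Icc s T) := by
    have h1 : ContinuousOn (fun r => ∫ x in r..T, y x) (Icc s T) := by
      have h2 := intervalIntegral.continuousOn_primitive_interval_left
        (μ := MeasureTheory.volume) (f := y) (a := s) (b := T) (by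
          rw [uIcc_of_le hsT]; exact hy.integrableOn_Icc)
      rwa [uIcc_of_le hsT] at h2
    have h3 : ContinuousOn F (Icc s T) := continuousOn_const.add (continuousOn_const.mul h1)
    exact h3.mul (by fun_prop)
  have hderiv : ∀ r ∈ Ioo s T, HasDerivAt (fun r => F r * exp (C * r))
      (-(C * y r) * exp (C * r) + F r * (exp (C * r) * C)) r := fun r hr => by
    have hr' : r ∈ Icc s T := Ioo_subset_Icc_self hr
    have hat : ContinuousAt y r := hy.continuousAt (Icc_mem_nhds hr.1 hr.2)
    have h1 : HasDerivAt (fun r => ∫ x in r..T, y x) (-y r) r :=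
      intervalIntegral.integral_hasDerivAt_left (hint r hr')
        (hy.stronglyMeasurableAtFilter_nhdsWithin measurableSet_Icc r |>.filter_mono (by
          rw [nhdsWithin_eq_nhds.mpr (Icc_mem_nhds hr.1 hr.2)])) hat
    have h2 : HasDerivAt F (-(C * y r)) r := by
      refine ((h1.const_mul C).const_add A).congr_deriv ?_
      ring
    have h3 : HasDerivAt (fun r => exp (C * r)) (exp (C * r) * C) r := by
      have := ((hasDerivAt_id r).const_mul C).exp
      simpa using this
    exact h2.mul h3
  -- The derivative is `C (F - y) exp (C r)`, nonnegative exactly because of the hypothesis `y ≤ F`.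
  have hmono : MonotoneOn (fun r => F r * exp (C * r)) (Icc s T) := by
    refine monotoneOn_of_deriv_nonneg (convex_Icc s T) hcont ?_ ?_
    · rw [interior_Icc]
      exact fun r hr => (hderiv r hr).differentiableAt.differentiableWithinAt
    · rw [interior_Icc]
      intro r hr
      rw [(hderiv r hr).deriv]
      have := h r (Ioo_subset_Icc_self hr)
      have h1 : 0 ≤ C * (F r - y r) * exp (C * r) :=
        mul_nonneg (mul_nonneg hC (by linarith)) (exp_pos _).le
      linarith
  have h1 := hmono (left_mem_Icc.mpr hsT) (right_mem_Icc.mpr hsT) hsT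
  have hFT : F T = A := by simp [hF]
  simp only [hFT] at h1
  have h2 : y s ≤ F s := h s (left_mem_Icc.mpr hsT)
  have h3 : F s ≤ A * exp (C * (T - s)) := by
    have h4 : exp (C * (T - s)) = exp (C * T) * exp (-(C * s)) := by
      rw [← exp_add]; ring_nf
    have h5 : exp (C * s) * exp (-(C * s)) = 1 := by rw [← exp_add]; simp
    calc F s = F s * exp (C * s) * exp (-(C * s)) := by rw [mul_assoc, h5, mul_one]
      _ ≤ A * exp (C * T) * exp (-(C * s)) := mul_le_mul_of_nonneg_right h1 (exp_pos _).le
      _ = _ := by rw [h4]; ring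
  exact h2.trans h3

lemma continuousOn_normH {u : ℝ → Fin 6 → Hsp (j + 2)} {I : Set ℝ}
    (h : ∀ i, ContinuousOn (fun t => u t i) I) (i : Fin 6) :
    ContinuousOn (fun t => normH (j + 3) (u t i) ^ 2) I := by
  have : (fun t => normH (j + 3) (u t i) ^ 2) = fun t => ((algConst (j + 2))⁻¹ * ‖u t i‖) ^ 2 :=
    funext fun t => by rw [normH_eq_norm]
  rw [this]
  exact (continuousOn_const.mul (h i).norm).pow 2

lemma continuousOn_nrm2_top (N : ℕ) {u : ℝ → Fin 6 → Hsp (j + 2)} {I : Set ℝ}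
    (h : ∀ i, ContinuousOn (fun t => u t i) I) (i : Fin 6) :
    ContinuousOn (fun t => nrm2 (top N (u t i)) ^ 2) I := by
  have e : (fun t => nrm2 (top N (u t i)) ^ 2) = fun t => avg (top N (u t i) * top N (u t i)) :=
    funext fun t => (avg_top_self N _).symm
  rw [e]
  have h1 : ContinuousOn (fun t => top N (u t i)) I :=
    (reg j N).continuous.comp_continuousOn
      ((incl (Nat.le_succ (j + 1))).continuous.comp_continuousOn (h i))
  exact avg.continuous.comp_continuousOn (h1.mul h1)

/-! ### The energy bound and the continuity argument. -/

section Apriori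

variable {ℓ a T₀ p B κ d : ℝ} {q r : ℝ → ℝ} {u : ℝ → Fin 6 → Hsp (j + 2)}
  {du : ℝ → Fin 6 → Hsp (j + 1)}

/-- The exponential rate in the a priori estimate. -/
def cG (j : ℕ) : ℝ := 2 * (cD j * algConst (j + 2) ^ 2)

lemma cG_nonneg (j : ℕ) : 0 ≤ cG j := by
  have := cD_nonneg j
  unfold cG; positivity

/-- For finite `N` the damping controls only the regularised norm, while the nonlinear error is
bounded by the full norm. Absorption is therefore carried out after the limit `N → ∞`, where `hdκ`
makes the difference nonnegative. -/
lemma energy_integral_le (hu : Soln ℓ a T₀ p q r u du) (hp : |p| ≤ B)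
    (hq : ∀ t ∈ Ioc 0 T₀, |q t| ≤ B) (hr : ∀ t ∈ Ioc 0 T₀, |r t| ≤ B) (hκ0 : 0 ≤ κ) (hκ1 : κ ≤ 1)
    (hκ2 : κ ≤ ℓ - a) (hκ3 : κ ≤ a ^ 2 - 1) (hd : d ≤ 1 / 2)
    (hdκ : 11 * cF (Hsp (j + 2)) a B * d * algConst (j + 2) ^ 2 ≤ κ) {s : ℝ} (hs : 0 < s)
    (hsT : s ≤ T₀) (hsmall : ∀ t ∈ Icc s T₀, ∀ i, ‖u t i‖ ≤ d) :
    sobNormSq (u s) ≤ 4 * sobNormSq (u T₀) + cG j * ∫ t in s..T₀, sobNormSq (u t) := by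
  set K := algConst (j + 2) with hK
  set c := cF (Hsp (j + 2)) a B with hc
  have hsub : Icc s T₀ ⊆ Ioc 0 T₀ := fun t ht => ⟨hs.trans_le ht.1, ht.2⟩
  have hcont : ∀ i, ContinuousOn (fun t => u t i) (Icc s T₀) := fun i => (hu.cont i).mono hsub
  have hinv : ContinuousOn (fun t : ℝ => t⁻¹) (Icc s T₀) :=
    continuousOn_inv₀.mono fun t ht => (hs.trans_le ht.1).ne'
  have hcD : ContinuousOn (fun t => decNormSq (u t)) (Icc s T₀) :=
    (((continuousOn_normH hcont 0).add (continuousOn_normH hcont 2)).add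
      (continuousOn_normH hcont 4)).add (continuousOn_normH hcont 5)
  have hcS : ContinuousOn (fun t => sobNormSq (u t)) (Icc s T₀) :=
    continuousOn_finsetSum _ fun i _ => continuousOn_normH hcont i
  have hcR : ∀ N, ContinuousOn (fun t => regDecNormSq N (u t)) (Icc s T₀) := fun N =>
    (((continuousOn_nrm2_top N hcont 0).add (continuousOn_nrm2_top N hcont 2)).add
      (continuousOn_nrm2_top N hcont 4)).add (continuousOn_nrm2_top N hcont 5)
  set φ : ℕ → ℝ → ℝ := fun N t => t⁻¹ * (κ * regDecNormSq N (u t)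
    - 11 * c * d * (K ^ 2 * decNormSq (u t))) - cD j * (K ^ 2 * sobNormSq (u t)) with hφ
  set φ' : ℝ → ℝ := fun t => t⁻¹ * (κ * decNormSq (u t)
    - 11 * c * d * (K ^ 2 * decNormSq (u t))) - cD j * (K ^ 2 * sobNormSq (u t)) with hφ'
  have hcφ : ∀ N, ContinuousOn (φ N) (Icc s T₀) := fun N =>
    (hinv.mul ((continuousOn_const.mul (hcR N)).sub (continuousOn_const.mul
      (continuousOn_const.mul hcD)))).sub (continuousOn_const.mul (continuousOn_const.mul hcS))
  have hcφ' : ContinuousOn φ' (Icc s T₀) :=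
    (hinv.mul ((continuousOn_const.mul hcD).sub (continuousOn_const.mul
      (continuousOn_const.mul hcD)))).sub (continuousOn_const.mul (continuousOn_const.mul hcS))
  have hstep : ∀ N, ∫ t in s..T₀, φ N t ≤ energy N (u T₀) - energy N (u s) := fun N => by
    have hE : ∀ t ∈ Icc s T₀, HasDerivWithinAt (fun s => energy N (u s))
        (energyDot N (u t) (du t)) (Ioc 0 T₀) t := fun t ht =>
      hasDerivWithinAt_energy N fun i => hu.deriv i t (hsub ht)
    refine intervalIntegral.integral_le_sub_of_hasDeriv_right_of_le
      (g' := fun t => energyDot N (u t) (du t)) hsT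
      (fun t ht => ((hE t ht).mono hsub).continuousWithinAt) (fun t ht => ?_)
      (hcφ N).integrableOn_Icc (fun t ht => ?_)
    · have h1 := hE t (Ioo_subset_Icc_self ht)
      refine (h1.hasDerivAt (mem_of_superset (Ioo_mem_nhds ht.1 ht.2) fun x hx =>
        hsub (Ioo_subset_Icc_self hx))).hasDerivWithinAt
    · have ht' := Ioo_subset_Icc_self ht
      have htI := hsub ht'
      have hud := hsmall t ht'
      have hsys := hu.sys t htI fun x => by
        have := (abs_le.mp ((abs_apply_le (u t 3) x).trans (hud 3))).1
        linarith
      have hdec : ∀ i, normH (j + 3) (u t i) ^ 2 ≤ decNormSq (u t) →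
          ‖u t i‖ ≤ √(K ^ 2 * decNormSq (u t)) := fun i hi => by
        refine Real.le_sqrt_of_sq_le ?_
        rw [norm_eq, mul_pow]
        exact mul_le_mul_of_nonneg_left hi (sq_nonneg _)
      have sqn := fun i => sq_nonneg (normH (j + 3) (u t i))
      have hge := energyDot_ge N (κ := κ) (d := d) (g := √(K ^ 2 * decNormSq (u t)))
        (n := √(K ^ 2 * sobNormSq (u t))) hp (hq t htI) (hr t htI) htI.1 hκ0 hκ1 hκ2 hκ3 hd hud
        (fun i => norm_le_of_sobNormSq (u t) i)
        (hdec 0 (by unfold decNormSq; linarith [sqn 0, sqn 2, sqn 4, sqn 5]))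
        (hdec 2 (by unfold decNormSq; linarith [sqn 0, sqn 2, sqn 4, sqn 5]))
        (hdec 4 (by unfold decNormSq; linarith [sqn 0, sqn 2, sqn 4, sqn 5]))
        (hdec 5 (by unfold decNormSq; linarith [sqn 0, sqn 2, sqn 4, sqn 5])) hsys
      rw [Real.sq_sqrt (mul_nonneg (sq_nonneg _) (decNormSq_nonneg _)),
        Real.sq_sqrt (mul_nonneg (sq_nonneg _) (sobNormSq_nonneg _))] at hge
      exact hge
  -- The energy is comparable to the regularised norm with constants `1/2` and `2`. These become the
  -- factor `4` in the conclusion, and the same doubling is built into `cG`.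
  have hineq : ∀ N, 1 / 2 * regNormSq N (u s) ≤ 2 * sobNormSq (u T₀) - ∫ t in s..T₀, φ N t :=
    fun N => by
      have h1 := (energy_bounds N ((hsmall s (left_mem_Icc.mpr hsT) 3).trans hd)).1
      have h2 := (energy_bounds N ((hsmall T₀ (right_mem_Icc.mpr hsT) 3).trans hd)).2
      have h3 := regNormSq_le N (u T₀)
      have h4 := hstep N
      linarith
  -- On `[s, T₀]` the factor `t⁻¹` is bounded, and the regularised norm is dominated by the full
  -- one, which is continuous in time.
  have hlim : Tendsto (fun N => ∫ t in s..T₀, φ N t) atTop (𝓝 (∫ t in s..T₀, φ' t)) := by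
    refine intervalIntegral.tendsto_integral_filter_of_dominated_convergence
      (fun t => t⁻¹ * (κ * decNormSq (u t) + |11 * c * d * (K ^ 2 * decNormSq (u t))|)
        + cD j * (K ^ 2 * sobNormSq (u t))) (Eventually.of_forall fun N => ?_)
      (Eventually.of_forall fun N => Eventually.of_forall fun t ht => ?_) ?_
      (Eventually.of_forall fun t _ => ?_)
    · rw [uIoc_of_le hsT]
      exact ((hcφ N).mono Ioc_subset_Icc_self).aestronglyMeasurable measurableSet_Ioc
    · rw [uIoc_of_le hsT] at ht
      have ht0 : 0 ≤ t⁻¹ := inv_nonneg.mpr (hs.trans ht.1).le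
      have n1 := regDecNormSq_nonneg N (u t)
      have n2 := regDecNormSq_le N (u t)
      have n3 : 0 ≤ cD j * (K ^ 2 * sobNormSq (u t)) :=
        mul_nonneg (cD_nonneg j) (mul_nonneg (sq_nonneg _) (sobNormSq_nonneg _))
      rw [Real.norm_eq_abs]
      refine (abs_sub _ _).trans (add_le_add ?_ (le_of_eq (abs_of_nonneg n3)))
      rw [abs_mul, abs_of_nonneg ht0]
      refine mul_le_mul_of_nonneg_left ((abs_sub _ _).trans (add_le_add ?_ le_rfl)) ht0
      rw [abs_of_nonneg (mul_nonneg hκ0 n1)]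
      exact mul_le_mul_of_nonneg_left n2 hκ0
    · refine ContinuousOn.intervalIntegrable_of_Icc hsT ?_
      exact (hinv.mul ((continuousOn_const.mul hcD).add (continuousOn_const.mul
        (continuousOn_const.mul hcD)).abs)).add (continuousOn_const.mul (continuousOn_const.mul hcS))
    · exact ((((tendsto_regDecNormSq (u t)).const_mul κ).sub_const _).const_mul _).sub_const _
  have hfin := le_of_tendsto_of_tendsto' ((tendsto_regNormSq (u s)).const_mul (1 / 2))
    (hlim.const_sub (2 * sobNormSq (u T₀))) hineq
  -- Here the singular part of the limiting integrand is discarded, because it is nonnegative.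
  have hlow : ∫ t in s..T₀, -(cD j * K ^ 2) * sobNormSq (u t) ≤ ∫ t in s..T₀, φ' t := by
    refine intervalIntegral.integral_mono_on hsT
      ((continuousOn_const.mul hcS).intervalIntegrable_of_Icc hsT)
      (hcφ'.intervalIntegrable_of_Icc hsT) fun t ht => ?_
    have ht0 : 0 ≤ t⁻¹ := inv_nonneg.mpr (hs.trans_le ht.1).le
    have h1 : 0 ≤ t⁻¹ * ((κ - 11 * c * d * K ^ 2) * decNormSq (u t)) :=
      mul_nonneg ht0 (mul_nonneg (by linarith) (decNormSq_nonneg _))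
    simp only [hφ']
    linarith
  rw [intervalIntegral.integral_const_mul] at hlow
  rw [cG, ← hK]
  linarith

lemma sobNormSq_le_exp (hu : Soln ℓ a T₀ p q r u du) (hp : |p| ≤ B)
    (hq : ∀ t ∈ Ioc 0 T₀, |q t| ≤ B) (hr : ∀ t ∈ Ioc 0 T₀, |r t| ≤ B) (hκ0 : 0 ≤ κ) (hκ1 : κ ≤ 1)
    (hκ2 : κ ≤ ℓ - a) (hκ3 : κ ≤ a ^ 2 - 1) (hd : d ≤ 1 / 2)
    (hdκ : 11 * cF (Hsp (j + 2)) a B * d * algConst (j + 2) ^ 2 ≤ κ) {s : ℝ} (hs : 0 < s)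
    (hsT : s ≤ T₀) (hsmall : ∀ t ∈ Icc s T₀, ∀ i, ‖u t i‖ ≤ d) :
    sobNormSq (u s) ≤ 4 * sobNormSq (u T₀) * exp (cG j * (T₀ - s)) := by
  have hsub : Icc s T₀ ⊆ Ioc 0 T₀ := fun t ht => ⟨hs.trans_le ht.1, ht.2⟩
  refine gronwall_integral (y := fun t => sobNormSq (u t)) hsT (cG_nonneg j)
    (continuousOn_finsetSum _ fun i _ =>
      continuousOn_normH (fun i => (hu.cont i).mono hsub) i) fun t ht => ?_
  exact energy_integral_le hu hp hq hr hκ0 hκ1 hκ2 hκ3 hd hdκ (hs.trans_le ht.1) ht.2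
    fun x hx => hsmall x ⟨ht.1.trans hx.1, hx.2⟩

/-- Solutions with small data stay small. -/
lemma small_of_small_data (hu : Soln ℓ a T₀ p q r u du) (hT₀ : 0 < T₀) (hp : |p| ≤ B)
    (hq : ∀ t ∈ Ioc 0 T₀, |q t| ≤ B) (hr : ∀ t ∈ Ioc 0 T₀, |r t| ≤ B) (hκ0 : 0 ≤ κ) (hκ1 : κ ≤ 1)
    (hκ2 : κ ≤ ℓ - a) (hκ3 : κ ≤ a ^ 2 - 1) (hd0 : 0 ≤ d) (hd : d ≤ 1 / 2)
    (hdκ : 11 * cF (Hsp (j + 2)) a B * d * algConst (j + 2) ^ 2 ≤ κ)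
    (hdata : algConst (j + 2) ^ 2 * (4 * sobNormSq (u T₀) * exp (cG j * T₀)) < d ^ 2) :
    ∀ t ∈ Ioc 0 T₀, ∀ i, ‖u t i‖ ≤ d := by
  set K := algConst (j + 2) with hK
  have hK0 : 0 < K ^ 2 := pow_pos (lt_of_lt_of_le one_pos (one_le_algConst _)) 2
  suffices h : ∀ t ∈ Ioc 0 T₀, K ^ 2 * sobNormSq (u t) < d ^ 2 by
    intro t ht i
    refine (norm_le_of_sobNormSq (u t) i).trans ?_
    rw [← hK, ← Real.sqrt_sq hd0]
    exact Real.sqrt_le_sqrt (h t ht).le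
  by_contra! hcon
  obtain ⟨t₁, ht₁, hbig⟩ := hcon
  have hsub : Icc t₁ T₀ ⊆ Ioc 0 T₀ := fun t ht => ⟨ht₁.1.trans_le ht.1, ht.2⟩
  have hc : ContinuousOn (fun t => K ^ 2 * sobNormSq (u t)) (Icc t₁ T₀) :=
    continuousOn_const.mul (continuousOn_finsetSum _ fun i _ =>
      continuousOn_normH (fun i => (hu.cont i).mono hsub) i)
  -- `S` collects the times in `[t₁, T₀]` at which the bound fails. It is compact, so it contains a
  -- last such time `s`. On `[s, T₀]` the solution is small enough for the energy bound, which gives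
  -- a strict inequality at `s`, a contradiction.
  set S := Icc t₁ T₀ ∩ (fun t => K ^ 2 * sobNormSq (u t)) ⁻¹' Ici (d ^ 2) with hS
  have hScl : IsClosed S := hc.preimage_isClosed_of_isClosed isClosed_Icc isClosed_Ici
  have hScomp : IsCompact S := isCompact_Icc.of_isClosed_subset hScl inter_subset_left
  obtain ⟨s, hsS, hsmax⟩ := hScomp.exists_isGreatest ⟨t₁, left_mem_Icc.mpr ht₁.2, hbig⟩
  have hs0 : 0 < s := ht₁.1.trans_le hsS.1.1
  have hsT : s ≤ T₀ := hsS.1.2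
  have hlt : ∀ t ∈ Ioc s T₀, K ^ 2 * sobNormSq (u t) ≤ d ^ 2 := fun t ht => by
    by_contra! hcon
    exact absurd (hsmax ⟨⟨hsS.1.1.trans ht.1.le, ht.2⟩, hcon.le⟩) (not_le.mpr ht.1)
  -- Strictness makes `[s, T₀]` the closure of `(s, T₀]`, so that the bound extends to the time `s`
  -- by continuity.
  have hsT' : s < T₀ := by
    refine lt_of_le_of_ne hsT fun h => ?_
    have h1 : d ^ 2 ≤ K ^ 2 * sobNormSq (u s) := hsS.2
    rw [h] at h1
    have h2 : (1 : ℝ) ≤ exp (cG j * T₀) :=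
      one_le_exp (mul_nonneg (cG_nonneg j) hT₀.le)
    have h3 := sobNormSq_nonneg (u T₀)
    have h4 : sobNormSq (u T₀) ≤ 4 * sobNormSq (u T₀) * exp (cG j * T₀) := by nlinarith
    exact absurd (h1.trans (mul_le_mul_of_nonneg_left h4 hK0.le)) (not_le.mpr hdata)
  have hle : ∀ t ∈ Icc s T₀, K ^ 2 * sobNormSq (u t) ≤ d ^ 2 := by
    have hcl : closure (Ioc s T₀) = Icc s T₀ := closure_Ioc hsT'.ne
    intro t ht
    have hsub2 : Icc s T₀ ⊆ Icc t₁ T₀ := Icc_subset_Icc_left hsS.1.1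
    refine ContinuousWithinAt.closure_le (s := Ioc s T₀) (x := t) (by rw [hcl]; exact ht)
      ((hc t (hsub2 ht)).mono (Ioc_subset_Icc_self.trans hsub2)) continuousWithinAt_const hlt
  have hsm : ∀ t ∈ Icc s T₀, ∀ i, ‖u t i‖ ≤ d := fun t ht i => by
    refine (norm_le_of_sobNormSq (u t) i).trans ?_
    rw [← hK, ← Real.sqrt_sq hd0]
    exact Real.sqrt_le_sqrt (hle t ht)
  have hfin := sobNormSq_le_exp hu hp hq hr hκ0 hκ1 hκ2 hκ3 hd hdκ hs0 hsT hsm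
  have h1 : d ^ 2 ≤ K ^ 2 * sobNormSq (u s) := hsS.2
  have h2 : exp (cG j * (T₀ - s)) ≤ exp (cG j * T₀) :=
    exp_le_exp.mpr (mul_le_mul_of_nonneg_left (by linarith) (cG_nonneg j))
  have h3 : 4 * sobNormSq (u T₀) * exp (cG j * (T₀ - s)) ≤ 4 * sobNormSq (u T₀) * exp (cG j * T₀) :=
    mul_le_mul_of_nonneg_left h2 (mul_nonneg (by norm_num) (sobNormSq_nonneg _))
  exact absurd (h1.trans (mul_le_mul_of_nonneg_left (hfin.trans h3) hK0.le)) (not_le.mpr hdata)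

end Apriori

end

end PolarisedT2

namespace PolarisedT2

noncomputable section

/-! ### Backward differential inequalities on `(0, T]` -/

section Tools

variable {E : Type*} [NormedAddCommGroup E] [NormedSpace ℝ E]

/-- Time is reversed and the norm compared with an explicit barrier. The comparison principle needs
the barrier to be strictly steeper wherever the two touch; the factor `2` in the exponent and `0 <
A` ensure this. -/
lemma backward_gronwall_of_pos {f f' : ℝ → E} {m Φ : ℝ → ℝ} {T A : ℝ} (hA : 0 < A)
    (hf : ∀ t ∈ Ioc 0 T, HasDerivWithinAt f (f' t) (Ioc 0 T) t)
    (hΦ : ∀ t ∈ Ioc 0 T, HasDerivAt Φ (m t) t) (hm : ∀ t ∈ Ioc 0 T, 0 < m t)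
    (hle : ∀ t ∈ Ioc 0 T, ‖f' t‖ ≤ m t * (‖f t‖ + A)) {t : ℝ} (ht : t ∈ Ioc 0 T) :
    ‖f t‖ + A ≤ (‖f T‖ + A) * exp (2 * (Φ T - Φ t)) := by
  set g : ℝ → E := fun s => f (T - s) with hg
  have hmem : ∀ s ∈ Icc 0 (T - t), T - s ∈ Ioc 0 T := fun s hs =>
    ⟨by linarith [hs.2, ht.1], by linarith [hs.1]⟩
  have hder : ∀ s ∈ Icc 0 (T - t), HasDerivWithinAt g (-(f' (T - s))) (Icc 0 (T - t)) s :=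
    fun s hs => by
      have h1 : HasDerivWithinAt (fun s : ℝ => T - s) (-1) (Icc 0 (T - t)) s := by
        simpa using ((hasDerivAt_id s).const_sub T).hasDerivWithinAt
      have h2 := (hf _ (hmem s hs)).scomp s h1 hmem
      exact h2.congr_deriv (by simp)
  have hB : ∀ s ∈ Icc 0 (T - t), HasDerivAt
      (fun s => (‖f T‖ + A) * exp (2 * (Φ T - Φ (T - s))) - A)
      ((‖f T‖ + A) * (exp (2 * (Φ T - Φ (T - s))) * (2 * m (T - s)))) s := fun s hs => by
    have h1 : HasDerivAt (fun s : ℝ => T - s) (-1) s := by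
      simpa using (hasDerivAt_id s).const_sub T
    have h2 : HasDerivAt (fun s => Φ (T - s)) (m (T - s) * -1) s :=
      HasDerivAt.comp s (hΦ _ (hmem s hs)) h1
    have h3 : HasDerivAt (fun s => 2 * (Φ T - Φ (T - s))) (2 * m (T - s)) s :=
      ((h2.const_sub (Φ T)).const_mul 2).congr_deriv (by ring)
    exact (h3.exp.const_mul _).sub_const A
  have key := image_norm_le_of_norm_deriv_right_lt_deriv_boundary' (f := g)
    (f' := fun s => -(f' (T - s))) (a := 0) (b := T - t)
    (B := fun s => (‖f T‖ + A) * exp (2 * (Φ T - Φ (T - s))) - A)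
    (B' := fun s => (‖f T‖ + A) * (exp (2 * (Φ T - Φ (T - s))) * (2 * m (T - s))))
    (fun s hs => (hder s hs).continuousWithinAt)
    (fun s hs => (hder s (Ico_subset_Icc_self hs)).mono_of_mem_nhdsWithin
      (Icc_mem_nhdsGE_of_mem hs))
    (by simp [hg])
    (fun s hs => (hB s hs).continuousAt.continuousWithinAt)
    (fun s hs => (hB s (Ico_subset_Icc_self hs)).hasDerivWithinAt)
    (fun s hs hs' => by
      have h1 := hmem s (Ico_subset_Icc_self hs)
      have h2 := hm _ h1
      have h3 := hle _ h1
      have h4 : ‖f (T - s)‖ + A = (‖f T‖ + A) * exp (2 * (Φ T - Φ (T - s))) := by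
        have h5 : ‖f (T - s)‖ = (‖f T‖ + A) * exp (2 * (Φ T - Φ (T - s))) - A := hs'
        linarith
      rw [norm_neg]
      rw [h4] at h3
      have h5 : 0 < (‖f T‖ + A) * exp (2 * (Φ T - Φ (T - s))) := by positivity
      nlinarith)
    (right_mem_Icc.mpr (by linarith [ht.2]))
  have e : T - (T - t) = t := by ring
  simp only [hg, e] at key
  linarith

/-- Apply the positive case with `A + ε / e` and let `ε` tend to `0`. The case `A = 0` is the one
needed for homogeneous equations. -/
lemma backward_gronwall {f f' : ℝ → E} {m Φ : ℝ → ℝ} {T A : ℝ} (hA : 0 ≤ A)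
    (hf : ∀ t ∈ Ioc 0 T, HasDerivWithinAt f (f' t) (Ioc 0 T) t)
    (hΦ : ∀ t ∈ Ioc 0 T, HasDerivAt Φ (m t) t) (hm : ∀ t ∈ Ioc 0 T, 0 < m t)
    (hle : ∀ t ∈ Ioc 0 T, ‖f' t‖ ≤ m t * (‖f t‖ + A)) {t : ℝ} (ht : t ∈ Ioc 0 T) :
    ‖f t‖ + A ≤ (‖f T‖ + A) * exp (2 * (Φ T - Φ t)) := by
  refine le_of_forall_pos_le_add fun ε hε => ?_
  set e := exp (2 * (Φ T - Φ t)) with he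
  have he0 : 0 < e := exp_pos _
  have hη : 0 < ε / e := div_pos hε he0
  have h := backward_gronwall_of_pos (A := A + ε / e) (by linarith) hf hΦ hm (fun s hs =>
    (hle s hs).trans (mul_le_mul_of_nonneg_left (by linarith) (hm s hs).le)) ht
  rw [← he] at h
  have h1 : (‖f T‖ + (A + ε / e)) * e = (‖f T‖ + A) * e + ε := by
    field_simp
    ring
  linarith

/-- Decay for perturbed linear Fuchsian equations `t f' = α f + n`. -/
lemma fuchsian_decay {f f' n : ℝ → E} {T α σ : ℝ} (hT : 0 < T) (hσ : 0 < σ)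
    (hf : ∀ t ∈ Ioc 0 T, HasDerivWithinAt f (f' t) (Ioc 0 T) t)
    (heq : ∀ t ∈ Ioc 0 T, f' t = t⁻¹ • (α • f t + n t))
    (hn : ∀ t ∈ Ioc 0 T, ‖n t‖ ≤ σ / 2 * ‖f t‖) {t : ℝ} (ht : t ∈ Ioc 0 T) :
    ‖f t‖ ≤ ‖f T‖ * (t / T) ^ (α - σ) := by
  -- Multiplication by `t^{-α}` removes the linear part. The factor `2` of `backward_gronwall` turns
  -- the bound `σ / 2` on the perturbation into a loss `σ` in the exponent.
  have hder : ∀ t ∈ Ioc 0 T, HasDerivWithinAt (fun t => t ^ (-α) • f t)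
      (t ^ (-α) • (t⁻¹ • n t)) (Ioc 0 T) t := fun t ht => by
    have h1 := (Real.hasDerivAt_rpow_const (x := t) (p := -α) (Or.inl ht.1.ne')).hasDerivWithinAt
      (s := Ioc 0 T)
    refine (h1.smul (hf t ht)).congr_deriv ?_
    rw [heq t ht, Real.rpow_sub ht.1, Real.rpow_one]
    module
  have h := backward_gronwall (A := 0) (m := fun t => σ / 2 * t⁻¹) (Φ := fun t => σ / 2 * log t)
    le_rfl hder (fun t ht => (Real.hasDerivAt_log ht.1.ne').const_mul _)
    (fun t ht => mul_pos (by linarith) (inv_pos.mpr ht.1)) (fun t ht => by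
      have hp := Real.rpow_nonneg ht.1.le (-α)
      rw [norm_smul, norm_smul, norm_smul, Real.norm_of_nonneg hp,
        Real.norm_of_nonneg (inv_nonneg.mpr ht.1.le), add_zero]
      have := mul_le_mul_of_nonneg_left (hn t ht) (mul_nonneg hp (inv_nonneg.mpr ht.1.le))
      linarith) ht
  have ht0 := ht.1
  have e : exp (2 * (σ / 2 * log T - σ / 2 * log t)) = (t / T) ^ (-σ) := by
    rw [Real.rpow_def_of_pos (div_pos ht0 hT), Real.log_div ht0.ne' hT.ne']
    ring_nf
  simp only [add_zero] at h
  rw [e, norm_smul, norm_smul, Real.norm_of_nonneg (Real.rpow_nonneg ht0.le _),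
    Real.norm_of_nonneg (Real.rpow_nonneg hT.le _)] at h
  have h1 : t ^ α * t ^ (-α) = 1 := by rw [← Real.rpow_add ht0]; simp
  have h2 : (t / T) ^ (α - σ) = t ^ α * T ^ (-α) * (t / T) ^ (-σ) := by
    rw [sub_eq_add_neg, Real.rpow_add (div_pos ht0 hT), Real.div_rpow ht0.le hT.le,
      Real.rpow_neg hT.le, div_eq_mul_inv]
  have h3 := mul_le_mul_of_nonneg_left h (Real.rpow_nonneg ht0.le α)
  rw [← mul_assoc, h1, one_mul] at h3
  rw [h2]
  calc _ ≤ _ := h3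
    _ = _ := by ring

/-- Integration from `0` of an integrable right-hand side. -/
lemma exists_primitive {g : ℝ → E} {T C ρ : ℝ} (hρ : 0 < ρ)
    (hg : ContinuousOn g (Ioc 0 T)) (hgC : ∀ t ∈ Ioc 0 T, ‖g t‖ ≤ C * (1 + t ^ (ρ - 1))) :
    ∃ G : ℝ → E, (∀ t ∈ Ioc 0 T, ‖G t‖ ≤ C * (1 + ρ⁻¹) * (t + t ^ ρ)) ∧
      ∀ s t, 0 < s → s ≤ t → t ≤ T → G t - G s = ∫ x in s..t, g x := by
  have hbound : ∀ t ∈ Ioc 0 T, IntervalIntegrable (fun x => C * (1 + x ^ (ρ - 1)))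
      MeasureTheory.volume 0 t := fun t ht =>
    (intervalIntegrable_const.add (intervalIntegral.intervalIntegrable_rpow' (by linarith))).const_mul
      C
  have hint : ∀ t ∈ Ioc 0 T, IntervalIntegrable g MeasureTheory.volume 0 t := fun t ht => by
    refine (hbound t ht).mono_fun ?_ ?_
    · rw [uIoc_of_le ht.1.le]
      exact (hg.mono (Ioc_subset_Ioc_right ht.2)).aestronglyMeasurable measurableSet_Ioc
    · rw [uIoc_of_le ht.1.le]
      refine (MeasureTheory.ae_restrict_iff' measurableSet_Ioc).mpr (Eventually.of_forall
        fun x hx => ?_)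
      exact (hgC x ⟨hx.1, hx.2.trans ht.2⟩).trans (le_abs_self _)
  refine ⟨fun t => ∫ x in (0 : ℝ)..t, g x, fun t ht => ?_, fun s t hs hst htT => ?_⟩
  · have h1 := intervalIntegral.norm_integral_le_of_norm_le (μ := MeasureTheory.volume) (f := g)
      (g := fun x => C * (1 + x ^ (ρ - 1))) ht.1.le
      (Eventually.of_forall fun x hx => hgC x ⟨hx.1, hx.2.trans ht.2⟩) (hbound t ht)
    refine h1.trans ?_
    have hpow : IntervalIntegrable (fun x : ℝ => x ^ (ρ - 1)) MeasureTheory.volume 0 t :=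
      intervalIntegral.intervalIntegrable_rpow' (by linarith)
    rw [intervalIntegral.integral_const_mul, intervalIntegral.integral_add intervalIntegrable_const
      hpow, integral_rpow (Or.inl (by linarith))]
    have hC : 0 ≤ C := by
      have h2 := (norm_nonneg _).trans (hgC t ht)
      have h3 : 0 < 1 + t ^ (ρ - 1) := by
        have := Real.rpow_nonneg ht.1.le (ρ - 1); linarith
      exact nonneg_of_mul_nonneg_left h2 h3
    simp only [intervalIntegral.integral_const, sub_zero, smul_eq_mul, mul_one, sub_add_cancel,
      Real.zero_rpow hρ.ne']
    rw [mul_assoc]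
    refine mul_le_mul_of_nonneg_left ?_ hC
    have h4 := Real.rpow_nonneg ht.1.le ρ
    have h5 : 0 < ρ⁻¹ := inv_pos.mpr hρ
    rw [div_eq_mul_inv]
    have h6 := mul_nonneg h5.le ht.1.le
    nlinarith
  · have ht : t ∈ Ioc 0 T := ⟨hs.trans_le hst, htT⟩
    have hs' : s ∈ Ioc 0 T := ⟨hs, hst.trans htT⟩
    exact intervalIntegral.integral_interval_sub_left (hint t ht) (hint s hs')

variable [CompleteSpace E]

lemma integral_eq_sub_of_curve {f g : ℝ → E} {T : ℝ}
    (hf : ∀ t ∈ Ioc 0 T, HasDerivWithinAt f (g t) (Ioc 0 T) t) (hg : ContinuousOn g (Ioc 0 T))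
    {s t : ℝ} (hs : 0 < s) (hst : s ≤ t) (htT : t ≤ T) : ∫ x in s..t, g x = f t - f s := by
  have hsub : Icc s t ⊆ Ioc 0 T := fun x hx => ⟨hs.trans_le hx.1, hx.2.trans htT⟩
  refine intervalIntegral.integral_eq_sub_of_hasDeriv_right_of_le hst
    (fun x hx => ((hf x (hsub hx)).mono hsub).continuousWithinAt) (fun x hx => ?_)
    ((hg.mono hsub).intervalIntegrable_of_Icc hst)
  exact ((hf x (hsub (Ioo_subset_Icc_self hx))).hasDerivAt (mem_of_superset
    (Ioo_mem_nhds hx.1 hx.2) fun y hy => hsub (Ioo_subset_Icc_self hy))).hasDerivWithinAt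

/-- A curve whose derivative is integrable at `0` has a limit at `0`. -/
lemma exists_limit {f g : ℝ → E} {T C ρ : ℝ} (hρ : 0 < ρ)
    (hf : ∀ t ∈ Ioc 0 T, HasDerivWithinAt f (g t) (Ioc 0 T) t) (hg : ContinuousOn g (Ioc 0 T))
    (hgC : ∀ t ∈ Ioc 0 T, ‖g t‖ ≤ C * (1 + t ^ (ρ - 1))) :
    ∃ L : E, ∀ t ∈ Ioc 0 T, ‖f t - L‖ ≤ C * (1 + ρ⁻¹) * (t + t ^ ρ) := by
  obtain ⟨G, hG, hGi⟩ := exists_primitive hρ hg hgC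
  refine ⟨f T - G T, fun t ht => ?_⟩
  have h1 := hGi t T ht.1 ht.2 le_rfl
  rw [integral_eq_sub_of_curve hf hg ht.1 ht.2 le_rfl] at h1
  have h2 : f t - (f T - G T) = G t := by
    rw [← sub_eq_zero, ← sub_eq_zero_of_eq h1]; abel
  rw [h2]
  exact hG t ht

end Tools

/-- Comparison of powers on `(0, T]`. -/
lemma rpow_le_const_mul_rpow {T x y t : ℝ} (hxy : y ≤ x) (ht : t ∈ Ioc 0 T) :
    t ^ x ≤ T ^ (x - y) * t ^ y := by
  have h : t ^ x = t ^ (x - y) * t ^ y := by rw [← Real.rpow_add ht.1]; ring_nf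
  rw [h]
  exact mul_le_mul_of_nonneg_right (Real.rpow_le_rpow ht.1.le ht.2 (by linarith))
    (Real.rpow_nonneg ht.1.le _)

end

end PolarisedT2

namespace PolarisedT2

noncomputable section

open Hsp

variable {j : ℕ}

/-! ### Decay of small solutions -/

/-- Smallness and size conditions on the parameters. -/
structure SmallParams (j : ℕ) (a T₀ p B d e σ κ : ℝ) (q r : ℝ → ℝ) : Prop where
  T_pos : 0 < T₀
  p_le : |p| ≤ B
  q_le : ∀ t ∈ Ioc 0 T₀, |q t| ≤ B
  r_le : ∀ t ∈ Ioc 0 T₀, |r t| ≤ B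
  sigma_pos : 0 < σ
  sigma_lt : 3 * σ < 2 * κ
  kappa_le_right : κ ≤ a ^ 2 - 1
  d_nonneg : 0 ≤ d
  d_le : d ≤ 1 / 2
  norm_incl_le : ‖(incl (Nat.le_succ (j + 1)) : Hsp (j + 1 + 1) →L[ℝ] Hsp (j + 1))‖ * d ≤ e
  e_le_one : e ≤ 1
  e_le_sigma : cF (Hsp (j + 1)) a B * e ≤ σ / 2

/-- A solution that stays in a small ball. -/
structure SmallSoln (ℓ a T₀ p d : ℝ) (q r : ℝ → ℝ) (u : ℝ → Fin 6 → Hsp (j + 2))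
    (du : ℝ → Fin 6 → Hsp (j + 1)) : Prop extends Soln ℓ a T₀ p q r u du where
  small : ∀ t ∈ Ioc 0 T₀, ∀ i, ‖u t i‖ ≤ d

/-- The solution as an element of `H^{j+2}`. -/
def low (u : Fin 6 → Hsp (j + 2)) (i : Fin 6) : Hsp (j + 1) := incl (Nat.le_succ (j + 1)) (u i)

@[simp] lemma low_apply (u : Fin 6 → Hsp (j + 2)) (i : Fin 6) (x : Circ) : low u i x = u i x := rfl

variable {ℓ a T₀ p B d e σ κ : ℝ} {q r : ℝ → ℝ}

section Basic

variable {u : ℝ → Fin 6 → Hsp (j + 2)} {du : ℝ → Fin 6 → Hsp (j + 1)}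

lemma SmallParams.B_nonneg (P : SmallParams j a T₀ p B d e σ κ q r) : 0 ≤ B :=
  (abs_nonneg _).trans P.p_le

lemma SmallParams.e_nonneg (P : SmallParams j a T₀ p B d e σ κ q r) : 0 ≤ e :=
  (mul_nonneg (norm_nonneg _) P.d_nonneg).trans P.norm_incl_le

lemma SmallSoln.norm_low_le (P : SmallParams j a T₀ p B d e σ κ q r)
    (hu : SmallSoln ℓ a T₀ p d q r u du) {t : ℝ} (ht : t ∈ Ioc 0 T₀) (i : Fin 6) :
    ‖low (u t) i‖ ≤ e :=
  ((incl (Nat.le_succ (j + 1))).le_opNorm _).trans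
    ((mul_le_mul_of_nonneg_left (hu.small t ht i) (norm_nonneg _)).trans P.norm_incl_le)

lemma SmallSoln.norm_low_le_one (P : SmallParams j a T₀ p B d e σ κ q r)
    (hu : SmallSoln ℓ a T₀ p d q r u du) {t : ℝ} (ht : t ∈ Ioc 0 T₀) (i : Fin 6) :
    ‖low (u t) i‖ ≤ 1 := (hu.norm_low_le P ht i).trans P.e_le_one

lemma SmallSoln.one_add_psi_ge (P : SmallParams j a T₀ p B d e σ κ q r)
    (hu : SmallSoln ℓ a T₀ p d q r u du) {t : ℝ} (ht : t ∈ Ioc 0 T₀) (x : Circ) :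
    1 / 2 ≤ 1 + u t 3 x := by
  have h := (abs_le.mp ((abs_apply_le (u t 3) x).trans (hu.small t ht 3))).1
  linarith [P.d_le]

lemma SmallSoln.sysEq (P : SmallParams j a T₀ p B d e σ κ q r)
    (hu : SmallSoln ℓ a T₀ p d q r u du) {t : ℝ} (ht : t ∈ Ioc 0 T₀) (i : Fin 6) :
    du t i = t⁻¹ • (linF ℓ a i • low (u t) i + nlF a p (q t) (r t) (low (u t)) i)
      + derF (u t) i := by
  have h := hu.sys t ht (fun x => by linarith [hu.one_add_psi_ge P ht x]) i
  rw [h, ← incl_nlF]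
  rfl

lemma SmallSoln.hasDeriv_low (hu : SmallSoln ℓ a T₀ p d q r u du) {t : ℝ} (ht : t ∈ Ioc 0 T₀)
    (i : Fin 6) : HasDerivWithinAt (fun s => low (u s) i) (du t i) (Ioc 0 T₀) t :=
  hu.deriv i t ht

lemma SmallSoln.continuousOn_low (hu : SmallSoln ℓ a T₀ p d q r u du) (i : Fin 6) :
    ContinuousOn (fun s => low (u s) i) (Ioc 0 T₀) :=
  fun _ ht => (hu.hasDeriv_low ht i).continuousWithinAt

/-- Both `w₂` and `η` have linear coefficient `1`, which division by `t` cancels exactly. -/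
lemma hasDerivWithinAt_inv_smul {E : Type*} [NormedAddCommGroup E] [NormedSpace ℝ E] {f : ℝ → E}
    {n X : E} {I : Set ℝ} {t : ℝ} (ht : t ≠ 0)
    (hf : HasDerivWithinAt f (t⁻¹ • ((1 : ℝ) • f t + n) + X) I t) :
    HasDerivWithinAt (fun s => s⁻¹ • f s) (t⁻¹ • (t⁻¹ • n + X)) I t := by
  have h1 := ((hasDerivAt_inv ht).hasDerivWithinAt (s := I)).smul hf
  refine h1.congr_deriv ?_
  have e : -(t ^ 2)⁻¹ = -(t⁻¹ * t⁻¹) := by rw [sq, mul_inv]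
  rw [e]
  module

lemma SmallSoln.hasDeriv_w2 (P : SmallParams j a T₀ p B d e σ κ q r)
    (hu : SmallSoln ℓ a T₀ p d q r u du) {t : ℝ} (ht : t ∈ Ioc 0 T₀) :
    HasDerivWithinAt (fun s => s⁻¹ • low (u s) 2) (t⁻¹ • D (u t 1)) (Ioc 0 T₀) t := by
  have h := hu.hasDeriv_low ht 2
  rw [hu.sysEq P ht 2] at h
  have h1 := hasDerivWithinAt_inv_smul (n := nlF a p (q t) (r t) (low (u t)) 2)
    (X := derF (u t) 2) ht.1.ne' h
  have e1 : nlF a p (q t) (r t) (low (u t)) 2 = 0 := rfl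
  have e2 : derF (u t) 2 = D (u t 1) := rfl
  rwa [e1, e2, smul_zero, zero_add] at h1

lemma SmallSoln.hasDeriv_eta (P : SmallParams j a T₀ p B d e σ κ q r)
    (hu : SmallSoln ℓ a T₀ p d q r u du) {t : ℝ} (ht : t ∈ Ioc 0 T₀) :
    HasDerivWithinAt (fun s => s⁻¹ • low (u s) 4)
      (t⁻¹ • (t⁻¹ • nlF a p (q t) (r t) (low (u t)) 4)) (Ioc 0 T₀) t := by
  have h := hu.hasDeriv_low ht 4
  rw [hu.sysEq P ht 4] at h
  have h1 := hasDerivWithinAt_inv_smul (n := nlF a p (q t) (r t) (low (u t)) 4)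
    (X := derF (u t) 4) ht.1.ne' h
  have e2 : derF (u t) 4 = 0 := rfl
  rwa [e2, add_zero] at h1

/-- Among the decay rates this is the one that controls `𝔟`: its terms are quadratic in `ξ`, with
coefficients that stay bounded. Smallness in `H^{k-1}` makes the nonlinear term a perturbation of
size `σ / 2`. -/
lemma SmallSoln.norm_xi_le (P : SmallParams j a T₀ p B d e σ κ q r)
    (hu : SmallSoln ℓ a T₀ p d q r u du) {t : ℝ} (ht : t ∈ Ioc 0 T₀) :
    ‖low (u t) 5‖ ≤ (t / T₀) ^ (κ - σ) := by
  have hT := P.T_pos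
  have h := fuchsian_decay (f := fun t => low (u t) 5) (f' := fun t => du t 5)
    (n := fun t => nlF a p (q t) (r t) (low (u t)) 5) (α := a ^ 2 - 1) P.T_pos P.sigma_pos
    (fun t ht => hu.hasDeriv_low ht 5) (fun t ht => by
      rw [hu.sysEq P ht 5]
      have e2 : derF (u t) 5 = 0 := rfl
      rw [e2, add_zero]
      rfl) (fun t ht => by
      refine (norm_nlF_five_le P.p_le (P.q_le t ht) (P.r_le t ht) P.e_le_one
        (fun i => hu.norm_low_le P ht i)).trans ?_
      rw [← mul_assoc]
      exact mul_le_mul_of_nonneg_right P.e_le_sigma (norm_nonneg _)) ht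
  have h0 : 0 < t / T₀ := div_pos ht.1 hT
  have h1 : t / T₀ ≤ 1 := (div_le_one hT).mpr ht.2
  have h2 : (t / T₀) ^ (a ^ 2 - 1 - σ) ≤ (t / T₀) ^ (κ - σ) :=
    Real.rpow_le_rpow_of_exponent_ge h0 h1 (by linarith [P.kappa_le_right])
  calc _ ≤ _ := h
    _ ≤ 1 * (t / T₀) ^ (κ - σ) := mul_le_mul
        (hu.norm_low_le_one P (right_mem_Ioc.mpr hT) 5) h2 (Real.rpow_nonneg h0.le _) zero_le_one
    _ = _ := one_mul _

lemma SmallSoln.norm_xi_sq_le (P : SmallParams j a T₀ p B d e σ κ q r)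
    (hu : SmallSoln ℓ a T₀ p d q r u du) {t : ℝ} (ht : t ∈ Ioc 0 T₀) :
    ‖low (u t) 5‖ ^ 2 ≤ T₀ ^ (-(2 * κ - 2 * σ)) * t ^ (2 * κ - 2 * σ) := by
  have hT := P.T_pos
  have h := pow_le_pow_left₀ (norm_nonneg _) (hu.norm_xi_le P ht) 2
  have h0 : 0 < t / T₀ := div_pos ht.1 hT
  refine h.trans (le_of_eq ?_)
  rw [← Real.rpow_natCast, ← Real.rpow_mul h0.le, Real.div_rpow ht.1.le hT.le,
    Real.rpow_neg hT.le, div_eq_mul_inv]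
  have e : (κ - σ) * ((2 : ℕ) : ℝ) = 2 * κ - 2 * σ := by push_cast; ring
  rw [e, mul_comm]

lemma SmallSoln.norm_b_le (P : SmallParams j a T₀ p B d e σ κ q r)
    (hu : SmallSoln ℓ a T₀ p d q r u du) {t : ℝ} (ht : t ∈ Ioc 0 T₀) :
    ‖nlB p (q t) (r t) (low (u t))‖ ≤
        cB (Hsp (j + 1)) B * T₀ ^ (-(2 * κ - 2 * σ)) * t ^ (2 * κ - 2 * σ) ∧
      ‖nlS a p (q t) (r t) (low (u t))‖ ≤
        cS (Hsp (j + 1)) a B * T₀ ^ (-(2 * κ - 2 * σ)) * t ^ (2 * κ - 2 * σ) := by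
  have h := hu.norm_xi_sq_le P ht
  have h1 : ∀ i, ‖low (u t) i‖ ≤ 1 := fun i => hu.norm_low_le_one P ht i
  have n1 := cB_nonneg (A := Hsp (j + 1)) P.B_nonneg
  have n2 := cS_nonneg (A := Hsp (j + 1)) (a := a) P.B_nonneg
  rw [mul_assoc, mul_assoc]
  exact ⟨(norm_nlB_le P.p_le (P.q_le t ht) (P.r_le t ht) h1).trans
      (mul_le_mul_of_nonneg_left h n1),
    (norm_nlS_le P.p_le (P.q_le t ht) (P.r_le t ht) h1).trans (mul_le_mul_of_nonneg_left h n2)⟩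

lemma SmallSoln.norm_D_le (hu : SmallSoln ℓ a T₀ p d q r u du) {t : ℝ} (ht : t ∈ Ioc 0 T₀)
    (i : Fin 6) : ‖(D (u t i) : Hsp (j + 1))‖
      ≤ ‖(D : Hsp (j + 1 + 1) →L[ℝ] Hsp (j + 1))‖ * d :=
  (ContinuousLinearMap.le_opNorm _ _).trans
    (mul_le_mul_of_nonneg_left (hu.small t ht i) (norm_nonneg _))

end Basic

/-! ### Bounds for `w₂ / t`, `η / t` and the slow components. -/

/-- The loss of decay of `w₂`. -/
def lossExp (σ : ℝ) : ℝ := min σ (1 / 2)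

lemma lossExp_pos (hσ : 0 < σ) : 0 < lossExp σ := lt_min hσ (by norm_num)

/-- The derivative of `w₂ / t` is `t⁻¹ ∂_θ w₁`, so logarithmic growth is possible; a small negative
power is enough at this stage. Keeping the loss below `σ` protects the rate `2κ - 3σ`, and keeping
it below `1/2` makes `w₂² / t` bounded. -/
lemma exists_w2_bound (P : SmallParams j a T₀ p B d e σ κ q r) :
    ∃ C, 0 ≤ C ∧ ∀ (u : ℝ → Fin 6 → Hsp (j + 2)) (du : ℝ → Fin 6 → Hsp (j + 1)),
      SmallSoln ℓ a T₀ p d q r u du → ∀ t ∈ Ioc 0 T₀,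
        ‖t⁻¹ • low (u t) 2‖ ≤ C * t ^ (-lossExp σ) := by
  set s := lossExp σ with hs
  have hs0 : 0 < s := lossExp_pos P.sigma_pos
  set nD := ‖(D : Hsp (j + 1 + 1) →L[ℝ] Hsp (j + 1))‖ with hnD
  have hT := P.T_pos
  have hd := P.d_nonneg
  have hn0 : 0 ≤ nD := norm_nonneg _
  have he := P.e_nonneg
  -- Chosen so that `s / 2 * A` equals the bound `nD * d` for `∂_θ w₁`; the inhomogeneity is thus
  -- hidden in the shift `A`.
  set A := 2 * (nD * d) / s with hA
  have hA0 : 0 ≤ A := by positivity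
  refine ⟨(T₀⁻¹ * e + A) * T₀ ^ s, by positivity, fun u du hu t ht => ?_⟩
  have h := backward_gronwall (m := fun t => s / 2 * t⁻¹) (Φ := fun t => s / 2 * log t) hA0
    (fun t ht => hu.hasDeriv_w2 P ht) (fun t ht => (Real.hasDerivAt_log ht.1.ne').const_mul _)
    (fun t ht => mul_pos (by linarith) (inv_pos.mpr ht.1)) (fun t ht => by
      have hti : 0 ≤ t⁻¹ := inv_nonneg.mpr ht.1.le
      rw [norm_smul, Real.norm_of_nonneg hti]
      have h1 := hu.norm_D_le ht 1
      have e1 : s / 2 * A = nD * d := by rw [hA]; field_simp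
      have h2 : 0 ≤ s / 2 * t⁻¹ * ‖t⁻¹ • low (u t) 2‖ := by positivity
      calc t⁻¹ * ‖D (u t 1)‖ ≤ t⁻¹ * (nD * d) := mul_le_mul_of_nonneg_left h1 hti
        _ = s / 2 * t⁻¹ * A := by rw [← e1]; ring
        _ ≤ _ := by rw [mul_add]; linarith) ht
  have e1 : exp (2 * (s / 2 * log T₀ - s / 2 * log t)) = T₀ ^ s * t ^ (-s) := by
    rw [Real.rpow_def_of_pos hT, Real.rpow_def_of_pos ht.1, ← Real.exp_add]
    ring_nf
  have h3 : ‖T₀⁻¹ • low (u T₀) 2‖ ≤ T₀⁻¹ * e := by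
    rw [norm_smul, Real.norm_of_nonneg (inv_nonneg.mpr hT.le)]
    exact mul_le_mul_of_nonneg_left (hu.norm_low_le P (right_mem_Ioc.mpr hT) 2)
      (inv_nonneg.mpr hT.le)
  rw [e1] at h
  have h4 : 0 ≤ T₀ ^ s * t ^ (-s) :=
    mul_nonneg (Real.rpow_nonneg hT.le _) (Real.rpow_nonneg ht.1.le _)
  calc ‖t⁻¹ • low (u t) 2‖ ≤ ‖t⁻¹ • low (u t) 2‖ + A := by linarith
    _ ≤ _ := h
    _ ≤ (T₀⁻¹ * e + A) * (T₀ ^ s * t ^ (-s)) := mul_le_mul_of_nonneg_right (by linarith) h4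
    _ = _ := by ring

/-- The time derivative of `η / t` is at most `M t^{θ - 1} (‖η / t‖ + 1)` with `θ = 2κ - 3σ`: here
`𝔟` supplies `2κ - 2σ`, and `w₂ / t` costs at most `σ`. Since `θ > 0`, the coefficient is integrable
at `0` and Gronwall gives a uniform bound. -/
lemma exists_eta_bound (P : SmallParams j a T₀ p B d e σ κ q r) :
    ∃ C, 0 ≤ C ∧ ∀ (u : ℝ → Fin 6 → Hsp (j + 2)) (du : ℝ → Fin 6 → Hsp (j + 1)),
      SmallSoln ℓ a T₀ p d q r u du → ∀ t ∈ Ioc 0 T₀,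
        ‖t⁻¹ • low (u t) 4‖ ≤ C ∧
        ‖t⁻¹ • (t⁻¹ • nlF a p (q t) (r t) (low (u t)) 4)‖ ≤ C * t ^ (2 * κ - 3 * σ - 1) := by
  obtain ⟨C₂, hC₂, hw2⟩ := exists_w2_bound P
  have hT := P.T_pos
  have he := P.e_nonneg
  have hB := P.B_nonneg
  set θ := 2 * κ - 3 * σ with hθ
  have hθ0 : 0 < θ := by linarith [P.sigma_lt]
  set s := lossExp σ with hs
  have hsσ : s ≤ σ := min_le_left _ _
  set E := ‖(1 : Hsp (j + 1))‖ + 1 with hE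
  have hE0 : 0 ≤ E := add_nonneg (norm_nonneg _) zero_le_one
  set τ := T₀ ^ (-(2 * κ - 2 * σ)) with hτ
  have hτ0 : 0 ≤ τ := Real.rpow_nonneg hT.le _
  have nB := cB_nonneg (A := Hsp (j + 1)) hB
  have nS := cS_nonneg (A := Hsp (j + 1)) (a := a) hB
  set c1 := 4 * (E * (cS (Hsp (j + 1)) a B * τ) * C₂) * T₀ ^ (2 * κ - 2 * σ - s - θ) with hc1
  set c2 := cB (Hsp (j + 1)) B * τ * T₀ ^ (2 * κ - 2 * σ - θ) with hc2
  have hc10 : 0 ≤ c1 := by have := Real.rpow_nonneg hT.le (2 * κ - 2 * σ - s - θ); positivity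
  have hc20 : 0 ≤ c2 := by have := Real.rpow_nonneg hT.le (2 * κ - 2 * σ - θ); positivity
  set M := c1 + c2 + 1 with hM
  have hM0 : 0 < M := by positivity
  set Z := (T₀⁻¹ * e + 1) * exp (2 * (M / θ * T₀ ^ θ)) with hZ
  have hZ0 : 0 ≤ Z := by positivity
  have hstep : ∀ (u : ℝ → Fin 6 → Hsp (j + 2)) (du : ℝ → Fin 6 → Hsp (j + 1)),
      SmallSoln ℓ a T₀ p d q r u du → ∀ t ∈ Ioc 0 T₀,
      ‖t⁻¹ • (t⁻¹ • nlF a p (q t) (r t) (low (u t)) 4)‖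
        ≤ M * t ^ (θ - 1) * (‖t⁻¹ • low (u t) 4‖ + 1) := by
    intro u du hu t ht
    have hti : 0 ≤ t⁻¹ := inv_nonneg.mpr ht.1.le
    obtain ⟨hb, hS⟩ := hu.norm_b_le P ht
    have e1 : t⁻¹ • nlF a p (q t) (r t) (low (u t)) 4
        = (4 : ℝ) • ((1 + low (u t) 3) * nlS a p (q t) (r t) (low (u t)) * (t⁻¹ • low (u t) 2))
          - nlB p (q t) (r t) (low (u t)) * (t⁻¹ • low (u t) 4) := by
      change t⁻¹ • ((4 : ℝ) • ((1 + low (u t) 3) * nlS a p (q t) (r t) (low (u t)) * low (u t) 2)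
        - nlB p (q t) (r t) (low (u t)) * low (u t) 4) = _
      rw [mul_smul_comm, mul_smul_comm, smul_sub, smul_comm]
    have hE1 : ‖1 + low (u t) 3‖ ≤ E := norm_one_add_le (hu.norm_low_le_one P ht 3)
    have h2 := norm_mul_le_mul' (norm_mul_le_mul' hE1 hS) (hw2 u du hu t ht)
    have h4 := norm_mul_le_mul' hb (le_refl ‖t⁻¹ • low (u t) 4‖)
    have h42 : ‖(4 : ℝ) • ((1 + low (u t) 3) * nlS a p (q t) (r t) (low (u t))
        * (t⁻¹ • low (u t) 2))‖ ≤ 4 * _ := norm_smul_le_mul' (by norm_num) h2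
    have hn := (norm_sub_le _ _).trans (add_le_add h42 h4)
    rw [← e1] at hn
    have p1 : t ^ (2 * κ - 2 * σ) * t ^ (-s) ≤ T₀ ^ (2 * κ - 2 * σ - s - θ) * t ^ θ := by
      rw [← Real.rpow_add ht.1, ← sub_eq_add_neg]
      exact rpow_le_const_mul_rpow (by linarith) ht
    have p2 : t ^ (2 * κ - 2 * σ) ≤ T₀ ^ (2 * κ - 2 * σ - θ) * t ^ θ :=
      rpow_le_const_mul_rpow (by linarith [P.sigma_pos]) ht
    have b1 : 4 * (E * (cS (Hsp (j + 1)) a B * τ * t ^ (2 * κ - 2 * σ)) * (C₂ * t ^ (-s)))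
        ≤ c1 * t ^ θ := by
      calc _ = 4 * (E * (cS (Hsp (j + 1)) a B * τ) * C₂) * (t ^ (2 * κ - 2 * σ) * t ^ (-s)) := by
            ring
        _ ≤ 4 * (E * (cS (Hsp (j + 1)) a B * τ) * C₂)
            * (T₀ ^ (2 * κ - 2 * σ - s - θ) * t ^ θ) :=
            mul_le_mul_of_nonneg_left p1 (by positivity)
        _ = _ := by rw [hc1]; ring
    have b2 : cB (Hsp (j + 1)) B * τ * t ^ (2 * κ - 2 * σ) ≤ c2 * t ^ θ := by
      calc _ ≤ cB (Hsp (j + 1)) B * τ * (T₀ ^ (2 * κ - 2 * σ - θ) * t ^ θ) :=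
            mul_le_mul_of_nonneg_left p2 (by positivity)
        _ = _ := by rw [hc2]; ring
    have hη0 : 0 ≤ ‖t⁻¹ • low (u t) 4‖ := norm_nonneg _
    have htθ := Real.rpow_nonneg ht.1.le θ
    have hfin : ‖t⁻¹ • nlF a p (q t) (r t) (low (u t)) 4‖
        ≤ M * t ^ θ * (‖t⁻¹ • low (u t) 4‖ + 1) := by
      refine hn.trans ?_
      have b2' := mul_le_mul_of_nonneg_right b2 hη0
      have k1 : 0 ≤ c1 * t ^ θ * ‖t⁻¹ • low (u t) 4‖ := by positivity
      have k2 : 0 ≤ c2 * t ^ θ := by positivity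
      have k3 : 0 ≤ t ^ θ * (‖t⁻¹ • low (u t) 4‖ + 1) := by positivity
      calc _ ≤ c1 * t ^ θ + c2 * t ^ θ * ‖t⁻¹ • low (u t) 4‖ := add_le_add b1 b2'
        _ ≤ _ := by rw [hM]; linarith
    rw [norm_smul t⁻¹ (t⁻¹ • nlF a p (q t) (r t) (low (u t)) 4), Real.norm_of_nonneg hti]
    have e3 : t ^ (θ - 1) = t⁻¹ * t ^ θ := by
      rw [Real.rpow_sub ht.1, Real.rpow_one, div_eq_inv_mul]
    rw [e3]
    calc _ ≤ t⁻¹ * (M * t ^ θ * (‖t⁻¹ • low (u t) 4‖ + 1)) := mul_le_mul_of_nonneg_left hfin hti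
      _ = _ := by ring
  have hbdd : ∀ (u : ℝ → Fin 6 → Hsp (j + 2)) (du : ℝ → Fin 6 → Hsp (j + 1)),
      SmallSoln ℓ a T₀ p d q r u du → ∀ t ∈ Ioc 0 T₀, ‖t⁻¹ • low (u t) 4‖ + 1 ≤ Z := by
    intro u du hu t ht
    have h := backward_gronwall (m := fun t => M * t ^ (θ - 1)) (Φ := fun t => M / θ * t ^ θ)
      zero_le_one (fun t ht => hu.hasDeriv_eta P ht) (fun t ht => by
        have := (Real.hasDerivAt_rpow_const (x := t) (p := θ) (Or.inl ht.1.ne')).const_mul (M / θ)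
        refine this.congr_deriv ?_
        field_simp) (fun t ht => mul_pos hM0 (Real.rpow_pos_of_pos ht.1 _))
      (fun t ht => hstep u du hu t ht) ht
    refine h.trans ?_
    have h3 : ‖T₀⁻¹ • low (u T₀) 4‖ ≤ T₀⁻¹ * e := by
      rw [norm_smul, Real.norm_of_nonneg (inv_nonneg.mpr hT.le)]
      exact mul_le_mul_of_nonneg_left (hu.norm_low_le P (right_mem_Ioc.mpr hT) 4)
        (inv_nonneg.mpr hT.le)
    have h5 : 0 ≤ M / θ * t ^ θ := by have := Real.rpow_nonneg ht.1.le θ; positivity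
    rw [hZ]
    exact mul_le_mul (by linarith) (exp_le_exp.mpr (by linarith)) (exp_pos _).le (by positivity)
  refine ⟨M * Z + Z, by positivity, fun u du hu t ht => ⟨?_, ?_⟩⟩
  · have h1 := hbdd u du hu t ht
    have h2 : 0 ≤ M * Z := by positivity
    linarith
  · have h1 := hbdd u du hu t ht
    have h2 := hstep u du hu t ht
    have h3 := Real.rpow_nonneg ht.1.le (θ - 1)
    calc _ ≤ _ := h2
      _ ≤ M * t ^ (θ - 1) * Z := mul_le_mul_of_nonneg_left h1 (by positivity)
      _ ≤ (M * Z + Z) * t ^ (θ - 1) := by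
          have : 0 ≤ Z * t ^ (θ - 1) := by positivity
          linarith

/-- Bounds for the time derivatives of `w₁`, `ψ`, and for `w₂²`. -/
lemma exists_slow_bound (P : SmallParams j a T₀ p B d e σ κ q r) :
    ∃ C, 0 ≤ C ∧ ∀ (u : ℝ → Fin 6 → Hsp (j + 2)) (du : ℝ → Fin 6 → Hsp (j + 1)),
      SmallSoln ℓ a T₀ p d q r u du → ∀ t ∈ Ioc 0 T₀,
        ‖du t 1‖ ≤ C * (1 + t ^ (2 * κ - 2 * σ - 1)) ∧
        ‖du t 3‖ ≤ C * (1 + t ^ (2 * κ - 2 * σ - 1)) ∧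
        ‖t⁻¹ • (low (u t) 2 ^ 2 * (1 + low (u t) 3)
          + (1 / 4 : ℝ) • nlB p (q t) (r t) (low (u t)))‖ ≤ C * (1 + t ^ (2 * κ - 2 * σ - 1)) := by
  obtain ⟨C₂, hC₂, hw2⟩ := exists_w2_bound P
  obtain ⟨C₄, hC₄, hw4⟩ := exists_eta_bound P
  have hT := P.T_pos
  have he := P.e_nonneg
  have hB := P.B_nonneg
  have hd := P.d_nonneg
  set θ := 2 * κ - 2 * σ with hθ
  set s := lossExp σ with hs
  have hs2 : s ≤ 1 / 2 := min_le_right _ _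
  set E := ‖(1 : Hsp (j + 1))‖ + 1 with hE
  have hE0 : 0 ≤ E := add_nonneg (norm_nonneg _) zero_le_one
  set τ := T₀ ^ (-θ) with hτ
  have hτ0 : 0 ≤ τ := Real.rpow_nonneg hT.le _
  set nD := ‖(D : Hsp (j + 1 + 1) →L[ℝ] Hsp (j + 1))‖ with hnD
  have hnD0 : 0 ≤ nD := norm_nonneg _
  have nB := cB_nonneg (A := Hsp (j + 1)) hB
  have nS := cS_nonneg (A := Hsp (j + 1)) (a := a) hB
  set bB := cB (Hsp (j + 1)) B * τ with hbB
  set bS := cS (Hsp (j + 1)) a B * τ with hbS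
  have hbB0 : 0 ≤ bB := by positivity
  have hbS0 : 0 ≤ bS := by positivity
  set t1 := T₀ ^ (1 - s) with ht1
  set t2 := T₀ ^ (1 - 2 * s) with ht2
  have ht10 : 0 ≤ t1 := Real.rpow_nonneg hT.le _
  have ht20 : 0 ≤ t2 := Real.rpow_nonneg hT.le _
  set c1 := E * (nD * d) + C₂ * C₄ * t1 + bS with hc1
  set c3 := E * bB with hc3
  set c5 := C₂ * C₂ * t2 * E + bB with hc5
  have hc10 : 0 ≤ c1 := by positivity
  have hc30 : 0 ≤ c3 := by positivity
  have hc50 : 0 ≤ c5 := by positivity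
  refine ⟨c1 + c3 + c5, by positivity, fun u du hu t ht => ?_⟩
  have ht0 := ht.1
  have hti : 0 ≤ t⁻¹ := inv_nonneg.mpr ht0.le
  obtain ⟨hb, hS⟩ := hu.norm_b_le P ht
  rw [← hθ, ← hτ, ← hbB] at hb
  rw [← hθ, ← hτ, ← hbS] at hS
  have hE1 : ‖1 + low (u t) 3‖ ≤ E := norm_one_add_le (hu.norm_low_le_one P ht 3)
  have hpow : t ^ (θ - 1) = t⁻¹ * t ^ θ := by
    rw [Real.rpow_sub ht0, Real.rpow_one, div_eq_inv_mul]
  have hp0 := Real.rpow_nonneg ht0.le (θ - 1)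
  have hw2' := hw2 u du hu t ht
  have hw4' := (hw4 u du hu t ht).1
  have r1 : t * t ^ (-s) ≤ t1 := by
    have : t * t ^ (-s) = t ^ (1 - s) := by
      rw [sub_eq_add_neg, Real.rpow_add ht0, Real.rpow_one]
    rw [this]
    exact Real.rpow_le_rpow ht0.le ht.2 (by linarith)
  have r2 : t * (t ^ (-s) * t ^ (-s)) ≤ t2 := by
    have : t * (t ^ (-s) * t ^ (-s)) = t ^ (1 - 2 * s) := by
      rw [← Real.rpow_add ht0]
      nth_rewrite 1 [← Real.rpow_one t]
      rw [← Real.rpow_add ht0]; ring_nf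
    rw [this]
    exact Real.rpow_le_rpow ht0.le ht.2 (by linarith)
  have htt : t * t⁻¹ = 1 := mul_inv_cancel₀ ht0.ne'
  have hx : ∀ x : ℝ, 0 ≤ x → x ≤ c1 + c3 + c5 → ∀ y : ℝ, 0 ≤ y → y ≤ c1 + c3 + c5 →
      x + y * t ^ (θ - 1) ≤ (c1 + c3 + c5) * (1 + t ^ (θ - 1)) := by
    intro x _ hx y _ hy
    have := mul_le_mul_of_nonneg_right hy hp0
    linarith
  refine ⟨?_, ?_, ?_⟩
  -- Writing `t⁻¹ w₂ η` as `t (w₂ / t) (η / t)` uses the growth bounds just proved. The product is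
  -- bounded, so only the terms from `𝔟` contribute the singular power of `t`.
  · have e1 : du t 1 = (1 / 2 : ℝ) • (t • ((t⁻¹ • low (u t) 2) * (t⁻¹ • low (u t) 4))
        + t⁻¹ • nlS a p (q t) (r t) (low (u t))) + (1 + low (u t) 3) * D (u t 2) := by
      rw [hu.sysEq P ht 1]
      change t⁻¹ • ((0 : ℝ) • low (u t) 1
        + (1 / 2 : ℝ) • (low (u t) 2 * low (u t) 4 + nlS a p (q t) (r t) (low (u t))))
          + (1 + low (u t) 3) * D (u t 2) = _
      rw [smul_mul_smul_comm, smul_smul, ← mul_assoc, htt, one_mul, zero_smul, zero_add, smul_comm,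
        smul_add]
    rw [e1]
    have n1 : ‖t • ((t⁻¹ • low (u t) 2) * (t⁻¹ • low (u t) 4))‖ ≤ t1 * (C₂ * C₄) := by
      rw [norm_smul, Real.norm_of_nonneg ht0.le]
      calc _ ≤ t * (C₂ * t ^ (-s) * C₄) :=
            mul_le_mul_of_nonneg_left (norm_mul_le_mul' hw2' hw4') ht0.le
        _ = t * t ^ (-s) * (C₂ * C₄) := by ring
        _ ≤ _ := mul_le_mul_of_nonneg_right r1 (by positivity)
    have n2 : ‖t⁻¹ • nlS a p (q t) (r t) (low (u t))‖ ≤ bS * t ^ (θ - 1) := by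
      rw [norm_smul, Real.norm_of_nonneg hti, hpow]
      calc _ ≤ t⁻¹ * (bS * t ^ θ) := mul_le_mul_of_nonneg_left hS hti
        _ = _ := by ring
    have n3 := norm_mul_le_mul' hE1 (hu.norm_D_le ht 2)
    have n4 := (norm_add_le _ _).trans (add_le_add
      (norm_smul_le_mul' (c := (1 / 2 : ℝ)) (B := 1) (by norm_num [abs_of_pos])
        ((norm_add_le _ _).trans (add_le_add n1 n2))) n3)
    refine n4.trans ?_
    have := hx (t1 * (C₂ * C₄) + E * (nD * d)) (by positivity)
      (by linarith only [hc1, hbS0, hc30, hc50]) bS hbS0 (by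
        have k : 0 ≤ E * (nD * d) + C₂ * C₄ * t1 := by positivity
        linarith only [hc1, k, hc30, hc50])
    linarith
  · have e1 : du t 3 = -((1 + low (u t) 3) * (t⁻¹ • nlB p (q t) (r t) (low (u t)))) := by
      rw [hu.sysEq P ht 3]
      change t⁻¹ • ((0 : ℝ) • low (u t) 3
        + -((1 + low (u t) 3) * nlB p (q t) (r t) (low (u t)))) + 0 = _
      rw [zero_smul, zero_add, add_zero, smul_neg, mul_smul_comm]
    rw [e1, norm_neg]
    have n2 : ‖t⁻¹ • nlB p (q t) (r t) (low (u t))‖ ≤ bB * t ^ (θ - 1) := by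
      rw [norm_smul, Real.norm_of_nonneg hti, hpow]
      calc _ ≤ t⁻¹ * (bB * t ^ θ) := mul_le_mul_of_nonneg_left hb hti
        _ = _ := by ring
    refine (norm_mul_le_mul' hE1 n2).trans ?_
    have := hx 0 le_rfl (by positivity) c3 hc30 (by linarith)
    rw [zero_add] at this
    calc _ = c3 * t ^ (θ - 1) := by rw [hc3]; ring
      _ ≤ _ := this
  · have e1 : t⁻¹ • (low (u t) 2 ^ 2 * (1 + low (u t) 3)
          + (1 / 4 : ℝ) • nlB p (q t) (r t) (low (u t)))
        = t • ((t⁻¹ • low (u t) 2) * (t⁻¹ • low (u t) 2) * (1 + low (u t) 3))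
          + (1 / 4 : ℝ) • (t⁻¹ • nlB p (q t) (r t) (low (u t))) := by
      rw [smul_mul_smul_comm, smul_mul_assoc, smul_smul, ← mul_assoc, htt, one_mul, smul_add,
        smul_comm (1 / 4 : ℝ), sq]
    rw [e1]
    have n1 : ‖t • ((t⁻¹ • low (u t) 2) * (t⁻¹ • low (u t) 2) * (1 + low (u t) 3))‖
        ≤ t2 * (C₂ * C₂ * E) := by
      rw [norm_smul, Real.norm_of_nonneg ht0.le]
      calc _ ≤ t * (C₂ * t ^ (-s) * (C₂ * t ^ (-s)) * E) :=
            mul_le_mul_of_nonneg_left (norm_mul_le_mul' (norm_mul_le_mul' hw2' hw2') hE1) ht0.le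
        _ = t * (t ^ (-s) * t ^ (-s)) * (C₂ * C₂ * E) := by ring
        _ ≤ _ := mul_le_mul_of_nonneg_right r2 (by positivity)
    have n2 : ‖t⁻¹ • nlB p (q t) (r t) (low (u t))‖ ≤ bB * t ^ (θ - 1) := by
      rw [norm_smul, Real.norm_of_nonneg hti, hpow]
      calc _ ≤ t⁻¹ * (bB * t ^ θ) := mul_le_mul_of_nonneg_left hb hti
        _ = _ := by ring
    have n4 := (norm_add_le _ _).trans (add_le_add n1
      (norm_smul_le_mul' (c := (1 / 4 : ℝ)) (B := 1) (by norm_num [abs_of_pos]) n2))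
    refine n4.trans ?_
    have := hx (t2 * (C₂ * C₂ * E)) (by positivity)
      (by linarith only [hc5, hbB0, hc30, hc10]) bB hbB0 (by
        have k : 0 ≤ C₂ * C₂ * t2 * E := by positivity
        linarith only [hc5, k, hc30, hc10])
    linarith

end

end PolarisedT2

namespace PolarisedT2

noncomputable section

/-! ### Inverses and logarithms of Sobolev functions -/

lemma memH_zero {f : Circ → ℝ} (hf : Continuous f) : MemH 0 f :=
  memH_of_summable hf (by simpa only [wf_zero] using (summable_sq_fc hf).summable)

lemma MemH.congr {r : ℕ} {f g : Circ → ℝ} (hf : MemH r f) (h : ∀ x, f x = g x) : MemH r g :=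
  (funext h : f = g) ▸ hf

lemma MemH.mul_of_le {r : ℕ} {f g : Circ → ℝ} (hf : MemH r f) (hg : MemH r g) : MemH r (f * g) := by
  cases r with
  | zero => exact memH_zero (hf.1.mul hg.1)
  | succ r => exact (MemH.mul hf hg).1

lemma fc_eq_integral (f : Circ → ℝ) (n : ℤ) :
    fc f n = fourierCoeffOn (Real.two_pi_pos) (fun s : ℝ => (f (s : Circ) : ℂ)) n := by
  rw [fc, fourierCoeff_eq_intervalIntegral _ _ 0, fourierCoeffOn_eq_integral, zero_add, sub_zero]

lemma abs_mul_norm_fc_le {f g : Circ → ℝ} (hg : Continuous g)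
    (h : ∀ s : ℝ, HasDerivAt (fun s : ℝ => f (s : Circ)) (g (s : Circ)) s) (n : ℤ) :
    |(n : ℝ)| * ‖fc f n‖ ≤ ‖fc g n‖ := by
  rcases eq_or_ne n 0 with rfl | hn
  · simp
  have hgc : Continuous fun s : ℝ => (g (s : Circ) : ℂ) :=
    Complex.continuous_ofReal.comp (hg.comp (AddCircle.continuous_mk' _))
  have e := fourierCoeffOn_of_hasDerivAt (Real.two_pi_pos) (f := fun s : ℝ => (f (s : Circ) : ℂ))
    (f' := fun s : ℝ => (g (s : Circ) : ℂ)) hn (fun x _ => (h x).ofReal_comp)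
    (hgc.intervalIntegrable _ _)
  have e0 : ((2 * π : ℝ) : Circ) = ((0 : ℝ) : Circ) := by
    rw [AddCircle.coe_period]; rfl
  rw [← fc_eq_integral, ← fc_eq_integral, e0, sub_self, mul_zero, zero_sub] at e
  have hn' : (n : ℂ) ≠ 0 := by exact_mod_cast hn
  have hpi : (π : ℂ) ≠ 0 := by exact_mod_cast Real.pi_ne_zero
  have e2 : Complex.I * n * fc f n = fc g n := by
    rw [e]; push_cast; field_simp
    simp
  rw [← e2, norm_mul, norm_mul, Complex.norm_I, one_mul, Complex.norm_intCast]

/-- Since `⟨n⟩² = 1 + n²`, the squared `H^{r+1}` norm is controlled by those of `f` and its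
derivative in `H^r`. Only a classical derivative of `f` has to be exhibited. -/
lemma MemH.succ {r : ℕ} {f g : Circ → ℝ} (hf : MemH r f) (hg : MemH r g)
    (h : ∀ s : ℝ, HasDerivAt (fun s : ℝ => f (s : Circ)) (g (s : Circ)) s) : MemH (r + 1) f := by
  refine memH_of_summable hf.1 (Summable.of_nonneg_of_le (fun n => sq_nonneg _) (fun n => ?_)
    (hf.summable.add hg.summable))
  have h1 := abs_mul_norm_fc_le hg.1 h n
  have h2 := pow_le_pow_left₀ (by positivity) h1 2
  rw [mul_pow, sq_abs] at h2
  have h3 := jb_sq n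
  have h4 : 0 ≤ (jb n ^ r) ^ 2 := sq_nonneg _
  calc wf (r + 1) f n ^ 2 = (jb n ^ r) ^ 2 * (jb n ^ 2 * ‖fc f n‖ ^ 2) := by unfold wf; ring
    _ ≤ (jb n ^ r) ^ 2 * (‖fc f n‖ ^ 2 + ‖fc g n‖ ^ 2) := by
        refine mul_le_mul_of_nonneg_left ?_ h4
        rw [h3]; linarith
    _ = _ := by unfold wf; ring

namespace Hsp

variable {m : ℕ}

lemma hasDerivAt_coe (f : Hsp (m + 1)) (s : ℝ) :
    HasDerivAt (fun s : ℝ => f (s : Circ)) (D f (s : Circ)) s := by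
  simpa using hasDerivAt_comp_add f 0 s

/-- As `Hsp r` is `H^{r+1}`, one derivative is given away. The induction can then start in `L²`,
where continuity suffices, and it proceeds through `∂_θ (1/f) = -∂_θ f / f²`. `memH_log` follows the
same pattern. -/
lemma memH_inv (r : ℕ) : ∀ f : Hsp r, (∀ x, f x ≠ 0) → MemH r fun x => (f x)⁻¹ := by
  induction r with
  | zero => exact fun f hf => memH_zero (f.cont.inv₀ hf)
  | succ r ih =>
    intro f hf
    have h1 : MemH r fun x => (f x)⁻¹ := ih (incl (Nat.le_succ r) f) hf
    have h2 : MemH r (((-D f : Hsp r) : Circ → ℝ) * ((fun x => (f x)⁻¹) * fun x => (f x)⁻¹)) :=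
      ((-D f).memH.mono (Nat.le_succ r)).1.mul_of_le (h1.mul_of_le h1)
    refine h1.succ h2 fun s => ?_
    refine ((hasDerivAt_coe f s).fun_inv (hf _)).congr_deriv ?_
    simp only [Pi.mul_apply, Hsp.neg_apply]
    field_simp

lemma memH_log (r : ℕ) : ∀ f : Hsp r, (∀ x, 0 < f x) → MemH r fun x => log (f x) := by
  induction r with
  | zero => exact fun f hf => memH_zero (f.cont.log fun x => (hf x).ne')
  | succ r ih =>
    intro f hf
    have h1 : MemH r fun x => log (f x) := ih (incl (Nat.le_succ r) f) hf
    have h3 : MemH r fun x => (f x)⁻¹ := memH_inv r (incl (Nat.le_succ r) f) fun x => (hf x).ne'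
    have h2 : MemH r ((D f : Circ → ℝ) * (fun x => (f x)⁻¹)) :=
      ((D f).memH.mono (Nat.le_succ r)).1.mul_of_le h3
    refine h1.succ h2 fun s => ?_
    refine ((hasDerivAt_coe f s).log (hf _).ne').congr_deriv ?_
    simp only [Pi.mul_apply]
    field_simp

/-- The logarithm of a positive function, with the loss of one derivative. -/
def logL (f : Hsp (m + 1)) (hf : ∀ x, 0 < f x) : Hsp m := mk (fun x => log (f x)) (memH_log _ f hf)

@[simp] lemma logL_apply (f : Hsp (m + 1)) (hf : ∀ x, 0 < f x) (x : Circ) :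
    logL f hf x = log (f x) := rfl

end Hsp

end

end PolarisedT2

namespace PolarisedT2

noncomputable section

open Hsp

variable {j : ℕ}

/-! ### Asymptotics of small solutions -/

lemma tendsto_zero_rate {C ρ : ℝ} (hρ : 0 < ρ) :
    Tendsto (fun t : ℝ => C * (t + t ^ ρ)) (𝓝[>] 0) (𝓝 0) := by
  have h1 : ContinuousAt (fun t : ℝ => C * (t + t ^ ρ)) 0 :=
    continuousAt_const.mul (continuousAt_id.add (Real.continuousAt_rpow_const 0 ρ (Or.inr hρ.le)))
  have h2 := h1.tendsto
  simp only [Real.zero_rpow hρ.ne', add_zero, mul_zero] at h2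
  exact h2.mono_left nhdsWithin_le_nhds

lemma tendsto_of_rate {E : Type*} [NormedAddCommGroup E] {f : ℝ → E} {L : E} {C T ρ : ℝ}
    (hT : 0 < T) (hρ : 0 < ρ) (h : ∀ t ∈ Ioc 0 T, ‖f t - L‖ ≤ C * (t + t ^ ρ)) :
    Tendsto f (𝓝[>] 0) (𝓝 L) := by
  rw [tendsto_iff_norm_sub_tendsto_zero]
  refine squeeze_zero' (Eventually.of_forall fun _ => norm_nonneg _) ?_
    (tendsto_zero_rate (C := C) hρ)
  filter_upwards [Ioc_mem_nhdsGT hT] with t ht using h t ht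

lemma inv_mul_rate {C t ρ : ℝ} (ht : 0 < t) :
    t⁻¹ * (C * (t + t ^ ρ)) = C * (1 + t ^ (ρ - 1)) := by
  rw [Real.rpow_sub ht, Real.rpow_one]
  field_simp

lemma norm_inv_smul_le_rate {E : Type*} [NormedAddCommGroup E] [NormedSpace ℝ E] {x : E}
    {C t ρ : ℝ} (ht : 0 < t) (h : ‖x‖ ≤ C * (t + t ^ ρ)) :
    ‖t⁻¹ • x‖ ≤ C * (1 + t ^ (ρ - 1)) := by
  rw [norm_smul, Real.norm_of_nonneg (inv_nonneg.mpr ht.le), ← inv_mul_rate ht]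
  exact mul_le_mul_of_nonneg_left h (inv_nonneg.mpr ht.le)

lemma continuousOn_inv_Ioc {T : ℝ} : ContinuousOn (fun t : ℝ => t⁻¹) (Ioc 0 T) :=
  continuousOn_inv₀.mono fun _ ht => ht.1.ne'

/-- A curve of Sobolev functions whose pointwise derivative is integrable at `0`. -/
lemma exists_limit_of_eval {m : ℕ} {F : ℝ → Circ → ℝ} {g : ℝ → Hsp m} {T C ρ : ℝ}
    (hρ : 0 < ρ) (hmem : MemH (m + 1) (F T))
    (hF : ∀ x, ∀ t ∈ Ioc 0 T, HasDerivWithinAt (fun s => F s x) (g t x) (Ioc 0 T) t)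
    (hg : ContinuousOn g (Ioc 0 T)) (hgC : ∀ t ∈ Ioc 0 T, ‖g t‖ ≤ C * (1 + t ^ (ρ - 1))) :
    ∃ (L : Hsp m) (G : ℝ → Hsp m), (∀ t ∈ Ioc 0 T, ‖G t‖ ≤ C * (1 + ρ⁻¹) * (t + t ^ ρ)) ∧
      ∀ t ∈ Ioc 0 T, ∀ x, F t x = L x + G t x := by
  -- The regularity is carried by the Sobolev-valued primitive of `g`; `F` itself is differentiated
  -- only at fixed points. A logarithm therefore has to be placed in a Sobolev space at the single
  -- time `T`.
  obtain ⟨G, hG, hGi⟩ := exists_primitive hρ hg hgC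
  refine ⟨mk (F T) hmem - G T, G, hG, fun t ht x => ?_⟩
  have h1 := congrArg (evalL x) (hGi t T ht.1 ht.2 le_rfl)
  have hsub : Icc t T ⊆ Ioc 0 T := fun y hy => ⟨ht.1.trans_le hy.1, hy.2⟩
  rw [← ContinuousLinearMap.intervalIntegral_comp_comm (evalL x)
    ((hg.mono hsub).intervalIntegrable_of_Icc ht.2)] at h1
  have h2 := integral_eq_sub_of_curve (f := fun s => F s x) (g := fun s => evalL x (g s))
    (hF x) ((evalL x).continuous.comp_continuousOn hg) ht.1 ht.2 le_rfl
  rw [h2] at h1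
  simp only [map_sub, evalL_apply] at h1
  simp only [Hsp.sub_apply, mk_apply]
  linarith

/-- Solutions of scalar linear equations stay positive. -/
lemma pos_of_linear {y c : ℝ → ℝ} {T : ℝ}
    (hy : ∀ t ∈ Ioc 0 T, HasDerivWithinAt y (c t * y t) (Ioc 0 T) t)
    (hc : ContinuousOn c (Ioc 0 T)) (hyT : 0 < y T) : ∀ t ∈ Ioc 0 T, 0 < y t := by
  intro t ht
  by_contra! hneg
  have hsub : ∀ {s}, t ≤ s → Icc s T ⊆ Ioc 0 T := fun {s} hs x hx =>
    ⟨ht.1.trans_le (hs.trans hx.1), hx.2⟩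
  have hyc : ContinuousOn y (Ioc 0 T) := fun s hs => (hy s hs).continuousWithinAt
  -- A nonpositive value would force a zero at some `s ≤ T`, and uniqueness from `s` up to `T` would
  -- then give `y T = 0`.
  obtain ⟨s, hs, hs0⟩ : (0 : ℝ) ∈ y '' Icc t T :=
    intermediate_value_Icc ht.2 (hyc.mono (hsub le_rfl)) ⟨hneg, hyT.le⟩
  obtain ⟨K, hK⟩ := isCompact_Icc.exists_bound_of_continuousOn (hc.mono (hsub hs.1))
  have := eq_zero_of_abs_deriv_le_mul_abs_self_of_eq_zero_right (f := y)
    (f' := fun t => c t * y t) (K := K) (hyc.mono (hsub hs.1)) (fun x hx => by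
      have hx' := hsub hs.1 (Ico_subset_Icc_self hx)
      refine (hy x hx').mono_of_mem_nhdsWithin ?_
      exact mem_of_superset (Icc_mem_nhdsGE hx.2) fun y hy => ⟨hx'.1.trans_le hy.1, hy.2⟩) hs0
    (fun x hx => by
      rw [norm_mul]
      exact mul_le_mul_of_nonneg_right (hK x (Ico_subset_Icc_self hx)) (norm_nonneg _))
    T (right_mem_Icc.mpr hs.2)
  exact hyT.ne' this

variable {ℓ a T₀ p B d e σ κ : ℝ} {q r : ℝ → ℝ}

/-! ### Pointwise equations and positivity. -/

section Pointwise

variable {u : ℝ → Fin 6 → Hsp (j + 2)} {du : ℝ → Fin 6 → Hsp (j + 1)}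

lemma SmallSoln.hasDeriv_apply (hu : SmallSoln ℓ a T₀ p d q r u du) {t : ℝ} (ht : t ∈ Ioc 0 T₀)
    (i : Fin 6) (x : Circ) :
    HasDerivWithinAt (fun s => u s i x) (du t i x) (Ioc 0 T₀) t :=
  (evalL x).hasFDerivAt.comp_hasDerivWithinAt t (hu.hasDeriv_low ht i)

lemma SmallSoln.continuousOn_apply (hu : SmallSoln ℓ a T₀ p d q r u du) (i : Fin 6) (x : Circ) :
    ContinuousOn (fun s => u s i x) (Ioc 0 T₀) :=
  fun _ ht => (hu.hasDeriv_apply ht i x).continuousWithinAt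

lemma SmallSoln.continuousOn_nlB (hu : SmallSoln ℓ a T₀ p d q r u du)
    (hq : ContinuousOn q (Ioc 0 T₀)) (hr : ContinuousOn r (Ioc 0 T₀)) :
    ContinuousOn (fun t => nlB p (q t) (r t) (low (u t))) (Ioc 0 T₀) := by
  have h := hu.continuousOn_low
  have h0 : ContinuousOn (fun t => (1 + low (u t) 3) * low (u t) 5 ^ 2) (Ioc 0 T₀) :=
    (continuousOn_const.add (h 3)).mul ((h 5).pow 2)
  exact ((h0.const_smul p).add (hq.smul (((h 0).pow 4).mul h0))).add
    ((continuousOn_const.mul hr).smul (((h 0).pow 2).mul h0))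

lemma SmallSoln.du_zero_apply (P : SmallParams j a T₀ p B d e σ κ q r)
    (hu : SmallSoln ℓ a T₀ p d q r u du) {t : ℝ} (ht : t ∈ Ioc 0 T₀) (x : Circ) :
    du t 0 x = t⁻¹ * (ℓ - a - u t 1 x) * u t 0 x := by
  rw [hu.sysEq P ht 0]
  change t⁻¹ * ((ℓ - a) * u t 0 x + -(u t 1 x * u t 0 x)) + 0 = _
  ring

lemma SmallSoln.du_five_apply (P : SmallParams j a T₀ p B d e σ κ q r)
    (hu : SmallSoln ℓ a T₀ p d q r u du) {t : ℝ} (ht : t ∈ Ioc 0 T₀) (x : Circ) :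
    du t 5 x = t⁻¹ * (a ^ 2 - 1 + 2 * a * u t 1 x + u t 1 x ^ 2 + u t 2 x ^ 2 * (1 + u t 3 x)
      + 1 / 4 * nlB p (q t) (r t) (low (u t)) x) * u t 5 x := by
  rw [hu.sysEq P ht 5]
  change t⁻¹ * ((a ^ 2 - 1) * u t 5 x + ((2 * a) * u t 1 x + u t 1 x ^ 2
    + u t 2 x ^ 2 * (1 + u t 3 x) + 1 / 4 * nlB p (q t) (r t) (low (u t)) x) * u t 5 x) + 0 = _
  ring

/-- The equations for `w₀` and `ξ` contain no `θ`-derivative and are proportional to the unknown, so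
at each point they are scalar linear equations. -/
lemma SmallSoln.pos (P : SmallParams j a T₀ p B d e σ κ q r)
    (hu : SmallSoln ℓ a T₀ p d q r u du) (hq : ContinuousOn q (Ioc 0 T₀))
    (hr : ContinuousOn r (Ioc 0 T₀)) (h0 : ∀ x, 0 < u T₀ 0 x) (h5 : ∀ x, 0 < u T₀ 5 x) :
    ∀ t ∈ Ioc 0 T₀, ∀ x, 0 < u t 0 x ∧ 0 < u t 5 x := by
  intro t ht x
  have hc := fun i => hu.continuousOn_apply i x
  have hb : ContinuousOn (fun t => nlB p (q t) (r t) (low (u t)) x) (Ioc 0 T₀) :=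
    (evalL x).continuous.comp_continuousOn (hu.continuousOn_nlB hq hr)
  refine ⟨pos_of_linear (y := fun t => u t 0 x) (c := fun t => t⁻¹ * (ℓ - a - u t 1 x)) (fun t ht => ?_)
    (continuousOn_inv_Ioc.mul (continuousOn_const.sub (hc 1))) (h0 x) t ht,
    pos_of_linear (y := fun t => u t 5 x) (c := fun t => t⁻¹ * (a ^ 2 - 1 + 2 * a * u t 1 x
      + u t 1 x ^ 2 + u t 2 x ^ 2 * (1 + u t 3 x) + 1 / 4 * nlB p (q t) (r t) (low (u t)) x)) (fun t ht => ?_)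
    (continuousOn_inv_Ioc.mul ((((continuousOn_const.add (continuousOn_const.mul (hc 1))).add
      ((hc 1).pow 2)).add (((hc 2).pow 2).mul (continuousOn_const.add (hc 3)))).add
      (continuousOn_const.mul hb))) (h5 x) t ht⟩
  · rw [← hu.du_zero_apply P ht]
    exact hu.hasDeriv_apply ht 0 x
  · have := hu.hasDeriv_apply ht 5 x
    rw [hu.du_five_apply P ht] at this
    exact this

end Pointwise

/-! ### Limits of the rescaled components. -/

lemma SmallParams.rate_pos (P : SmallParams j a T₀ p B d e σ κ q r) : 0 < 2 * κ - 2 * σ := by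
  linarith [P.sigma_lt, P.sigma_pos]

lemma exists_slow_limits (P : SmallParams j a T₀ p B d e σ κ q r) :
    ∃ C, 0 ≤ C ∧ ∀ (u : ℝ → Fin 6 → Hsp (j + 2)) (du : ℝ → Fin 6 → Hsp (j + 1)),
      SmallSoln ℓ a T₀ p d q r u du → ∃ w ψ : Hsp (j + 1), ‖w‖ ≤ 1 ∧ (∀ x, 1 / 2 ≤ 1 + ψ x) ∧
        ∀ t ∈ Ioc 0 T₀, ‖low (u t) 1 - w‖ ≤ C * (t + t ^ (2 * κ - 2 * σ)) ∧
          ‖low (u t) 3 - ψ‖ ≤ C * (t + t ^ (2 * κ - 2 * σ)) := by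
  obtain ⟨C, hC, h⟩ := exists_slow_bound P
  have hθ := P.rate_pos
  have hT := P.T_pos
  refine ⟨C * (1 + (2 * κ - 2 * σ)⁻¹), by positivity, fun u du hu => ?_⟩
  obtain ⟨w, hw⟩ := exists_limit hθ (fun t ht => hu.hasDeriv_low ht 1) (hu.contDeriv 1)
    (fun t ht => (h u du hu t ht).1)
  obtain ⟨ψ, hψ⟩ := exists_limit hθ (fun t ht => hu.hasDeriv_low ht 3) (hu.contDeriv 3)
    (fun t ht => (h u du hu t ht).2.1)
  refine ⟨w, ψ, ?_, fun x => ?_, fun t ht => ⟨hw t ht, hψ t ht⟩⟩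
  · refine le_of_tendsto (tendsto_of_rate hT hθ hw).norm ?_
    filter_upwards [Ioc_mem_nhdsGT hT] with t ht using hu.norm_low_le_one P ht 1
  · have h1 := ((evalL x).continuous.tendsto ψ).comp (tendsto_of_rate hT hθ hψ)
    refine ge_of_tendsto (h1.const_add 1) ?_
    filter_upwards [Ioc_mem_nhdsGT hT] with t ht using hu.one_add_psi_ge P ht x

/-- After subtraction of `ln t ∂_θ w̃₁` the time derivative is `t⁻¹ ∂_θ (w₁ - w̃₁)`, integrable by
the rate for `w₁`. That rate holds in `H^{j+2}`, so the limit is taken in `H^{j+1}`. -/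
lemma exists_w2_limit (P : SmallParams j a T₀ p B d e σ κ q r) {C : ℝ} (hC : 0 ≤ C) :
    ∃ C', 0 ≤ C' ∧ ∀ (u : ℝ → Fin 6 → Hsp (j + 2)) (du : ℝ → Fin 6 → Hsp (j + 1)),
      SmallSoln ℓ a T₀ p d q r u du → ∀ w : Hsp (j + 1),
      (∀ t ∈ Ioc 0 T₀, ‖low (u t) 1 - w‖ ≤ C * (t + t ^ (2 * κ - 2 * σ))) →
      ∃ w₂ : Hsp j, ∀ t ∈ Ioc 0 T₀,
        ‖t⁻¹ • incl (Nat.le_succ j) (low (u t) 2) - log t • D w - w₂‖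
          ≤ C' * (t + t ^ (2 * κ - 2 * σ)) := by
  have hθ := P.rate_pos
  set nD := ‖(D : Hsp (j + 1) →L[ℝ] Hsp j)‖ with hnD
  have hnD0 : 0 ≤ nD := norm_nonneg _
  refine ⟨nD * C * (1 + (2 * κ - 2 * σ)⁻¹), by positivity, fun u du hu w hw => ?_⟩
  refine exists_limit (g := fun t => t⁻¹ • D (low (u t) 1 - w)) hθ (fun t ht => ?_) ?_
    (fun t ht => ?_)
  · have h1 := (incl (Nat.le_succ j)).hasFDerivAt.comp_hasDerivWithinAt t (hu.hasDeriv_w2 P ht)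
    have h2 := ((Real.hasDerivAt_log ht.1.ne').smul_const (D w)).hasDerivWithinAt (s := Ioc 0 T₀)
    have h3 := h1.sub h2
    have e1 : ⇑(incl (Nat.le_succ j)) ∘ (fun s => s⁻¹ • low (u s) 2)
        = fun s => s⁻¹ • incl (Nat.le_succ j) (low (u s) 2) := by
      funext s; simp only [Function.comp_apply, map_smul]
    rw [e1] at h3
    refine h3.congr_deriv ?_
    rw [map_smul, map_sub, smul_sub]
    congr 2
    exact (D_incl (Nat.le_succ j) (u t 1)).symm
  · exact continuousOn_inv_Ioc.smul (D.continuous.comp_continuousOn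
      ((hu.continuousOn_low 1).sub continuousOn_const))
  · refine norm_inv_smul_le_rate ht.1 ((ContinuousLinearMap.le_opNorm _ _).trans ?_)
    rw [mul_assoc]
    exact mul_le_mul_of_nonneg_left (hw t ht) hnD0

lemma exists_eta_limit (P : SmallParams j a T₀ p B d e σ κ q r) :
    ∃ C', 0 ≤ C' ∧ ∀ (u : ℝ → Fin 6 → Hsp (j + 2)) (du : ℝ → Fin 6 → Hsp (j + 1)),
      SmallSoln ℓ a T₀ p d q r u du → ∃ η : Hsp (j + 1), ∀ t ∈ Ioc 0 T₀,
        ‖t⁻¹ • low (u t) 4 - η‖ ≤ C' * (t + t ^ (2 * κ - 3 * σ)) := by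
  obtain ⟨C, hC, h⟩ := exists_eta_bound P
  have hθ : 0 < 2 * κ - 3 * σ := by linarith [P.sigma_lt]
  refine ⟨C * (1 + (2 * κ - 3 * σ)⁻¹), by positivity, fun u du hu => ?_⟩
  refine exists_limit hθ (fun t ht => hu.hasDeriv_eta P ht) ?_ (fun t ht => ?_)
  · have h1 : ContinuousOn (fun t => t⁻¹ • (du t 4 - t⁻¹ • low (u t) 4)) (Ioc 0 T₀) :=
      continuousOn_inv_Ioc.smul ((hu.contDeriv 4).sub
        (continuousOn_inv_Ioc.smul (hu.continuousOn_low 4)))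
    refine h1.congr fun t ht => ?_
    simp only
    rw [hu.sysEq P ht 4]
    change _ = t⁻¹ • (t⁻¹ • ((1 : ℝ) • low (u t) 4 + nlF a p (q t) (r t) (low (u t)) 4) + 0
      - t⁻¹ • low (u t) 4)
    rw [one_smul, add_zero, smul_add, add_sub_cancel_left]
  · refine (h u du hu t ht).2.trans (mul_le_mul_of_nonneg_left ?_ hC)
    linarith

/-- The time derivative of the corrected logarithm is `-t⁻¹ (w₁ - w̃₁)`. -/
lemma exists_log_w0_limit (P : SmallParams j a T₀ p B d e σ κ q r) {C : ℝ} (hC : 0 ≤ C) :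
    ∃ C', 0 ≤ C' ∧ ∀ (u : ℝ → Fin 6 → Hsp (j + 2)) (du : ℝ → Fin 6 → Hsp (j + 1)),
      SmallSoln ℓ a T₀ p d q r u du → (∀ t ∈ Ioc 0 T₀, ∀ x, 0 < u t 0 x) → ∀ w : Hsp (j + 1),
      (∀ t ∈ Ioc 0 T₀, ‖low (u t) 1 - w‖ ≤ C * (t + t ^ (2 * κ - 2 * σ))) →
      ∃ (L : Hsp (j + 1)) (G : ℝ → Hsp (j + 1)),
        (∀ t ∈ Ioc 0 T₀, ‖G t‖ ≤ C' * (t + t ^ (2 * κ - 2 * σ))) ∧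
        ∀ t ∈ Ioc 0 T₀, ∀ x, log (u t 0 x) + (a + w x - ℓ) * log t = L x + G t x := by
  have hθ := P.rate_pos
  have hT := P.T_pos
  refine ⟨C * (1 + (2 * κ - 2 * σ)⁻¹), by positivity, fun u du hu hpos w hw => ?_⟩
  have hTm : T₀ ∈ Ioc 0 T₀ := right_mem_Ioc.mpr hT
  refine exists_limit_of_eval (g := fun t => -(t⁻¹ • (low (u t) 1 - w))) hθ ?_
    (fun x t ht => ?_) ?_ (fun t ht => ?_)
  · exact (logL (u T₀ 0) (hpos T₀ hTm) + log T₀ • (algebraMap ℝ (Hsp (j + 1)) (a - ℓ) + w)).memH.congr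
      fun x => by
        simp only [Hsp.add_apply, Hsp.smul_apply, Hsp.algebraMap_apply, logL_apply]; ring
  · have h1 := (hu.hasDeriv_apply ht 0 x).log (hpos t ht x).ne'
    have h2 := ((Real.hasDerivAt_log ht.1.ne').const_mul (a + w x - ℓ)).hasDerivWithinAt
      (s := Ioc 0 T₀)
    refine (h1.add h2).congr_deriv ?_
    rw [hu.du_zero_apply P ht, mul_div_assoc, div_self (hpos t ht x).ne']
    simp only [Hsp.neg_apply, Hsp.smul_apply, Hsp.sub_apply, low_apply]
    ring
  · exact (continuousOn_inv_Ioc.smul ((hu.continuousOn_low 1).sub continuousOn_const)).neg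
  · rw [norm_neg]
    exact norm_inv_smul_le_rate ht.1 (hw t ht)

/-- The time derivative of the corrected logarithm is `t⁻¹ ((a + w₁)² - (a + w̃₁)²)` plus `t⁻¹ (w₂²
(1 + ψ) + 𝔟 / 4)`. The first part factors through `w₁ - w̃₁`, and the second was bounded in
`exists_slow_bound`. -/
lemma exists_log_xi_limit (P : SmallParams j a T₀ p B d e σ κ q r) {C : ℝ} (hC : 0 ≤ C)
    (hq : ContinuousOn q (Ioc 0 T₀)) (hr : ContinuousOn r (Ioc 0 T₀)) :
    ∃ C', 0 ≤ C' ∧ ∀ (u : ℝ → Fin 6 → Hsp (j + 2)) (du : ℝ → Fin 6 → Hsp (j + 1)),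
      SmallSoln ℓ a T₀ p d q r u du → (∀ t ∈ Ioc 0 T₀, ∀ x, 0 < u t 5 x) → ∀ w : Hsp (j + 1),
      ‖w‖ ≤ 1 →
      (∀ t ∈ Ioc 0 T₀, ‖low (u t) 1 - w‖ ≤ C * (t + t ^ (2 * κ - 2 * σ))) →
      ∃ (L : Hsp (j + 1)) (G : ℝ → Hsp (j + 1)),
        (∀ t ∈ Ioc 0 T₀, ‖G t‖ ≤ C' * (t + t ^ (2 * κ - 2 * σ))) ∧
        ∀ t ∈ Ioc 0 T₀, ∀ x,
          log (u t 5 x) + (1 - (a + w x) ^ 2) * log t = L x + G t x := by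
  obtain ⟨C₁, hC₁, hb⟩ := exists_slow_bound P
  have hθ := P.rate_pos
  have hT := P.T_pos
  set M := C * (2 * |a| + 2) + C₁ with hM
  have hM0 : 0 ≤ M := by positivity
  refine ⟨M * (1 + (2 * κ - 2 * σ)⁻¹), by positivity, fun u du hu hpos w hw1 hw => ?_⟩
  have hTm : T₀ ∈ Ioc 0 T₀ := right_mem_Ioc.mpr hT
  refine exists_limit_of_eval (g := fun t => t⁻¹ • ((low (u t) 1 - w)
      * (algebraMap ℝ (Hsp (j + 1)) (2 * a) + (low (u t) 1 + w))) + t⁻¹ • (low (u t) 2 ^ 2 * (1 + low (u t) 3)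
          + (1 / 4 : ℝ) • nlB p (q t) (r t) (low (u t)))) hθ ?_
    (fun x t ht => ?_) ?_ (fun t ht => ?_)
  · exact (logL (u T₀ 5) (hpos T₀ hTm)
      + log T₀ • (1 - (algebraMap ℝ (Hsp (j + 1)) a + w) ^ 2)).memH.congr
      fun x => by
        simp only [Hsp.add_apply, Hsp.smul_apply, Hsp.algebraMap_apply, logL_apply, Hsp.sub_apply,
          Hsp.one_apply, Hsp.pow_apply]; ring
  · have h1 := (hu.hasDeriv_apply ht 5 x).log (hpos t ht x).ne'
    have h2 := ((Real.hasDerivAt_log ht.1.ne').const_mul (1 - (a + w x) ^ 2)).hasDerivWithinAt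
      (s := Ioc 0 T₀)
    refine (h1.add h2).congr_deriv ?_
    rw [hu.du_five_apply P ht, mul_div_assoc, div_self (hpos t ht x).ne']
    simp only [Hsp.add_apply, Hsp.mul_apply, Hsp.smul_apply, Hsp.sub_apply, low_apply,
      Hsp.algebraMap_apply, Hsp.pow_apply, Hsp.one_apply]
    ring
  · have h := hu.continuousOn_low
    have hb : ContinuousOn (fun t => (1 / 4 : ℝ) • nlB p (q t) (r t) (low (u t))) (Ioc 0 T₀) :=
      (hu.continuousOn_nlB hq hr).const_smul (1 / 4 : ℝ)
    exact (continuousOn_inv_Ioc.smul (((h 1).sub continuousOn_const).mul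
      (continuousOn_const.add ((h 1).add continuousOn_const)))).add
      (continuousOn_inv_Ioc.smul ((((h 2).pow 2).mul (continuousOn_const.add (h 3))).add
        hb))
  · have n1 : ‖(low (u t) 1 - w) * (algebraMap ℝ (Hsp (j + 1)) (2 * a) + (low (u t) 1 + w))‖
        ≤ C * (2 * |a| + 2) * (t + t ^ (2 * κ - 2 * σ)) := by
      have e1 : (low (u t) 1 - w) * (algebraMap ℝ (Hsp (j + 1)) (2 * a) + (low (u t) 1 + w))
          = (2 * a) • (low (u t) 1 - w) + (low (u t) 1 - w) * (low (u t) 1 + w) := by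
        rw [mul_add, mul_comm _ (algebraMap _ _ _), Algebra.smul_def]
      have e2 : ‖low (u t) 1 + w‖ ≤ 2 :=
        (norm_add_le _ _).trans (by linarith [hu.norm_low_le_one P ht 1])
      rw [e1]
      refine (norm_add_le _ _).trans ((add_le_add (norm_smul_le_mul' (c := 2 * a) (B := 2 * |a|)
        (by rw [abs_mul]; norm_num) (hw t ht)) (norm_mul_le_mul' (hw t ht) e2)).trans
        (le_of_eq ?_))
      ring
    refine (norm_add_le _ _).trans ((add_le_add (norm_inv_smul_le_rate ht.1 n1)
      (hb u du hu t ht).2.2).trans (le_of_eq ?_))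
    rw [hM]; ring

end

end PolarisedT2

namespace PolarisedT2

noncomputable section

open Hsp

variable {j : ℕ} {ℓ a T₀ p B d e σ κ : ℝ} {q r : ℝ → ℝ}

/-! ### Propagation of the constraints -/

section Constraints

variable {u : ℝ → Fin 6 → Hsp (j + 2)} {du : ℝ → Fin 6 → Hsp (j + 1)}

lemma SmallSoln.hasDeriv_D_apply (hu : SmallSoln ℓ a T₀ p d q r u du) {t : ℝ}
    (ht : t ∈ Ioc 0 T₀) (i : Fin 6) (x : Circ) :
    HasDerivWithinAt (fun s => D (u s i) x) (D (du t i) x) (Ioc 0 T₀) t := by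
  have h := ((evalL x).comp (D : Hsp (j + 1) →L[ℝ] Hsp j)).hasFDerivAt.comp_hasDerivWithinAt t
    (hu.hasDeriv_low ht i)
  have e : ∀ s, D (low (u s) i) x = D (u s i) x := fun s => by
    rw [low, D_incl (Nat.le_succ j) (u s i), incl_apply]
  exact h.congr_of_mem (fun s _ => (e s).symm) ht

lemma nlB_low_apply (p q r : ℝ) (v : Fin 6 → Hsp (j + 2)) (x : Circ) :
    nlB p q r (low v) x = p * ((1 + v 3 x) * v 5 x ^ 2) + q * (v 0 x ^ 4 * ((1 + v 3 x) * v 5 x ^ 2))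
      + 2 * r * (v 0 x ^ 2 * ((1 + v 3 x) * v 5 x ^ 2)) := rfl

lemma nlS_low_apply (a p q r : ℝ) (v : Fin 6 → Hsp (j + 2)) (x : Circ) :
    nlS a p q r (low v) x = q * (v 0 x ^ 4 * ((1 + v 3 x) * v 5 x ^ 2))
      + r * (v 0 x ^ 2 * ((1 + v 3 x) * v 5 x ^ 2)) - (a + v 1 x) * nlB p q r (low v) x := by
  have h : nlS a p q r (low v) x = q * (v 0 x ^ 4 * ((1 + v 3 x) * v 5 x ^ 2))
      + r * (v 0 x ^ 2 * ((1 + v 3 x) * v 5 x ^ 2)) - (a * nlB p q r (low v) x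
        + v 1 x * nlB p q r (low v) x) := rfl
  rw [h]; ring

/-- The form isolates the logarithmic derivatives prescribed by the constraints. Both `q w₀⁴` and `2
r w₀²` produce the factor `4`, so the combination `𝔟_{J_X} + 𝔟_Λ` appears, as it does in `nlS`. -/
lemma hasDerivAt_nlB (p q r : ℝ) (v : Fin 6 → Hsp (j + 2)) (x : Circ) (hψ : 1 + v 3 x ≠ 0) (h5 : v 5 x ≠ 0) :
    HasDerivAt (fun s : ℝ => nlB p q r (low v) (x + (s : Circ)))
      (nlB p q r (low v) x * (D (v 3) x / (1 + v 3 x) + 2 * (D (v 5) x / v 5 x))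
        + 4 * (q * (v 0 x ^ 4 * ((1 + v 3 x) * v 5 x ^ 2))
          + r * (v 0 x ^ 2 * ((1 + v 3 x) * v 5 x ^ 2))) * (D (v 0) x / v 0 x)) 0 := by
  have h := fun i => hasDerivAt_comp_add (v i) x 0
  have hb := ((h 3).const_add 1).fun_mul ((h 5).fun_pow 2)
  have := ((hb.const_mul p).fun_add ((((h 0).fun_pow 4).fun_mul hb).const_mul q)).fun_add
    ((((h 0).fun_pow 2).fun_mul hb).const_mul (2 * r))
  refine this.congr_deriv ?_
  rw [nlB_low_apply]
  simp only [QuotientAddGroup.mk_zero, add_zero]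
  field_simp
  ring

lemma SmallSoln.D_du_zero (P : SmallParams j a T₀ p B d e σ κ q r)
    (hu : SmallSoln ℓ a T₀ p d q r u du) {t : ℝ} (ht : t ∈ Ioc 0 T₀) (x : Circ) :
    D (du t 0) x = t⁻¹ * ((ℓ - a - u t 1 x) * D (u t 0) x - D (u t 1) x * u t 0 x) := by
  have h := fun i => hasDerivAt_comp_add (u t i) x 0
  have h1 := (((h 1).const_sub (ℓ - a)).const_mul t⁻¹).fun_mul (h 0)
  have h2 := hasDerivAt_comp_add (du t 0) x 0
  simp_rw [hu.du_zero_apply P ht] at h2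
  have h3 := h2.unique h1
  simp only [QuotientAddGroup.mk_zero, add_zero] at h3
  rw [h3]; ring

lemma SmallSoln.du_three_apply (P : SmallParams j a T₀ p B d e σ κ q r)
    (hu : SmallSoln ℓ a T₀ p d q r u du) {t : ℝ} (ht : t ∈ Ioc 0 T₀) (x : Circ) :
    du t 3 x = -t⁻¹ * ((1 + u t 3 x) * nlB p (q t) (r t) (low (u t)) x) := by
  rw [hu.sysEq P ht 3]
  change t⁻¹ * (0 * u t 3 x + -((1 + u t 3 x) * nlB p (q t) (r t) (low (u t)) x)) + 0 = _
  ring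

lemma SmallSoln.du_one_apply (P : SmallParams j a T₀ p B d e σ κ q r)
    (hu : SmallSoln ℓ a T₀ p d q r u du) {t : ℝ} (ht : t ∈ Ioc 0 T₀) (x : Circ) :
    du t 1 x = t⁻¹ * (1 / 2 * (u t 2 x * u t 4 x + nlS a p (q t) (r t) (low (u t)) x))
      + (1 + u t 3 x) * D (u t 2) x := by
  rw [hu.sysEq P ht 1]
  change t⁻¹ * (0 * u t 1 x + 1 / 2 * (u t 2 x * u t 4 x + nlS a p (q t) (r t) (low (u t)) x))
    + (1 + u t 3 x) * D (u t 2) x = _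
  ring

lemma SmallSoln.D_du_three (P : SmallParams j a T₀ p B d e σ κ q r)
    (hu : SmallSoln ℓ a T₀ p d q r u du) {t : ℝ} (ht : t ∈ Ioc 0 T₀) (x : Circ) {b' : ℝ}
    (hb : HasDerivAt (fun s : ℝ => nlB p (q t) (r t) (low (u t)) (x + (s : Circ))) b' 0) :
    D (du t 3) x = -t⁻¹ * (D (u t 3) x * nlB p (q t) (r t) (low (u t)) x + (1 + u t 3 x) * b') := by
  have h := fun i => hasDerivAt_comp_add (u t i) x 0
  have h1 := (((h 3).const_add 1).fun_mul hb).const_mul (-t⁻¹)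
  have h2 := hasDerivAt_comp_add (du t 3) x 0
  simp_rw [hu.du_three_apply P ht] at h2
  have h3 := h2.unique h1
  simp only [QuotientAddGroup.mk_zero, add_zero] at h3
  exact h3

lemma SmallSoln.D_du_five (P : SmallParams j a T₀ p B d e σ κ q r)
    (hu : SmallSoln ℓ a T₀ p d q r u du) {t : ℝ} (ht : t ∈ Ioc 0 T₀) (x : Circ) {b' : ℝ}
    (hb : HasDerivAt (fun s : ℝ => nlB p (q t) (r t) (low (u t)) (x + (s : Circ))) b' 0)
    (h5 : u t 5 x ≠ 0) :
    D (du t 5) x = t⁻¹ * (2 * (a + u t 1 x) * D (u t 1) x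
        + 2 * u t 2 x * D (u t 2) x * (1 + u t 3 x) + u t 2 x ^ 2 * D (u t 3) x + 1 / 4 * b')
      * u t 5 x + du t 5 x * (D (u t 5) x / u t 5 x) := by
  have h := fun i => hasDerivAt_comp_add (u t i) x 0
  have h1 := (((((((h 1).const_mul (2 * a)).const_add (a ^ 2 - 1)).fun_add ((h 1).fun_pow 2)).fun_add
    (((h 2).fun_pow 2).fun_mul ((h 3).const_add 1))).fun_add (hb.const_mul (1 / 4))).const_mul
      t⁻¹).fun_mul (h 5)
  have h2 := hasDerivAt_comp_add (du t 5) x 0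
  simp_rw [hu.du_five_apply P ht] at h2
  have h3 := h2.unique h1
  simp only [QuotientAddGroup.mk_zero, add_zero] at h3
  rw [h3, hu.du_five_apply P ht]
  field_simp
  ring

/-- The quantity is conserved: `∂_t ∂_θ ln w₀ = -t⁻¹ ∂_θ w₁` cancels the derivative of `w₂ / t`. -/
lemma SmallSoln.constraintW (P : SmallParams j a T₀ p B d e σ κ q r)
    (hu : SmallSoln ℓ a T₀ p d q r u du) (hpos : ∀ t ∈ Ioc 0 T₀, ∀ x, 0 < u t 0 x) (x : Circ)
    (h : D (u T₀ 0) x / u T₀ 0 x + T₀⁻¹ * u T₀ 2 x = 0) {t : ℝ} (ht : t ∈ Ioc 0 T₀) :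
    D (u t 0) x / u t 0 x + t⁻¹ * u t 2 x = 0 := by
  have hd : ∀ t ∈ Ioc 0 T₀, HasDerivWithinAt
      (fun t => D (u t 0) x / u t 0 x + t⁻¹ * u t 2 x) 0 (Ioc 0 T₀) t := fun t ht => by
    have h1 := (hu.hasDeriv_D_apply ht 0 x).fun_div (hu.hasDeriv_apply ht 0 x) (hpos t ht x).ne'
    have h2 := (evalL x).hasFDerivAt.comp_hasDerivWithinAt t (hu.hasDeriv_w2 P ht)
    refine (h1.fun_add h2).congr_deriv ?_
    have e2 : (evalL x) (t⁻¹ • D (u t 1)) = t⁻¹ * D (u t 1) x := rfl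
    rw [e2, hu.D_du_zero P ht, hu.du_zero_apply P ht]
    have := (hpos t ht x).ne'
    have := ht.1.ne'
    field_simp
    ring
  have := integral_eq_sub_of_curve hd continuousOn_const ht.1 ht.2 le_rfl
  rw [h, intervalIntegral.integral_zero, zero_sub] at this
  linarith

/-- The defects of the constraints for `ψ` and `ξ`. -/
def defects (a : ℝ) (u : ℝ → Fin 6 → Hsp (j + 2)) (x : Circ) (t : ℝ) : ℝ × ℝ :=
  (D (u t 3) x - t⁻¹ * u t 4 x,
    D (u t 5) x / u t 5 x - 2 * (t⁻¹ * u t 2 x) * (a + u t 1 x)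
      + t⁻¹ * u t 4 x / (2 * (1 + u t 3 x)))

/-- Normalised by `t` and `ξ`, the two defects satisfy a closed homogeneous linear system. Closure
uses the constraint for `w₀`, which replaces `∂_θ w₀ / w₀` in `∂_θ 𝔟` by `-w₂ / t`. -/
lemma SmallSoln.hasDeriv_defects (P : SmallParams j a T₀ p B d e σ κ q r)
    (hu : SmallSoln ℓ a T₀ p d q r u du) (x : Circ) {t : ℝ} (ht : t ∈ Ioc 0 T₀)
    (hpos : ∀ x, 0 < u t 5 x) (hW : D (u t 0) x / u t 0 x + t⁻¹ * u t 2 x = 0) :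
    HasDerivWithinAt (defects a u x)
      (-(t⁻¹ * (2 * nlB p (q t) (r t) (low (u t)) x * ((defects a u x t).1
          + (1 + u t 3 x) * (defects a u x t).2))),
        t⁻¹ * (u t 2 x ^ 2 * (defects a u x t).1 + nlB p (q t) (r t) (low (u t)) x
          * ((defects a u x t).1 / (4 * (1 + u t 3 x)) + (defects a u x t).2 / 2)))
      (Ioc 0 T₀) t := by
  have hψ : 1 + u t 3 x ≠ 0 := by linarith [hu.one_add_psi_ge P ht x]
  have h5 : u t 5 x ≠ 0 := (hpos x).ne'
  have ht0 : t ≠ 0 := ht.1.ne'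
  have hb := hasDerivAt_nlB p (q t) (r t) (u t) x hψ h5
  have hW' : D (u t 0) x / u t 0 x = -(t⁻¹ * u t 2 x) := by linarith
  rw [hW'] at hb
  have hη : HasDerivWithinAt (fun s => s⁻¹ * u s 4 x)
      (t⁻¹ * (t⁻¹ * (4 * ((1 + u t 3 x) * nlS a p (q t) (r t) (low (u t)) x * u t 2 x)
        - nlB p (q t) (r t) (low (u t)) x * u t 4 x))) (Ioc 0 T₀) t :=
    (evalL x).hasFDerivAt.comp_hasDerivWithinAt t (hu.hasDeriv_eta P ht)
  have hw2 : HasDerivWithinAt (fun s => s⁻¹ * u s 2 x) (t⁻¹ * D (u t 1) x) (Ioc 0 T₀) t :=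
    (evalL x).hasFDerivAt.comp_hasDerivWithinAt t (hu.hasDeriv_w2 P ht)
  have h1 := (hu.hasDeriv_D_apply ht 3 x).fun_sub hη
  have h2 := (((hu.hasDeriv_D_apply ht 5 x).fun_div (hu.hasDeriv_apply ht 5 x) h5).fun_sub
    ((hw2.const_mul 2).fun_mul ((hu.hasDeriv_apply ht 1 x).const_add a))).fun_add
    (hη.fun_div (((hu.hasDeriv_apply ht 3 x).const_add 1).const_mul 2)
      (mul_ne_zero two_ne_zero hψ))
  refine (h1.prodMk h2).congr_deriv ?_
  rw [hu.D_du_three P ht x hb, hu.D_du_five P ht x hb h5, hu.du_one_apply P ht,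
    hu.du_three_apply P ht, nlS_low_apply]
  simp only [defects]
  set β := nlB p (q t) (r t) (low (u t)) x
  set γ := q t * (u t 0 x ^ 4 * ((1 + u t 3 x) * u t 5 x ^ 2))
      + r t * (u t 0 x ^ 2 * ((1 + u t 3 x) * u t 5 x ^ 2))
  -- With `𝔟` and `𝔟_{J_X} + 𝔟_Λ` treated as unknowns, both components become rational identities in
  -- which neither has to be expanded.
  clear_value β γ
  refine Prod.ext ?_ ?_
  · simp only
    field_simp
    ring
  · simp only
    field_simp
    ring

/-- The coefficients of the homogeneous system are `O(1/t)`, so `backward_gronwall` with `A = 0`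
propagates the zero data at `T₀` to every positive time. -/
lemma SmallSoln.defects_eq_zero (P : SmallParams j a T₀ p B d e σ κ q r)
    (hu : SmallSoln ℓ a T₀ p d q r u du) (hpos : ∀ t ∈ Ioc 0 T₀, ∀ x, 0 < u t 0 x ∧ 0 < u t 5 x)
    (x : Circ) (hW : D (u T₀ 0) x / u T₀ 0 x + T₀⁻¹ * u T₀ 2 x = 0)
    (h : defects a u x T₀ = 0) {t : ℝ} (ht : t ∈ Ioc 0 T₀) : defects a u x t = 0 := by
  set M := cB (Hsp (j + 1)) B with hM
  have hM0 : 0 ≤ M := cB_nonneg P.B_nonneg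
  -- The first component of the system is bounded by `6 M N / t` and the second by `(M + 1) N / t`;
  -- `6 * M + 1` covers both.
  have key := backward_gronwall (f := defects a u x) (m := fun t => (6 * M + 1) * t⁻¹)
    (Φ := fun t => (6 * M + 1) * log t) le_rfl
    (fun t ht => hu.hasDeriv_defects P x ht (fun x => (hpos t ht x).2)
      (hu.constraintW P (fun t ht x => (hpos t ht x).1) x hW ht))
    (fun t ht => (Real.hasDerivAt_log ht.1.ne').const_mul _)
    (fun t ht => mul_pos (by linarith) (inv_pos.mpr ht.1)) (fun t ht => ?_) ht
  · rw [h, norm_zero, add_zero, add_zero, zero_mul] at key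
    exact norm_le_zero_iff.mp key
  · have hti : 0 ≤ t⁻¹ := inv_nonneg.mpr ht.1.le
    have h1 : ∀ i, |u t i x| ≤ 1 := fun i =>
      (abs_apply_le (low (u t) i) x).trans (hu.norm_low_le_one P ht i)
    have hψ := hu.one_add_psi_ge P ht x
    have hψ2 : 1 + u t 3 x ≤ 2 := by linarith [(abs_le.mp (h1 3)).2]
    have hb : |nlB p (q t) (r t) (low (u t)) x| ≤ M := by
      refine (abs_apply_le _ x).trans ((norm_nlB_le P.p_le (P.q_le t ht) (P.r_le t ht)
        (fun i => hu.norm_low_le_one P ht i)).trans ?_)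
      exact mul_le_of_le_one_right hM0 (pow_le_one₀ (norm_nonneg _) (hu.norm_low_le_one P ht 5))
    set N := ‖defects a u x t‖ with hN
    have hN0 : 0 ≤ N := norm_nonneg _
    have hY : |(defects a u x t).1| ≤ N := norm_fst_le (defects a u x t)
    have hZ : |(defects a u x t).2| ≤ N := norm_snd_le (defects a u x t)
    set Y := (defects a u x t).1
    set Z := (defects a u x t).2
    set β := nlB p (q t) (r t) (low (u t)) x
    have e1 : |Y + (1 + u t 3 x) * Z| ≤ 3 * N := by
      refine (abs_add_le _ _).trans ?_
      rw [abs_mul, abs_of_pos (by linarith : 0 < 1 + u t 3 x)]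
      nlinarith [abs_nonneg Z]
    have e2 : |Y / (4 * (1 + u t 3 x)) + Z / 2| ≤ N := by
      refine (abs_add_le _ _).trans ?_
      rw [abs_div, abs_div, abs_two, abs_of_pos (by linarith : 0 < 4 * (1 + u t 3 x))]
      have : |Y| / (4 * (1 + u t 3 x)) ≤ N / 2 := by
        rw [div_le_div_iff₀ (by linarith) two_pos]
        nlinarith [abs_nonneg Y]
      linarith
    have e3 : |u t 2 x ^ 2 * Y| ≤ N := by
      rw [abs_mul, abs_pow]
      calc _ ≤ 1 * N := mul_le_mul (pow_le_one₀ (abs_nonneg _) (h1 2)) hY (abs_nonneg _) zero_le_one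
        _ = N := one_mul N
    have hMN : 0 ≤ M * N := mul_nonneg hM0 hN0
    rw [add_zero, Prod.norm_def]
    refine max_le ?_ ?_
    · rw [Real.norm_eq_abs, abs_neg, abs_mul, abs_of_nonneg hti, abs_mul, abs_mul, abs_two]
      calc _ ≤ t⁻¹ * (2 * M * (3 * N)) := by gcongr
        _ ≤ t⁻¹ * ((6 * M + 1) * N) := mul_le_mul_of_nonneg_left (by linarith) hti
        _ = _ := by ring
    · rw [Real.norm_eq_abs, abs_mul, abs_of_nonneg hti]
      have e4 : |β * (Y / (4 * (1 + u t 3 x)) + Z / 2)| ≤ M * N := by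
        rw [abs_mul]; gcongr
      calc _ ≤ t⁻¹ * (N + M * N) := by
            refine mul_le_mul_of_nonneg_left ((abs_add_le _ _).trans (add_le_add e3 e4)) hti
        _ ≤ t⁻¹ * ((6 * M + 1) * N) := mul_le_mul_of_nonneg_left (by linarith) hti
        _ = _ := by ring

/-- The constraint satisfied by the asymptotic data. -/
lemma SmallSoln.asymptotic_constraint (P : SmallParams j a T₀ p B d e σ κ q r)
    (hu : SmallSoln ℓ a T₀ p d q r u du) (hpos : ∀ t ∈ Ioc 0 T₀, ∀ x, 0 < u t 5 x) (x : Circ)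
    (hdef : ∀ t ∈ Ioc 0 T₀, defects a u x t = 0)
    {w ψ η L : Hsp (j + 1)} {w₂ : Hsp j} {G : ℝ → Hsp (j + 1)} {C : ℝ} (hψ : 1 / 2 ≤ 1 + ψ x)
    (hw1 : ∀ t ∈ Ioc 0 T₀, ‖low (u t) 1 - w‖ ≤ C * (t + t ^ (2 * κ - 2 * σ)))
    (hψ1 : ∀ t ∈ Ioc 0 T₀, ‖low (u t) 3 - ψ‖ ≤ C * (t + t ^ (2 * κ - 2 * σ)))
    (hw2 : Tendsto (fun t => t⁻¹ • incl (Nat.le_succ j) (low (u t) 2) - log t • D w) (𝓝[>] 0) (𝓝 w₂))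
    (hη : Tendsto (fun t => t⁻¹ • low (u t) 4) (𝓝[>] 0) (𝓝 η))
    (hG : Tendsto G (𝓝[>] 0) (𝓝 0))
    (hL : ∀ t ∈ Ioc 0 T₀, ∀ x, log (u t 5 x) + (1 - (a + w x) ^ 2) * log t = L x + G t x) :
    D L x = 2 * (a + w x) * w₂ x - η x / (2 * (1 + ψ x)) := by
  have hθ := P.rate_pos
  have hT := P.T_pos
  have ev : ∀ᶠ t in 𝓝[>] (0 : ℝ), t ∈ Ioc 0 T₀ := Ioc_mem_nhdsGT hT
  obtain ⟨C₂, hC₂, hb2⟩ := exists_w2_bound P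
  have hC : 0 ≤ C := by
    have h1 := (norm_nonneg _).trans (hw1 T₀ (right_mem_Ioc.mpr hT))
    have h2 : 0 < T₀ + T₀ ^ (2 * κ - 2 * σ) := by
      have := Real.rpow_pos_of_pos hT (2 * κ - 2 * σ)
      linarith
    exact nonneg_of_mul_nonneg_left h1 h2
  -- The `θ`-derivative of the expansion of `ln ξ` is combined with the vanishing defect. The term
  -- `ln t ∂_θ w̃₁` from the exponent is exactly the one subtracted from `w₂ / t`, so every
  -- remaining piece converges.
  have key : ∀ t ∈ Ioc 0 T₀, D L x = 2 * (a + w x) * (t⁻¹ * u t 2 x - log t * D w x)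
      + 2 * (t⁻¹ * u t 2 x * (u t 1 x - w x)) - t⁻¹ * u t 4 x / (2 * (1 + u t 3 x)) - D (G t) x := by
    intro t ht
    have h1 := ((hasDerivAt_comp_add (u t 5) x 0).log (by simpa using (hpos t ht x).ne')).fun_add
      (((((hasDerivAt_comp_add w x 0).const_add a).fun_pow 2).const_sub 1).mul_const (log t))
    have h2 := (hasDerivAt_comp_add L x 0).fun_add (hasDerivAt_comp_add (G t) x 0)
    simp_rw [hL t ht] at h1
    have h3 := h2.unique h1
    simp only [QuotientAddGroup.mk_zero, add_zero] at h3
    have h4 := congrArg Prod.snd (hdef t ht)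
    simp only [defects, Prod.snd_zero] at h4
    push_cast at h3
    linear_combination h3 + h4
  have hw2' : Tendsto (fun t => t⁻¹ * u t 2 x - log t * D w x) (𝓝[>] 0) (𝓝 (w₂ x)) :=
    ((evalL x).continuous.tendsto w₂).comp hw2
  have hη' : Tendsto (fun t => t⁻¹ * u t 4 x) (𝓝[>] 0) (𝓝 (η x)) :=
    ((evalL x).continuous.tendsto η).comp hη
  have hψ' : Tendsto (fun t => u t 3 x) (𝓝[>] 0) (𝓝 (ψ x)) :=
    ((evalL x).continuous.tendsto ψ).comp (tendsto_of_rate hT hθ hψ1)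
  have hG' : Tendsto (fun t => D (G t) x) (𝓝[>] 0) (𝓝 0) := by
    have := (((evalL x).comp (D : Hsp (j + 1) →L[ℝ] Hsp j)).continuous.tendsto 0).comp hG
    rwa [map_zero] at this
  -- The growth `t^{-s}` of `w₂ / t` is beaten by the rate of `w₁`, since `s ≤ 1/2` and `s ≤ σ`.
  have hprod : Tendsto (fun t => t⁻¹ * u t 2 x * (u t 1 x - w x)) (𝓝[>] 0) (𝓝 0) := by
    set s := lossExp σ with hs
    have hs1 : s ≤ σ := min_le_left _ _
    have hs2 : s ≤ 1 / 2 := min_le_right _ _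
    have hlim : Tendsto (fun t : ℝ => C₂ * C * (t ^ (1 - s) + t ^ (2 * κ - 2 * σ - s))) (𝓝[>] 0)
        (𝓝 0) := by
      have e1 : 0 < 1 - s := by linarith
      have e2 : 0 < 2 * κ - 2 * σ - s := by linarith [P.sigma_lt]
      have h1 : ContinuousAt (fun t : ℝ => C₂ * C * (t ^ (1 - s) + t ^ (2 * κ - 2 * σ - s))) 0 :=
        continuousAt_const.mul ((Real.continuousAt_rpow_const 0 _ (Or.inr e1.le)).add
          (Real.continuousAt_rpow_const 0 _ (Or.inr e2.le)))
      have h2 := h1.tendsto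
      simp only [Real.zero_rpow e1.ne', Real.zero_rpow e2.ne', add_zero, mul_zero] at h2
      exact h2.mono_left nhdsWithin_le_nhds
    refine squeeze_zero_norm' ?_ hlim
    filter_upwards [ev] with t ht
    have n1 : |t⁻¹ * u t 2 x| ≤ C₂ * t ^ (-s) :=
      (abs_apply_le (t⁻¹ • low (u t) 2) x).trans (hb2 u du hu t ht)
    have n2 : |u t 1 x - w x| ≤ C * (t + t ^ (2 * κ - 2 * σ)) :=
      (abs_apply_le (low (u t) 1 - w) x).trans (hw1 t ht)
    rw [norm_mul, Real.norm_eq_abs, Real.norm_eq_abs]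
    have e0 := Real.rpow_nonneg ht.1.le (-s)
    refine (mul_le_mul n1 n2 (abs_nonneg _) (by positivity)).trans (le_of_eq ?_)
    rw [Real.rpow_sub ht.1 1, Real.rpow_sub ht.1 (2 * κ - 2 * σ) s, Real.rpow_one,
      Real.rpow_neg ht.1.le]
    ring
  have hlim := (((hw2'.const_mul (2 * (a + w x))).add (hprod.const_mul 2)).sub
    (hη'.div ((hψ'.const_add 1).const_mul 2) (by linarith))).sub hG'
  have h1 := tendsto_nhds_unique (tendsto_const_nhds.congr' (by
    filter_upwards [ev] with t ht using key t ht)) hlim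
  rw [h1]; ring

end Constraints

end

end PolarisedT2

namespace PolarisedT2

noncomputable section

open Hsp

variable {j m : ℕ}

/-! ### Curves of functions as curves in the Sobolev algebras -/

lemma exists_curve {I : Set ℝ} {V : ℝ → Fin 6 → Circ → ℝ} (h : ∀ t ∈ I, MemHv (m + 1) (V t)) :
    ∃ u : ℝ → Fin 6 → Hsp m, ∀ t ∈ I, ∀ i, (u t i : Circ → ℝ) = V t i := by
  classical
  refine ⟨fun t i => if ht : t ∈ I then mk (V t i) (h t ht i) else 0, fun t ht i => ?_⟩
  simp only [ht, dif_pos, coe_mk]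

lemma norm_le_normHv (f : Fin 6 → Hsp m) (i : Fin 6) :
    ‖f i‖ ≤ algConst m * normHv (m + 1) fun i => f i := by
  rw [norm_eq]
  refine mul_le_mul_of_nonneg_left (Real.le_sqrt_of_sq_le ?_)
    (zero_le_one.trans (one_le_algConst m))
  exact Finset.single_le_sum (f := fun i => normH (m + 1) (f i) ^ 2) (fun i _ => sq_nonneg _)
    (Finset.mem_univ i)

lemma normHv_le_sum (f : Fin 6 → Hsp m) : normHv (m + 1) (fun i => f i) ≤ ∑ i, ‖f i‖ := by
  refine Real.sqrt_le_iff.mpr ⟨Finset.sum_nonneg fun i _ => norm_nonneg _, ?_⟩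
  refine (Finset.sum_le_sum fun i _ => ?_).trans
    (Finset.sum_sq_le_sq_sum_of_nonneg fun i _ => norm_nonneg (f i))
  exact pow_le_pow_left₀ (Real.sqrt_nonneg _) (normH_le_norm _) 2

lemma tendsto_of_normHv {l : Filter ℝ} {V : ℝ → Fin 6 → Circ → ℝ} {f : ℝ → Fin 6 → Hsp m}
    (hV : Tendsto (fun s => normHv (m + 1) (V s)) l (𝓝 0))
    (hf : ∀ᶠ s in l, ∀ i, (f s i : Circ → ℝ) = V s i) (i : Fin 6) :
    Tendsto (fun s => f s i) l (𝓝 0) := by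
  have h := hV.const_mul (algConst m)
  rw [mul_zero] at h
  refine squeeze_zero_norm' ?_ h
  filter_upwards [hf] with s hs
  have := norm_le_normHv (f s) i
  rwa [show (fun i => (f s i : Circ → ℝ)) = V s from funext hs] at this

lemma ContH.continuousOn {I : Set ℝ} {V : ℝ → Fin 6 → Circ → ℝ} (h : ContH (m + 1) I V)
    {u : ℝ → Fin 6 → Hsp m} (hu : ∀ t ∈ I, ∀ i, (u t i : Circ → ℝ) = V t i) (i : Fin 6) :
    ContinuousOn (fun t => u t i) I := fun t ht => by
  have h1 := tendsto_of_normHv (f := fun s i => u s i - u t i) (h.2 t ht) (by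
    filter_upwards [self_mem_nhdsWithin] with s hs i
    funext x
    rw [Hsp.sub_apply, hu s hs, hu t ht]; rfl) i
  rw [ContinuousWithinAt, tendsto_sub_nhds_zero_iff.symm]
  exact h1

lemma ContDerivH.hasDerivWithinAt {I : Set ℝ} {V V' : ℝ → Fin 6 → Circ → ℝ}
    (h : ContDerivH (m + 1) I V V') {u du : ℝ → Fin 6 → Hsp m}
    (hu : ∀ t ∈ I, ∀ i, (u t i : Circ → ℝ) = V t i)
    (hdu : ∀ t ∈ I, ∀ i, (du t i : Circ → ℝ) = V' t i) (i : Fin 6) {t : ℝ} (ht : t ∈ I) :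
    HasDerivWithinAt (fun s => u s i) (du t i) I t := by
  rw [hasDerivWithinAt_iff_tendsto_slope]
  have h1 := tendsto_of_normHv (f := fun s i => (s - t)⁻¹ • (u s i - u t i) - du t i)
    (h.2.2 t ht) (by
      filter_upwards [self_mem_nhdsWithin] with s hs i
      funext x
      rw [Hsp.sub_apply, Hsp.smul_apply, Hsp.sub_apply, hu s hs.1, hu t ht, hdu t ht]; rfl) i
  rw [tendsto_sub_nhds_zero_iff.symm]
  exact h1

lemma boundH_of_norm_le {f : Circ → ℝ} {B : ℝ} (g : Hsp m) (h : ∀ x, g x = f x) (hB : ‖g‖ ≤ B) :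
    BoundH (m + 1) f B := by
  rw [← funext h]
  exact ⟨g.memH, (normH_le_norm g).trans hB⟩

/-! ### The system of equations -/

/-- Positivity of `1 + ψ` is needed because solving the third row for `∂_t w₂` divides by it. Along
solutions it comes from smallness inside the continuity argument. -/
lemma sysEq_of_evolutionEq {P J Λ ℓ a t : ℝ} {v : Fin 6 → Hsp (j + 2)} {dv : Fin 6 → Hsp (j + 1)}
    (h : EvolutionEq P J Λ ℓ a t (fun i => v i) (fun i => dv i)) (hψ : ∀ x, 0 < 1 + v 3 x) :
    SysEq ℓ a (P ^ 2) (J ^ 2 * t ^ (2 * (1 - 2 * ℓ))) (2 * Λ * t ^ (2 * (2 - ℓ))) t v dv := by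
  set q := J ^ 2 * t ^ (2 * (1 - 2 * ℓ)) with hq
  set r := 2 * Λ * t ^ (2 * (2 - ℓ)) with hr
  have hb : ∀ x, bTot P J Λ ℓ t (stateAt (fun i => v i) x) = nlB (P ^ 2) q r (low v) x := fun x => by
    rw [nlB_low_apply]
    simp only [bTot, bP, bJ, bΛ, stateAt]
    rw [← hq, ← hr]; ring
  have hS : ∀ x, bJ J ℓ t (stateAt (fun i => v i) x) + bΛ Λ ℓ t (stateAt (fun i => v i) x)
      - (a + v 1 x) * bTot P J Λ ℓ t (stateAt (fun i => v i) x) = nlS a (P ^ 2) q r (low v) x :=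
    fun x => by
      rw [nlS_low_apply, hb]
      simp only [bJ, bΛ, stateAt]
      rw [← hq, ← hr]; ring
  intro i
  rw [show incl (Nat.le_succ (j + 1)) (nlF a (P ^ 2) q r v i) = nlF a (P ^ 2) q r (low v) i from
    (incl_nlF _ _ _ _ _ _ _).symm]
  ext x
  have hx := congrFun (h x) i
  have hSx := hS x
  rw [hb] at hSx
  fin_cases i <;>
    simp [matB0, matB1, matB, matP, vecF, Matrix.vecHead, Matrix.vecTail, dotProduct, Fin.sum_univ_six,
      hb] at hx <;> simp only [stateAt, dθ_eq] at hx hSx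
  · change dv 0 x = t⁻¹ * ((ℓ - a) * v 0 x + -(v 1 x * v 0 x)) + 0
    linear_combination hx
  · change dv 1 x = t⁻¹ * (0 * v 1 x + 1 / 2 * (v 2 x * v 4 x + nlS a (P ^ 2) q r (low v) x))
      + (1 + v 3 x) * D (v 2) x
    linear_combination hx + t⁻¹ * (1 / 2) * hSx
  · change dv 2 x = t⁻¹ * (1 * v 2 x + 0) + D (v 1) x
    refine mul_left_cancel₀ (hψ x).ne' ?_
    linear_combination hx
  · change dv 3 x = t⁻¹ * (0 * v 3 x + -((1 + v 3 x) * nlB (P ^ 2) q r (low v) x)) + 0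
    linear_combination hx
  · change dv 4 x = t⁻¹ * (1 * v 4 x + (4 * ((1 + v 3 x) * nlS a (P ^ 2) q r (low v) x * v 2 x)
      - nlB (P ^ 2) q r (low v) x * v 4 x)) + 0
    linear_combination hx + t⁻¹ * v 2 x * 4 * (1 + v 3 x) * hSx
  · change dv 5 x = t⁻¹ * ((a ^ 2 - 1) * v 5 x + ((2 * a) * v 1 x + v 1 x ^ 2
      + v 2 x ^ 2 * (1 + v 3 x) + 1 / 4 * nlB (P ^ 2) q r (low v) x) * v 5 x) + 0
    linear_combination (1 / 4) * hx

lemma abs_mul_rpow_le {c e t T : ℝ} (h : c = 0 ∨ 0 ≤ e) (ht : t ∈ Ioc 0 T) :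
    |c * t ^ e| ≤ |c| * T ^ e := by
  rw [abs_mul, abs_of_nonneg (Real.rpow_nonneg ht.1.le e)]
  rcases h with rfl | h
  · simp
  · exact mul_le_mul_of_nonneg_left (Real.rpow_le_rpow ht.1.le ht.2 h) (abs_nonneg c)

/-- In each admissible range, a power of `t` whose exponent could be negative is multiplied by a
vanishing coefficient. -/
lemma exists_coeff_bound {P J Λ ℓ a T : ℝ} (h : Admissible J Λ ℓ a) (hT : 0 < T) :
    ∃ B, |P ^ 2| ≤ B ∧ (∀ t ∈ Ioc 0 T, |J ^ 2 * t ^ (2 * (1 - 2 * ℓ))| ≤ B) ∧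
      ∀ t ∈ Ioc 0 T, |2 * Λ * t ^ (2 * (2 - ℓ))| ≤ B := by
  have h1 : J ^ 2 = 0 ∨ 0 ≤ 2 * (1 - 2 * ℓ) := by
    rcases h with h | h | h
    · exact Or.inr (by linarith [h.2.2.1])
    · exact Or.inl (by rw [h.1]; ring)
    · exact Or.inl (by rw [h.1]; ring)
  have h2 : 2 * Λ = 0 ∨ 0 ≤ 2 * (2 - ℓ) := by
    rcases h with h | h | h
    · exact Or.inr (by linarith [h.2.2.1])
    · exact Or.inr (by linarith [h.2.2.2.1])
    · exact Or.inl (by rw [h.2.1]; ring)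
  have n1 : 0 ≤ |J ^ 2| * T ^ (2 * (1 - 2 * ℓ)) := mul_nonneg (abs_nonneg _) (Real.rpow_nonneg hT.le _)
  have n2 : 0 ≤ |2 * Λ| * T ^ (2 * (2 - ℓ)) := mul_nonneg (abs_nonneg _) (Real.rpow_nonneg hT.le _)
  have n3 := abs_nonneg (P ^ 2)
  refine ⟨|P ^ 2| + |J ^ 2| * T ^ (2 * (1 - 2 * ℓ)) + |2 * Λ| * T ^ (2 * (2 - ℓ)), by linarith,
    fun t ht => ?_, fun t ht => ?_⟩
  · linarith [abs_mul_rpow_le h1 ht]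
  · linarith [abs_mul_rpow_le h2 ht]

lemma continuousOn_coeff (c e T : ℝ) : ContinuousOn (fun t : ℝ => c * t ^ e) (Ioc 0 T) :=
  continuousOn_const.mul (continuousOn_id.rpow_const fun _ ht => Or.inl ht.1.ne')

/-- The radius `e` in `H^{j+2}` is fixed first, so that the perturbation costs at most `σ`. The
radius `d` in `H^{j+3}` is then small enough for the inclusion to map into the `e`-ball and for the
damping to absorb the energy errors. Positivity of `κ` follows from `0 < σ` and `3σ < 2κ`. -/
lemma exists_smallParams (j : ℕ) {a T₀ p B σ κ : ℝ} {q r : ℝ → ℝ} (hT : 0 < T₀) (hp : |p| ≤ B)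
    (hq : ∀ t ∈ Ioc 0 T₀, |q t| ≤ B) (hr : ∀ t ∈ Ioc 0 T₀, |r t| ≤ B) (hσ : 0 < σ)
    (hσκ : 3 * σ < 2 * κ) (hκ3 : κ ≤ a ^ 2 - 1) :
    ∃ d e, 0 < d ∧ SmallParams j a T₀ p B d e σ κ q r ∧
      11 * cF (Hsp (j + 2)) a B * d * algConst (j + 2) ^ 2 ≤ κ := by
  have hB : 0 ≤ B := (abs_nonneg p).trans hp
  have c1 := cF_pos (A := Hsp (j + 1)) (a := a) hB
  have c2 := cF_pos (A := Hsp (j + 2)) (a := a) hB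
  have c3 : 0 < algConst (j + 2) ^ 2 := pow_pos (one_pos.trans_le (one_le_algConst _)) 2
  have hκ : 0 < κ := by linarith
  set n := ‖(incl (Nat.le_succ (j + 1)) : Hsp (j + 1 + 1) →L[ℝ] Hsp (j + 1))‖ with hn
  have hn0 : 0 ≤ n := norm_nonneg _
  set e := min 1 (σ / 2 / cF (Hsp (j + 1)) a B) with he
  have he0 : 0 < e := lt_min one_pos (by positivity)
  set d := min (1 / 2) (min (κ / (11 * cF (Hsp (j + 2)) a B * algConst (j + 2) ^ 2)) (e / (n + 1)))
    with hd
  have hd0 : 0 < d := lt_min (by norm_num) (lt_min (by positivity) (by positivity))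
  have hd1 : d ≤ κ / (11 * cF (Hsp (j + 2)) a B * algConst (j + 2) ^ 2) :=
    (min_le_right _ _).trans (min_le_left _ _)
  have hd2 : d ≤ e / (n + 1) := (min_le_right _ _).trans (min_le_right _ _)
  refine ⟨d, e, hd0, ⟨hT, hp, hq, hr, hσ, hσκ, hκ3, hd0.le, min_le_left _ _, ?_,
    min_le_left _ _, ?_⟩, ?_⟩
  · rw [le_div_iff₀ (by linarith)] at hd2
    rw [← hn]
    nlinarith
  · have := min_le_right 1 (σ / 2 / cF (Hsp (j + 1)) a B)
    rw [← he, le_div_iff₀ c1] at this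
    linarith
  · rw [le_div_iff₀ (by positivity)] at hd1
    linarith

end

end PolarisedT2

namespace PolarisedT2

noncomputable section

open Hsp

variable {j m : ℕ}

/-! ### Assembly of the asymptotics. -/

lemma IsSolution.exists_soln {P J Λ ℓ a T₀ : ℝ} {U₀ : Fin 6 → Circ → ℝ}
    {U : ℝ → Fin 6 → Circ → ℝ} (h : IsSolution P J Λ ℓ a T₀ (j + 3) U₀ U) :
    ∃ (u : ℝ → Fin 6 → Hsp (j + 2)) (du : ℝ → Fin 6 → Hsp (j + 1)),
      Soln ℓ a T₀ (P ^ 2) (fun t => J ^ 2 * t ^ (2 * (1 - 2 * ℓ)))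
        (fun t => 2 * Λ * t ^ (2 * (2 - ℓ))) u du ∧
      ∀ t ∈ Ioc 0 T₀, ∀ i, (u t i : Circ → ℝ) = U t i := by
  obtain ⟨hc, -, ⟨U', hd, he⟩, -⟩ := h
  -- `j + 3 - 1` reduces definitionally to `j + 1 + 1`, the order of the spaces `Hsp (j + 1)`.
  have hd' : ContDerivH (j + 1 + 1) (Ioc 0 T₀) U U' := hd
  obtain ⟨u, hu⟩ := exists_curve (m := j + 2) hc.1
  obtain ⟨du, hdu⟩ := exists_curve (m := j + 1) hd'.2.1.1
  refine ⟨u, du, ⟨fun i => ContH.continuousOn hc hu i, fun i t ht => ?_,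
    fun i => ContH.continuousOn hd'.2.1 hdu i, fun t ht hψ => ?_⟩, hu⟩
  · exact hd'.hasDerivWithinAt (u := fun s i => incl (Nat.le_succ (j + 1)) (u s i))
      (fun t ht i => (coe_incl _ _).trans (hu t ht i)) hdu i ht
  · refine sysEq_of_evolutionEq ?_ hψ
    rw [funext (hu t ht), funext (hdu t ht)]
    exact he t ht

lemma sobNormSq_eq (u : Fin 6 → Hsp (j + 2)) : sobNormSq u = normHv (j + 3) (fun i => u i) ^ 2 := by
  rw [normHv, Real.sq_sqrt (Finset.sum_nonneg fun i _ => sq_nonneg _), sobNormSq]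

lemma perpPart_sub (V : Fin 6 → Circ → ℝ) (f g : Circ → ℝ) :
    perpPart V - ![0, f, 0, g, 0, 0] = ![0, V 1 - f, 0, V 3 - g, 0, 0] := by
  funext i x
  have h : perpPart V = ![0, V 1, 0, V 3, 0, 0] := by
    funext i x
    fin_cases i <;>
      simp [perpPart, matP, stateAt, Matrix.mulVec,
        dotProduct, Fin.sum_univ_six]
  rw [h]
  fin_cases i <;> simp

lemma tendsto_perpPart {U : ℝ → Fin 6 → Circ → ℝ} {f g : ℝ → Hsp m} {w ψ : Hsp m} {T : ℝ}
    (hT : 0 < T) (hf : Tendsto f (𝓝[>] 0) (𝓝 w)) (hg : Tendsto g (𝓝[>] 0) (𝓝 ψ))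
    (hU : ∀ t ∈ Ioc 0 T, (f t : Circ → ℝ) = U t 1 ∧ (g t : Circ → ℝ) = U t 3) :
    Tendsto (fun t => normHv (m + 1) (perpPart (U t) - ![0, (w : Circ → ℝ), 0, ψ, 0, 0]))
      (𝓝[>] 0) (𝓝 0) := by
  have h1 := (tendsto_iff_norm_sub_tendsto_zero.mp hf).add (tendsto_iff_norm_sub_tendsto_zero.mp hg)
  rw [add_zero] at h1
  refine squeeze_zero' (Eventually.of_forall fun _ => Real.sqrt_nonneg _) ?_ h1
  filter_upwards [Ioc_mem_nhdsGT hT] with t ht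
  rw [perpPart_sub, ← (hU t ht).1, ← (hU t ht).2]
  have h2 := normHv_le_sum (![0, f t - w, 0, g t - ψ, 0, 0] : Fin 6 → Hsp m)
  have h3 : (fun i => ((![0, f t - w, 0, g t - ψ, 0, 0] : Fin 6 → Hsp m) i : Circ → ℝ))
      = ![0, (f t : Circ → ℝ) - w, 0, (g t : Circ → ℝ) - ψ, 0, 0] := by
    funext i
    fin_cases i <;> rfl
  rw [h3] at h2
  refine h2.trans (le_of_eq ?_)
  simp [Fin.sum_univ_six]

/-- The asymptotics of small solutions, in the Sobolev space `H^{j+3}`. -/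
theorem exists_asymptotics (T₀ : ℝ) (hT₀ : 0 < T₀) (j : ℕ) (P J Λ ℓ a : ℝ)
    (hadm : Admissible J Λ ℓ a) (σ : ℝ) (hσ0 : 0 < σ) (hσ : σ < 2 * kappa0 ℓ a / 3) :
    ∃ R₀ : ℝ, 0 < R₀ ∧ ∃ C : ℝ,
      ∀ U₀ : Fin 6 → Circ → ℝ, (∀ x, 0 < U₀ 0 x) → (∀ x, 0 < U₀ 5 x) →
        normHv (j + 3) U₀ < R₀ →
      ∀ U : ℝ → Fin 6 → Circ → ℝ, IsSolution P J Λ ℓ a T₀ (j + 3) U₀ U →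
        (∀ t ∈ Ioc 0 T₀, ∀ x, 0 < U t 0 x ∧ 0 < U t 5 x) ∧
        ∃ w₁ ψ : Circ → ℝ, MemH (j + 2) w₁ ∧ MemH (j + 2) ψ ∧ (∀ x, 0 < 1 + ψ x) ∧
          Tendsto (fun t => normHv (j + 2) (perpPart (U t) - ![0, w₁, 0, ψ, 0, 0]))
            (𝓝[>] 0) (𝓝 0) ∧
        ∃ w₂ η u ν : Circ → ℝ,
          MemH (j + 1) w₂ ∧ MemH (j + 1) η ∧ MemH (j + 2) u ∧ MemH (j + 2) ν ∧
          (∀ t ∈ Ioc 0 T₀,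
            BoundH (j + 1) (fun x => t⁻¹ * U t 2 x - log t * dθ w₁ x - w₂ x)
              (C * (t + t ^ (2 * kappa0 ℓ a - 3 * σ))) ∧
            BoundH (j + 1) (fun x => t⁻¹ * U t 4 x - η x)
              (C * (t + t ^ (2 * kappa0 ℓ a - 3 * σ))) ∧
            BoundH (j + 2) (fun x => log (U t 0 x) + (a + w₁ x - ℓ) * log t - u x)
              (C * (t + t ^ (2 * kappa0 ℓ a - 2 * σ))) ∧
            BoundH (j + 2) (fun x => log (U t 5 x) + (1 - (a + w₁ x) ^ 2) * log t - ν x)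
              (C * (t + t ^ (2 * kappa0 ℓ a - 2 * σ)))) ∧
          (ConstraintXi a T₀ U₀ → ConstraintW T₀ U₀ → ConstraintPsi T₀ U₀ →
            ∀ x, dθ ν x - 2 * (a + w₁ x) * w₂ x + 1 / 2 * (1 + ψ x)⁻¹ * η x = 0) := by
  set κ := kappa0 ℓ a with hκ
  have hκ1 : κ ≤ 1 := min_le_left _ _
  have hκ2 : κ ≤ ℓ - a := (min_le_right _ _).trans (min_le_right _ _)
  have hκ3 : κ ≤ a ^ 2 - 1 := (min_le_right _ _).trans (min_le_left _ _)
  have hσκ : 3 * σ < 2 * κ := by linarith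
  obtain ⟨B, hBp, hBq, hBr⟩ := exists_coeff_bound (P := P) hadm hT₀
  obtain ⟨d, e, hd0, hP, hdκ⟩ := exists_smallParams j hT₀ hBp hBq hBr hσ0 hσκ hκ3
  have hq := continuousOn_coeff (J ^ 2) (2 * (1 - 2 * ℓ)) T₀
  have hr := continuousOn_coeff (2 * Λ) (2 * (2 - ℓ)) T₀
  obtain ⟨C₁, hC₁, H₁⟩ := exists_slow_limits hP
  obtain ⟨C₂, hC₂, H₂⟩ := exists_w2_limit hP hC₁
  obtain ⟨C₄, hC₄, H₄⟩ := exists_eta_limit hP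
  obtain ⟨C₀, hC₀, H₀⟩ := exists_log_w0_limit hP hC₁
  obtain ⟨C₅, hC₅, H₅⟩ := exists_log_xi_limit hP hC₁ hq hr
  set A := algConst (j + 2) with hA
  have hA0 : 0 < A := one_pos.trans_le (one_le_algConst _)
  set E := exp (cG j * T₀ / 2) with hE
  have hE0 : 0 < E := exp_pos _
  have hE2 : exp (cG j * T₀) = E ^ 2 := by rw [sq, hE, ← Real.exp_add]; ring_nf
  set n := ‖(incl (Nat.le_succ j) : Hsp (j + 1) →L[ℝ] Hsp j)‖ with hn
  have hn0 : 0 ≤ n := norm_nonneg _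
  have hTσ : 0 ≤ T₀ ^ σ := Real.rpow_nonneg hT₀.le σ
  have hx1 : 0 ≤ C₂ * (1 + T₀ ^ σ) := by positivity
  have hx2 : 0 ≤ n * C₄ := by positivity
  have hθ := hP.rate_pos
  have hθ3 : 0 < 2 * κ - 3 * σ := by linarith
  -- `small_of_small_data` asks for `4 A² E² ‖U₀‖² < d²`, with `E²` the Gronwall factor; the radius
  -- is its square root form. All constants are nonnegative, so their sum serves every estimate.
  refine ⟨d / (2 * A * E), by positivity, C₂ * (1 + T₀ ^ σ) + n * C₄ + C₀ + C₅,
    fun U₀ hU0 hU5 hR U hU => ?_⟩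
  obtain ⟨u, du, hsol, huU⟩ := hU.exists_soln
  have hTm : T₀ ∈ Ioc 0 T₀ := right_mem_Ioc.mpr hT₀
  have hUT : U T₀ = U₀ := hU.2.2.2
  have huU₀ : ∀ i, (u T₀ i : Circ → ℝ) = U₀ i := fun i => by rw [huU T₀ hTm, hUT]
  have hdata : A ^ 2 * (4 * sobNormSq (u T₀) * exp (cG j * T₀)) < d ^ 2 := by
    rw [sobNormSq_eq, funext huU₀, hE2]
    rw [lt_div_iff₀ (by positivity)] at hR
    have h0 : 0 ≤ normHv (j + 3) U₀ := Real.sqrt_nonneg _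
    have h1 := pow_lt_pow_left₀ hR (by positivity) two_ne_zero
    calc _ = (normHv (j + 3) U₀ * (2 * A * E)) ^ 2 := by ring
      _ < d ^ 2 := h1
  have hs : SmallSoln ℓ a T₀ (P ^ 2) d (fun t => J ^ 2 * t ^ (2 * (1 - 2 * ℓ)))
      (fun t => 2 * Λ * t ^ (2 * (2 - ℓ))) u du :=
    ⟨hsol, small_of_small_data hsol hT₀ hBp hBq hBr (by linarith) hκ1 hκ2 hκ3 hd0.le hP.d_le
      hdκ hdata⟩
  have hpos := hs.pos hP hq hr (fun x => by rw [huU₀]; exact hU0 x)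
    (fun x => by rw [huU₀]; exact hU5 x)
  have hval : ∀ t ∈ Ioc 0 T₀, ∀ i x, U t i x = u t i x := fun t ht i x => by rw [huU t ht]
  obtain ⟨w, ψ, hw1, hψ, hlim⟩ := H₁ u du hs
  have hwl := fun t ht => (hlim t ht).1
  have hψl := fun t ht => (hlim t ht).2
  obtain ⟨w₂, hw₂⟩ := H₂ u du hs w hwl
  obtain ⟨η, hη⟩ := H₄ u du hs
  obtain ⟨L₀, G₀, hG₀, hL₀⟩ := H₀ u du hs (fun t ht x => (hpos t ht x).1) w hwl
  obtain ⟨L₅, G₅, hG₅, hL₅⟩ := H₅ u du hs (fun t ht x => (hpos t ht x).2) w hw1 hwl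
  refine ⟨fun t ht x => by rw [hval t ht, hval t ht]; exact hpos t ht x, w, ψ, w.memH, ψ.memH,
    fun x => by linarith [hψ x], ?_, w₂, (incl (Nat.le_succ j) η : Hsp j), L₀, L₅, w₂.memH,
    Hsp.memH _, L₀.memH, L₅.memH, fun t ht => ⟨?_, ?_, ?_, ?_⟩, ?_⟩
  · exact tendsto_perpPart hT₀ (tendsto_of_rate hT₀ hθ hwl) (tendsto_of_rate hT₀ hθ hψl)
      fun t ht => ⟨(coe_incl _ _).trans (huU t ht 1), (coe_incl _ _).trans (huU t ht 3)⟩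
  · refine boundH_of_norm_le (t⁻¹ • incl (Nat.le_succ j) (low (u t) 2) - log t • D w - w₂)
      (fun x => ?_) ((hw₂ t ht).trans ?_)
    · rw [hval t ht, dθ_eq]; rfl
    -- The rate found for `w₂` is `2κ - 2σ`; passing to the weaker exponent `2κ - 3σ` on `(0, T₀]`
    -- costs the factor `T₀ ^ σ`.
    · have h1 := rpow_le_const_mul_rpow (x := 2 * κ - 2 * σ) (y := 2 * κ - 3 * σ) (by linarith) ht
      have e1 : 2 * κ - 2 * σ - (2 * κ - 3 * σ) = σ := by ring
      rw [e1] at h1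
      have h2 := Real.rpow_nonneg ht.1.le (2 * κ - 3 * σ)
      have h3 : t + t ^ (2 * κ - 2 * σ) ≤ (1 + T₀ ^ σ) * (t + t ^ (2 * κ - 3 * σ)) := by
        have := mul_nonneg hTσ ht.1.le
        nlinarith
      calc _ ≤ C₂ * ((1 + T₀ ^ σ) * (t + t ^ (2 * κ - 3 * σ))) := mul_le_mul_of_nonneg_left h3 hC₂
        _ = C₂ * (1 + T₀ ^ σ) * (t + t ^ (2 * κ - 3 * σ)) := by ring
        _ ≤ _ := mul_le_mul_of_nonneg_right (by linarith) (by linarith [ht.1])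
  · refine boundH_of_norm_le (incl (Nat.le_succ j) (t⁻¹ • low (u t) 4 - η))
      (fun x => ?_) (((incl (Nat.le_succ j)).le_opNorm _).trans ?_)
    · rw [hval t ht]; rfl
    · have h2 := Real.rpow_nonneg ht.1.le (2 * κ - 3 * σ)
      calc _ ≤ n * (C₄ * (t + t ^ (2 * κ - 3 * σ))) := mul_le_mul_of_nonneg_left (hη t ht) hn0
        _ = n * C₄ * (t + t ^ (2 * κ - 3 * σ)) := by ring
        _ ≤ _ := mul_le_mul_of_nonneg_right (by linarith) (by linarith [ht.1])
  · refine boundH_of_norm_le (G₀ t) (fun x => ?_) ((hG₀ t ht).trans ?_)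
    · rw [hval t ht, hL₀ t ht]; ring
    · have h2 := Real.rpow_nonneg ht.1.le (2 * κ - 2 * σ)
      exact mul_le_mul_of_nonneg_right (by linarith) (by linarith [ht.1])
  · refine boundH_of_norm_le (G₅ t) (fun x => ?_) ((hG₅ t ht).trans ?_)
    · rw [hval t ht, hL₅ t ht]; ring
    · have h2 := Real.rpow_nonneg ht.1.le (2 * κ - 2 * σ)
      exact mul_le_mul_of_nonneg_right (by linarith) (by linarith [ht.1])
  · intro hXi hW hPsi x
    have hXi' := hXi x
    have hW' := hW x
    have hPsi' := hPsi x
    simp only [← huU₀, dθ_eq] at hXi' hW' hPsi'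
    have hT0 := hT₀.ne'
    have p0 := (hpos T₀ hTm x).1.ne'
    have p5 := (hpos T₀ hTm x).2.ne'
    have pψ : 1 + u T₀ 3 x ≠ 0 := by linarith [hs.one_add_psi_ge hP hTm x]
    have hWT : D (u T₀ 0) x / u T₀ 0 x + T₀⁻¹ * u T₀ 2 x = 0 := by
      rw [hW']; field_simp; ring
    have hdT : defects a u x T₀ = 0 := by
      have hD5 : D (u T₀ 5) x = T₀⁻¹ * (2 * u T₀ 2 x * (a + u T₀ 1 x) * u T₀ 5 x
          - u T₀ 4 x * u T₀ 5 x / (2 * (1 + u T₀ 3 x))) := by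
        rw [← hXi', ← mul_assoc, inv_mul_cancel₀ hT0, one_mul]
      refine Prod.ext ?_ ?_
      · simp only [defects, Prod.fst_zero]
        rw [hPsi']; ring
      · simp only [defects, Prod.snd_zero]
        rw [hD5]; field_simp; ring
    have key := hs.asymptotic_constraint hP (fun t ht x => (hpos t ht x).2) x
      (fun t ht => hs.defects_eq_zero hP hpos x hWT hdT ht) (hψ x) hwl hψl
      (tendsto_of_rate hT₀ hθ hw₂) (tendsto_of_rate hT₀ hθ3 hη)
      (tendsto_of_rate hT₀ hθ (L := 0) (fun t ht => by rw [sub_zero]; exact hG₅ t ht)) hL₅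
    rw [dθ_eq, key, incl_apply]
    have : 1 + ψ x ≠ 0 := by linarith [hψ x]
    field_simp
    ring

end

end PolarisedT2

theorem proposition4p3 (T₀ : ℝ) (hT₀ : 0 < T₀) (k : ℕ) (hk : 3 ≤ k) (P J Λ ℓ a : ℝ)
    (hadm : Admissible J Λ ℓ a) (σ : ℝ) (hσ0 : 0 < σ) (hσ : σ < 2 * kappa0 ℓ a / 3) :
    ∃ R₀ : ℝ, 0 < R₀ ∧ ∃ C : ℝ,
      ∀ U₀ : Fin 6 → Circ → ℝ, MemHv k U₀ → (∀ x, 0 < U₀ 0 x) → (∀ x, 0 < U₀ 5 x) →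
        normHv k U₀ < R₀ →
      ∀ U : ℝ → Fin 6 → Circ → ℝ, IsSolution P J Λ ℓ a T₀ k U₀ U →
        (∀ t ∈ Ioc 0 T₀, ∀ x, 0 < U t 0 x ∧ 0 < U t 5 x) ∧
        ∃ w₁ ψ : Circ → ℝ, MemH (k - 1) w₁ ∧ MemH (k - 1) ψ ∧ (∀ x, 0 < 1 + ψ x) ∧
          Tendsto (fun t => normHv (k - 1) (perpPart (U t) - ![0, w₁, 0, ψ, 0, 0]))
            (𝓝[>] 0) (𝓝 0) ∧
        ∃ w₂ η u ν : Circ → ℝ,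
          MemH (k - 2) w₂ ∧ MemH (k - 2) η ∧ MemH (k - 1) u ∧ MemH (k - 1) ν ∧
          (∀ t ∈ Ioc 0 T₀,
            BoundH (k - 2) (fun x => t⁻¹ * U t 2 x - log t * dθ w₁ x - w₂ x)
              (C * (t + t ^ (2 * kappa0 ℓ a - 3 * σ))) ∧
            BoundH (k - 2) (fun x => t⁻¹ * U t 4 x - η x)
              (C * (t + t ^ (2 * kappa0 ℓ a - 3 * σ))) ∧
            BoundH (k - 1) (fun x => log (U t 0 x) + (a + w₁ x - ℓ) * log t - u x)
              (C * (t + t ^ (2 * kappa0 ℓ a - 2 * σ))) ∧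
            BoundH (k - 1) (fun x => log (U t 5 x) + (1 - (a + w₁ x) ^ 2) * log t - ν x)
              (C * (t + t ^ (2 * kappa0 ℓ a - 2 * σ)))) ∧
          (ConstraintXi a T₀ U₀ → ConstraintW T₀ U₀ → ConstraintPsi T₀ U₀ →
            ∀ x, dθ ν x - 2 * (a + w₁ x) * w₂ x + 1 / 2 * (1 + ψ x)⁻¹ * η x = 0) := by
  -- With `k = j + 3`, the orders `k`, `k - 1` and `k - 2` are all successors, so the corresponding
  -- spaces are Banach algebras of the form `Hsp m`.
  obtain ⟨j, rfl⟩ : ∃ j, k = j + 3 := ⟨k - 3, by omega⟩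
  obtain ⟨R₀, hR₀, C, h⟩ := exists_asymptotics T₀ hT₀ j P J Λ ℓ a hadm σ hσ0 hσ
  exact ⟨R₀, hR₀, C, fun U₀ _ hU0 hU5 hR U hU => h U₀ hU0 hU5 hR U hU⟩
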